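/- **Setting.** Let $0<\epsilon\le\frac14$, and put $\Gamma=\frac{12}{\epsilon}$, $\alpha=\epsilon^{\frac1\epsilon+1}$, $\beta=\frac14\,\epsilon^{\frac4\epsilon+1}$. Let $T$ be a finite rooted tree with vertex set $V$, root $r$ (the depot) and edge weights $w\ge 0$, in which every non-leaf vertex has exactly two children; the terminals are the leaves of $T$. Let $k\ge 1$ be an integer (the tour capacity). Let $\mathrm{dist}(v)$ be the distance in $T$ from $r$ to $v$, and let $D_{\min}$, $D_{\max}$ be the minimum and maximum of $\mathrm{dist}$ over the terminals. Assume bounded distances: $D_{\max}<(1/\epsilon)^{\frac1\epsilon-1}D_{\min}$. A *solution* of the unit demand CVRP on a rooted tree with a finite family of terminals located at vertices is a finite family of closed walks from the root (tours), together with a choice, for each terminal, of exactly one tour that visits it and of a passage of that tour through its location at which it is picked up, such that each tour visits at most $k$ terminals. Its cost is the total weight of the edges on the tours, with multiplicity. Let $\mathrm{opt}$ be the optimal cost on $T$. A *subtour* of a tour at a vertex $u\ne r$ is a maximal part of the walk that stays in the subtree rooted at $u$ (so it starts and ends at $u$); its *demand* is the number of terminals picked up during it. **Components.** A *component decomposition*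 of $T$ is a partition $\mathcal C$ of the edges of $T$ into nonempty connected subgraphs (components) with the following properties. The root $r_c$ of $c\in\mathcal C$ is its vertex closest to $r$. A component is a *leaf* component if it contains all descendants of $r_c$, and *internal* otherwise. A leaf component meets other components only at $r_c$. An internal component has an exit vertex $e_c\neq r_c$, none of whose descendants other than $e_c$ itself is in $c$, where it meets another component, and it meets other components only at $r_c$ and $e_c$. Each component contains at most $2\Gamma k$ terminals; it is *big* if it contains at least $\Gamma k$. If $|\mathcal C|>1$, then each leaf component is big, there is a map from $\mathcal C$ to the big components sending each component to itself or to a descendant component such that each big component has at most three preimages, and $|\mathcal C|\le\frac3\Gamma$ times the number of terminals. **The tree $\hat T$.** Let $\tilde D=\alpha\epsilon D_{\min}$, and for $i\ge1$ let $\mathcal C_i=\{c\in\mathcal C:(i-1)\tilde D\le\mathrm{dist}(r_c)<i\tilde D\}$. Consider the maximal sets of components of a common class $\mathcal C_i$ that are connected through common vertices. The *critical vertex* $z$ of such a set is the topmost of the roots of its components. The tree $\hat T$ arises from $T$ by splitting off each component $c$ at its root, i.e. replacing $r_c$ inside $c$ by a new copy, and joining this copy as a child to the critical vertex $z$ of the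 set containing $c$ by an edge of weight $\mathrm{dist}(r_c)-\mathrm{dist}(z)$. The root of $\hat T$ is $r$. **Theorem.** A component decomposition of $T$ exists. For every component decomposition of $T$, there are finitely many dummy terminals at internal vertices of $\hat T$, and a solution $\mathrm{OPT}_3$ on $\hat T$ with capacity $k$ visiting all the real terminals (the leaves of $T$) and all the dummy terminals, such that: 1. for each component $c$, at most $\frac{2\Gamma}{\alpha}+1$ tours visit terminals located at vertices of $c$ other than (the copy of) its root; 2. for each critical vertex $z$ there is a set of at most $\frac1\beta$ integers in $[\alpha k,k]$ that contains the demands of all subtours of $\mathrm{OPT}_3$ at the children of $z$ in $\hat T$; 3. the cost of $\mathrm{OPT}_3$ is less than $(1+4\epsilon)\cdot\mathrm{opt}$. -/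

import Mathlib

open Finset

noncomputable section

namespace TreeCVRP

/-- A rooted, edge-weighted tree with vertex set `V`, given by its parent map: the edges are the
pairs `{v, parent v}` with `v ≠ root`, and `weight v` is the weight of the edge `{v, parent v}`
(the values `parent root = root` and `weight root` carry no information). -/
structure RootedTree (V : Type*) where
  root : V
  parent : V → V
  weight : V → ℝ
  parent_root : parent root = root
  reach : ∀ v, ∃ m : ℕ, parent^[m] v = root

namespace RootedTree

variable {V : Type*} (T : RootedTree V)

/-- `u` is an ancestor of `v`, possibly `v` itself; i.e. `v` lies in the subtree rooted at `u`. -/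
def IsAncestor (u v : V) : Prop := ∃ m : ℕ, T.parent^[m] v = u

/-- The number of edges between `v` and the root. -/
def depth (v : V) : ℕ := sInf {m : ℕ | T.parent^[m] v = T.root}

theorem depth_spec (v : V) : T.parent^[T.depth v] v = T.root := Nat.sInf_mem (T.reach v)

theorem depth_parent (v : V) (h : v ≠ T.root) : T.depth (T.parent v) < T.depth v := by
  have h1 := T.depth_spec v
  rcases hm : T.depth v with _ | m
  · rw [hm] at h1
    exact absurd h1 h
  · rw [hm, Function.iterate_succ_apply] at h1
    exact Nat.lt_succ_of_le (Nat.sInf_le h1)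

/-- The (weighted) distance between `v` and the root. -/
def dist (v : V) : ℝ := ∑ i ∈ range (T.depth v), T.weight (T.parent^[i] v)

/-- The children of `v`. -/
def children (v : V) : Set V := {u | u ≠ T.root ∧ T.parent u = v}

/-- The leaves of the tree. -/
def leaves : Set V := {v | T.children v = ∅}

/-- Every vertex that is not a leaf has exactly two children. -/
def IsBinary : Prop := ∀ v, v ∉ T.leaves → (T.children v).ncard = 2

/-- The underlying undirected graph. -/
def graph : SimpleGraph V := SimpleGraph.fromRel fun u v => T.parent u = v

open Classical in
/-- The weight of the edge between two adjacent vertices. -/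
def edgeWeight (u v : V) : ℝ := if T.parent u = v then T.weight u else T.weight v

variable {T} in
/-- The cost of a walk: the total weight of the edges on it, with multiplicity. -/
def walkCost {u v : V} (p : T.graph.Walk u v) : ℝ :=
  (p.darts.map fun d => T.edgeWeight d.fst d.snd).sum

variable {T} in
/-- The part of the walk `p` between the times `a` and `b` is a *subtour at `u`*: it is a maximal
part of `p` that stays in the subtree rooted at `u`. (If `p` is a closed walk from the root and
`u` is not the root, such a part starts and ends at `u`.) -/
def IsSubtour {x y : V} (p : T.graph.Walk x y) (u : V) (a b : ℕ) : Prop :=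
  a ≤ b ∧ b ≤ p.length ∧
  (∀ j, a ≤ j → j ≤ b → T.IsAncestor u (p.getVert j)) ∧
  (∀ j, j + 1 = a → ¬ T.IsAncestor u (p.getVert j)) ∧
  (b < p.length → ¬ T.IsAncestor u (p.getVert (b + 1)))

/-- The minimum distance between the depot and a terminal, where the terminals are the leaves. -/
def Dmin : ℝ := sInf (T.dist '' T.leaves)

/-- The maximum distance between the depot and a terminal, where the terminals are the leaves. -/
def Dmax : ℝ := sSup (T.dist '' T.leaves)

/-- Bounded distances. -/
def BoundedDistances (ε : ℝ) : Prop := T.Dmax < (1 / ε) ^ (1 / ε - 1) * T.Dmin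

end RootedTree

/-! ### Unit demand capacitated vehicle routing -/

/-- A feasible solution of the unit demand CVRP on the tree `T` with depot `T.root` and capacity
`k`, where `τ` is the finite set of terminals (each carrying one token) and the terminal `x` is located
at the vertex `loc x`. It consists of finitely many tours, i.e. closed walks from the depot. The
terminal `x` is visited by exactly one tour, namely `visitor x`, which picks up the token of `x`
at step `time x`, when the tour is at the vertex `loc x`. A tour visits at most `k` terminals. -/
structure Solution {V : Type*} (T : RootedTree V) {τ : Type*} [Finite τ]
    (loc : τ → V) (k : ℕ) where
  numTours : ℕ
  tour : Fin numTours → T.graph.Walk T.root T.root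
  visitor : τ → Fin numTours
  time : τ → ℕ
  time_le : ∀ x, time x ≤ (tour (visitor x)).length
  getVert_time : ∀ x, (tour (visitor x)).getVert (time x) = loc x
  capacity : ∀ i, {x | visitor x = i}.ncard ≤ k

namespace Solution

variable {V : Type*} {T : RootedTree V} {τ : Type*} [Finite τ] {loc : τ → V} {k : ℕ}

/-- The total cost of the tours. -/
def cost (S : Solution T loc k) : ℝ := ∑ i, RootedTree.walkCost (S.tour i)

/-- The number of terminals visited by the `i`-th tour between the times `a` and `b`. -/
def demandBetween (S : Solution T loc k) (i : Fin S.numTours) (a b : ℕ) : ℕ :=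
  {x | S.visitor x = i ∧ a ≤ S.time x ∧ S.time x ≤ b}.ncard

end Solution

/-- The optimal cost of the unit demand CVRP on `T` with capacity `k`, one terminal at each
leaf. -/
def opt {V : Type*} [Finite V] (T : RootedTree V) (k : ℕ) : ℝ :=
  ⨅ S : Solution T (fun x : T.leaves => (x : V)) k, S.cost

/-! ### Decomposition into components -/

section Decomposition

variable {V : Type*} [Fintype V] [DecidableEq V]

/-- The edges of `T`; the edge `{v, parent v}` is represented by its lower endpoint `v`. -/
def RootedTree.edges (T : RootedTree V) : Finset V := univ.erase T.root

/-- A partition of the edges of `T` into connected subgraphs (components). The vertex `top c` is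
the vertex of the component `c` that is closest to the depot: climbing up from any edge of `c`,
one stays inside `c` until `top c` is reached, and the edge above `top c` is not in `c`. -/
structure Decomposition (T : RootedTree V) where
  partition : Finpartition T.edges
  top : {c // c ∈ partition.parts} → V
  top_notMem : ∀ c, top c ∉ c.1
  connected : ∀ c, ∀ v ∈ c.1, T.parent v = top c ∨ T.parent v ∈ c.1

namespace Decomposition

variable {T : RootedTree V} (D : Decomposition T)

/-- The type of components. -/
abbrev Comp : Type _ := {c // c ∈ D.partition.parts}

/-- The vertices of a component: its root, and the lower endpoints of its edges. -/
def verts (c : D.Comp) : Finset V := insert (D.top c) c.1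

/-- A component is a leaf component if it contains all descendants of its root; otherwise it is
an internal component. -/
def IsLeaf (c : D.Comp) : Prop := ∀ u, T.IsAncestor (D.top c) u → u ∈ D.verts c

/-- The number of terminals (leaves of `T`) in a component. -/
def numTerminals (c : D.Comp) : ℕ := {v | v ∈ D.verts c ∧ v ∈ T.leaves}.ncard

/-- A component is big if it contains at least `Γ k` terminals. -/
def IsBig (Γ : ℝ) (k : ℕ) (c : D.Comp) : Prop := Γ * k ≤ D.numTerminals c

/-- `c'` is `c` or a descendant of `c`, i.e. a component whose root is below a vertex of `c`
other than the root of `c`. -/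
def IsBelow (c c' : D.Comp) : Prop := c' = c ∨ ∃ v ∈ c.1, T.IsAncestor v (D.top c')

/-- The properties of a component decomposition with parameter `Γ` for the capacity `k`. -/
structure Admissible (Γ : ℝ) (k : ℕ) : Prop where
  /-- A leaf component meets other components at its root only. -/
  leaf_meets : ∀ c, D.IsLeaf c → ∀ c', c' ≠ c → ∀ x, x ∈ D.verts c → x ∈ D.verts c' →
    x = D.top c
  /-- An internal component has an exit vertex `e`, different from its root and without
  descendants in the component, where it meets another component, and it meets other components
  at its root and at `e` only. -/
  internal_meets : ∀ c, ¬ D.IsLeaf c → ∃ e ∈ c.1, (∀ v ∈ c.1, T.parent v ≠ e) ∧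
    (∃ c', c' ≠ c ∧ e ∈ D.verts c') ∧
    ∀ c', c' ≠ c → ∀ x, x ∈ D.verts c → x ∈ D.verts c' → x = D.top c ∨ x = e
  numTerminals_le : ∀ c, (D.numTerminals c : ℝ) ≤ 2 * Γ * k
  leaf_big : 1 < #D.partition.parts → ∀ c, D.IsLeaf c → D.IsBig Γ k c
  exists_map : 1 < #D.partition.parts → ∃ f : D.Comp → D.Comp,
    (∀ c, D.IsBig Γ k (f c) ∧ D.IsBelow c (f c)) ∧ ∀ b, {c | f c = b}.ncard ≤ 3
  card_le : 1 < #D.partition.parts → (#D.partition.parts : ℝ) ≤ 3 / Γ * T.leaves.ncard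

/-! ### Height reduction -/

/-- The `i`-th class of components for the step length `s`: the distance between the root of the
component and the depot lies in `[(i - 1) s, i s)`. -/
def level (s : ℝ) (i : ℕ) : Set D.Comp :=
  {c | ((i : ℝ) - 1) * s ≤ T.dist (D.top c) ∧ T.dist (D.top c) < i * s}

/-- Two components of the same class that have a common vertex. -/
def Linked (s : ℝ) (c c' : D.Comp) : Prop :=
  (∃ i : ℕ, c ∈ D.level s i ∧ c' ∈ D.level s i) ∧ ∃ x, x ∈ D.verts c ∧ x ∈ D.verts c'

/-- The maximally connected set of components (within its class) that contains `c`. -/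
def cluster (s : ℝ) (c : D.Comp) : Set D.Comp := {c' | Relation.ReflTransGen (D.Linked s) c c'}

/-- The critical vertex of the maximally connected set that contains `c`: among the roots of the
components in that set, the one closest to the depot. (All these roots are descendants of one
of them; edges may have weight `0`, so the comparison is made by the number of edges.) -/
def critical (s : ℝ) (c : D.Comp) : V :=
  D.top (Function.argminOn (fun c' => T.depth (D.top c')) (D.cluster s c)
    ⟨c, Relation.ReflTransGen.refl⟩)

/-- The parent map of the tree `T̂`. Its vertices are the vertices `v` of `T` (as `Sum.inl v`) and
a new copy `Sum.inr c` of the root of each component `c`. The copy of the root of `c` replaces that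
root inside of `c`, and it is a child of the critical vertex of the set that contains `c`. -/
def hatParent (s : ℝ) : V ⊕ D.Comp → V ⊕ D.Comp
  | .inl v =>
    if h : v ∈ T.edges then
      if T.parent v = D.top ⟨D.partition.part v, D.partition.part_mem.2 h⟩ then
        .inr ⟨D.partition.part v, D.partition.part_mem.2 h⟩
      else .inl (T.parent v)
    else .inl T.root
  | .inr c => .inl (D.critical s c)

theorem depth_critical_le (s : ℝ) (c : D.Comp) :
    T.depth (D.critical s c) ≤ T.depth (D.top c) :=
  Function.argminOn_le (fun c' => T.depth (D.top c')) (D.cluster s c)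
    (a := c) Relation.ReflTransGen.refl

theorem hat_reach (s : ℝ) (x : V ⊕ D.Comp) :
    ∃ m : ℕ, (D.hatParent s)^[m] x = .inl T.root := by
  suffices H : ∀ (n : ℕ) (x : V ⊕ D.Comp),
      Sum.elim (fun v => 2 * T.depth v) (fun c => 2 * T.depth (D.top c) + 1) x < n →
      ∃ m : ℕ, (D.hatParent s)^[m] x = .inl T.root from H _ x (Nat.lt_succ_self _)
  intro n
  induction n with
  | zero => intro x hx; exact absurd hx (Nat.not_lt_zero _)
  | succ n ih =>
    intro x hx
    by_cases hroot : x = .inl T.root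
    · exact ⟨0, hroot⟩
    · have key : Sum.elim (fun v => 2 * T.depth v) (fun c => 2 * T.depth (D.top c) + 1)
          (D.hatParent s x) < n := by
        rcases x with v | c
        · have hv : v ≠ T.root := fun h => hroot (by rw [h])
          have hmem : v ∈ T.edges := by simp [RootedTree.edges, hv]
          have hd := T.depth_parent v hv
          simp only [Sum.elim_inl] at hx
          simp only [hatParent, hmem, dite_true]
          split_ifs with h1
          · simp only [Sum.elim_inr, ← h1]
            omega
          · simp only [Sum.elim_inl]
            omega
        · have := D.depth_critical_le s c
          simp only [Sum.elim_inr] at hx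
          simp only [hatParent, Sum.elim_inl]
          omega
      obtain ⟨m, hm⟩ := ih _ key
      exact ⟨m + 1, by rw [Function.iterate_succ_apply]; exact hm⟩

/-- The tree `T̂`. Edges inside the components keep their weights. The edge between the critical
vertex `z` and the copy of the root of `c` has as its weight the distance in `T` between `z` and
the root of `c` (of which `z` is an ancestor). -/
def hat (s : ℝ) : RootedTree (V ⊕ D.Comp) where
  root := .inl T.root
  parent := D.hatParent s
  weight := Sum.elim T.weight fun c => T.dist (D.top c) - T.dist (D.critical s c)
  parent_root := by simp [hatParent, RootedTree.edges]
  reach := D.hat_reach s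

/-- The locations in `T̂` of the real terminals, i.e. the leaves of `T`, and of `d` dummy
terminals. -/
def hatLoc {d : ℕ} (place : Fin d → V ⊕ D.Comp) : T.leaves ⊕ Fin d → V ⊕ D.Comp :=
  Sum.elim (fun v => .inl v) place

end Decomposition

end Decomposition

/-! ### Constants -/

/-- `Γ = 12 / ε`. -/
def Gam (ε : ℝ) : ℝ := 12 / ε

/-- `α = ε ^ (1 / ε + 1)`. -/
def alpha (ε : ℝ) : ℝ := ε ^ (1 / ε + 1)

/-- `β = 1/4 · ε ^ (4 / ε + 1)`. -/
def beta (ε : ℝ) : ℝ := 1 / 4 * ε ^ (4 / ε + 1)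

/-- The step length `α · ε · Dmin` of the classes of components. -/
def step {V : Type*} (T : RootedTree V) (ε : ℝ) : ℝ := alpha ε * ε * T.Dmin

end TreeCVRP

end

/-!
A set `U` of vertices visited by a tour forces a cost of at least twice the weight of the subtree
spanned by the root and `U` (`two_mul_spanWeight_le_walkCost`), and a depth first traversal of this
subtree attains this bound. So only the assignment of the terminals to tours matters: the cost of
a solution is compared with the sum of the spanned weights (`totalSpan`), and at the end a forest of
visits that lies over the tree is turned into walks (`exists_solution_of_forest`).

Three facts make small changes affordable. Big components have many terminals, and every component
is charged to a big one, so that one additional tour per component, from the depot through the spine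
of the component, costs only `O(1 / Γ)` times the optimum (`sum_overhead_le`). By the bounded
distances, a tour to any place is more expensive than any nonempty tour by at most a factor that
depends only on `ε`. And a tour that visits at least `α k` terminals, real or dummy ones, in each
component that it meets, meets at most `1 / α` components.

* Few tours per component (`exists_few_tours_per_component`). The pieces in which a tour holds less
  than `α k` terminals of a component are grouped to sizes in `[α k, 2 α k)`. By a rounding of
  fractional assignments, based on Hall's theorem (`exists_rounded_assignment`), each group goes to
  a tour that holds a part of it, without increasing the load of a tour, if each tour may refuse one
  group. Refused groups are packed into new tours, few compared to the number of tours.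
* Height reduction (`spanWeight_hat_le`). Among the components of a tour that are moved to the same
  critical vertex, the topmost one is paid for by the path from the critical vertex to its root,
  which the tour no longer uses. The other ones cost less than the step length each, and they are at
  most as many as the components in which the tour visits terminals.
* Few demands (`exists_rearranged_solution`). At each critical vertex the pieces that hang there are
  sorted by demand and cut into groups. The pieces of the group with the largest demands are detached
  and get tours of their own, every other piece takes the place of a piece of the group before, and
  dummy terminals raise its demand to the largest one in its group (`exists_rounded_demands`). Since
  every piece replaces a larger one, no tour exceeds its capacity, although this
  is done at all critical vertices at once.

For the existence of a component decomposition (`exists_admissible`) the tree is cut at the root, at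
all vertices with two children above at least `Γ k` leaves each, and, from the leaves upwards,
whenever `Γ k` leaves have not been cut off yet. At a vertex with two such children each child edge
starts a component of its own. The components that are not big are mapped to big ones by walking
down along vertices above at least `Γ k` leaves, where two walks are kept apart at each branching
(`exists_heavy_descent`).
-/

noncomputable section

namespace TreeCVRP

open scoped Classical

namespace RootedTree

variable {V : Type*} (T : RootedTree V)

theorem isAncestor_refl (v : V) : T.IsAncestor v v := ⟨0, rfl⟩

variable {T}

theorem IsAncestor.trans {u v w : V} (h : T.IsAncestor u v) (h' : T.IsAncestor v w) :
    T.IsAncestor u w := by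
  obtain ⟨m, rfl⟩ := h
  obtain ⟨n, rfl⟩ := h'
  exact ⟨m + n, by rw [Function.iterate_add_apply]⟩

variable (T)

theorem isAncestor_parent (v : V) : T.IsAncestor (T.parent v) v := ⟨1, rfl⟩

theorem isAncestor_root (v : V) : T.IsAncestor T.root v := T.reach v

theorem depth_root : T.depth T.root = 0 := by
  have : T.depth T.root ≤ 0 := Nat.sInf_le (m := 0) (by simp)
  omega

variable {T}

theorem depth_eq_zero {v : V} : T.depth v = 0 ↔ v = T.root := by
  constructor
  · intro h
    have := T.depth_spec v
    rwa [h] at this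
  · rintro rfl
    exact T.depth_root

theorem depth_eq {v : V} (h : v ≠ T.root) : T.depth v = T.depth (T.parent v) + 1 := by
  refine le_antisymm (Nat.sInf_le ?_) (T.depth_parent v h)
  change T.parent^[_ + 1] v = _
  rw [Function.iterate_succ_apply]
  exact T.depth_spec _

theorem depth_parent_le (v : V) : T.depth (T.parent v) ≤ T.depth v := by
  by_cases h : v = T.root
  · rw [h, T.parent_root]
  · exact (T.depth_parent v h).le

theorem IsAncestor.eq_or_parent {u v : V} (h : T.IsAncestor u v) :
    u = v ∨ v ≠ T.root ∧ T.IsAncestor u (T.parent v) := by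
  obtain ⟨m, hm⟩ := h
  by_cases hv : v = T.root
  · left
    rw [← hm, hv]
    exact (Function.iterate_fixed T.parent_root m)
  · cases m with
    | zero => exact Or.inl hm.symm
    | succ m => exact Or.inr ⟨hv, m, by rwa [Function.iterate_succ_apply] at hm⟩

/-- Induction along the path from `v` up to its ancestor `u`. -/
theorem IsAncestor.induction {u : V} {p : V → Prop} (base : p u)
    (succ : ∀ v, v ≠ T.root → T.IsAncestor u (T.parent v) → p (T.parent v) → p v)
    {v : V} (h : T.IsAncestor u v) : p v := by
  obtain ⟨m, hm⟩ := h
  induction m generalizing v with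
  | zero =>
    obtain rfl : v = u := hm
    exact base
  | succ m ih =>
    rw [Function.iterate_succ_apply] at hm
    by_cases hv : v = T.root
    · have : T.parent v = v := by rw [hv, T.parent_root]
      rw [this] at hm
      exact ih hm
    · exact succ v hv ⟨m, hm⟩ (ih hm)

theorem IsAncestor.depth_le {u v : V} (h : T.IsAncestor u v) : T.depth u ≤ T.depth v :=
  h.induction (p := fun v => T.depth u ≤ T.depth v) le_rfl
    fun v _ _ ih => ih.trans (T.depth_parent_le v)

theorem IsAncestor.eq_of_depth_le {u v : V} (h : T.IsAncestor u v) (hd : T.depth v ≤ T.depth u) :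
    u = v := by
  rcases h.eq_or_parent with h | ⟨hv, h⟩
  · exact h
  · have := h.depth_le
    have := T.depth_parent v hv
    omega

theorem IsAncestor.antisymm {u v : V} (h : T.IsAncestor u v) (h' : T.IsAncestor v u) : u = v :=
  h.eq_of_depth_le h'.depth_le

theorem IsAncestor.depth_lt {u v : V} (h : T.IsAncestor u v) (hne : u ≠ v) :
    T.depth u < T.depth v := by
  by_contra hd
  exact hne (h.eq_of_depth_le (not_lt.1 hd))

theorem IsAncestor.parent_of_ne {u v : V} (h : T.IsAncestor u v) (hne : u ≠ v) :
    T.IsAncestor u (T.parent v) :=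
  (h.eq_or_parent.resolve_left hne).2

theorem IsAncestor.ne_root {u v : V} (h : T.IsAncestor u v) (hu : u ≠ T.root) : v ≠ T.root := by
  rintro rfl
  exact hu (h.antisymm (T.isAncestor_root u))

/-- Two ancestors of the same vertex are comparable. -/
theorem IsAncestor.total {u u' v : V} (h : T.IsAncestor u v) (h' : T.IsAncestor u' v) :
    T.IsAncestor u u' ∨ T.IsAncestor u' u := by
  revert h'
  refine h.induction (p := fun v => T.IsAncestor u' v → _) Or.inr ?_
  intro v hv h1 ih h'
  rcases h'.eq_or_parent with rfl | ⟨_, h2⟩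
  · exact Or.inl (h1.trans (T.isAncestor_parent _))
  · exact ih h2

theorem IsAncestor.of_depth_le {u u' v : V} (h : T.IsAncestor u v) (h' : T.IsAncestor u' v)
    (hd : T.depth u ≤ T.depth u') : T.IsAncestor u u' := by
  rcases h.total h' with h1 | h1
  · exact h1
  · rw [h1.eq_of_depth_le hd]
    exact T.isAncestor_refl u

theorem not_isAncestor_parent {v : V} (hv : v ≠ T.root) : ¬ T.IsAncestor v (T.parent v) := by
  intro h
  have := h.depth_le
  have := T.depth_parent v hv
  omega

theorem IsAncestor.exists_child {u v : V} (h : T.IsAncestor u v) (hne : u ≠ v) :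
    ∃ w, w ≠ T.root ∧ T.parent w = u ∧ T.IsAncestor w v := by
  revert hne
  refine h.induction (p := fun v => u ≠ v → ∃ w, w ≠ T.root ∧ T.parent w = u ∧ T.IsAncestor w v)
    (fun h => absurd rfl h) ?_
  intro v hv h1 ih hne
  by_cases hu : u = T.parent v
  · exact ⟨v, hv, hu.symm, T.isAncestor_refl v⟩
  · obtain ⟨w, hw, hw1, hw2⟩ := ih hu
    exact ⟨w, hw, hw1, hw2.trans (T.isAncestor_parent v)⟩

variable (T)

theorem graph_adj {u v : V} : T.graph.Adj u v ↔ u ≠ v ∧ (T.parent u = v ∨ T.parent v = u) := by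
  simp [graph, SimpleGraph.fromRel_adj]

variable {T}

theorem parent_ne {v : V} (hv : v ≠ T.root) : T.parent v ≠ v := by
  intro h
  have := T.depth_parent v hv
  rw [h] at this
  omega

theorem adj_parent {v : V} (hv : v ≠ T.root) : T.graph.Adj (T.parent v) v :=
  (T.graph_adj).2 ⟨parent_ne hv, Or.inr rfl⟩

theorem edgeWeight_self_parent (v : V) : T.edgeWeight v (T.parent v) = T.weight v := by
  simp [edgeWeight]

theorem edgeWeight_parent_self {v : V} (hv : v ≠ T.root) :
    T.edgeWeight (T.parent v) v = T.weight v := by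
  unfold edgeWeight
  rw [if_neg]
  intro h
  have h1 := T.depth_parent v hv
  have h2 := T.depth_parent_le (T.parent v)
  rw [h] at h2
  omega

theorem edgeWeight_nonneg (hw : ∀ v, v ≠ T.root → 0 ≤ T.weight v) {u v : V}
    (h : T.graph.Adj u v) : 0 ≤ T.edgeWeight u v := by
  obtain ⟨hne, h⟩ := (T.graph_adj).1 h
  unfold edgeWeight
  split_ifs with h1
  · apply hw
    rintro rfl
    exact hne (by rw [← h1, T.parent_root])
  · apply hw
    rintro rfl
    exact hne (by rw [← h.resolve_left h1, T.parent_root])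

/-! ### Distances and walks -/

theorem dist_root : T.dist T.root = 0 := by
  simp [dist, depth_root]

theorem dist_eq {v : V} (hv : v ≠ T.root) : T.dist v = T.weight v + T.dist (T.parent v) := by
  unfold dist
  rw [depth_eq hv, sum_range_succ']
  simp only [Function.iterate_succ_apply, Function.iterate_zero, id]
  ring

theorem IsAncestor.dist_le (hw : ∀ v, v ≠ T.root → 0 ≤ T.weight v) {u v : V}
    (h : T.IsAncestor u v) : T.dist u ≤ T.dist v :=
  h.induction (p := fun v => T.dist u ≤ T.dist v) le_rfl fun v hv _ ih => by
    rw [dist_eq hv]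
    linarith [hw v hv]

theorem dist_nonneg (hw : ∀ v, v ≠ T.root → 0 ≤ T.weight v) (v : V) : 0 ≤ T.dist v := by
  have := (T.isAncestor_root v).dist_le hw
  rwa [dist_root] at this

theorem eq_of_isAncestor_of_leaf {x v : V} (hx : x ∈ T.leaves) (h : T.IsAncestor x v) : x = v := by
  by_contra hne
  obtain ⟨w, hw1, hw2, -⟩ := h.exists_child hne
  have : w ∈ T.children x := ⟨hw1, hw2⟩
  rw [show T.children x = ∅ from hx] at this
  exact this

theorem walkCost_append {u v w : V} (p : T.graph.Walk u v) (q : T.graph.Walk v w) :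
    walkCost (p.append q) = walkCost p + walkCost q := by
  simp [walkCost, SimpleGraph.Walk.darts_append]

theorem walkCost_cons {u v w : V} (h : T.graph.Adj u v) (q : T.graph.Walk v w) :
    walkCost (SimpleGraph.Walk.cons h q) = T.edgeWeight u v + walkCost q := by
  simp [walkCost]

theorem walkCost_nonneg (hw : ∀ v, v ≠ T.root → 0 ≤ T.weight v) {u v : V}
    (p : T.graph.Walk u v) : 0 ≤ walkCost p := by
  refine List.sum_nonneg ?_
  intro x hx
  obtain ⟨d, -, rfl⟩ := List.mem_map.1 hx
  exact edgeWeight_nonneg hw d.adj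

/-- A walk that enters the subtree rooted at `u` does so along the edge above `u`. -/
theorem eq_of_boundary {u x y : V} (hadj : T.graph.Adj x y) (hx : ¬ T.IsAncestor u x)
    (hy : T.IsAncestor u y) : y = u ∧ T.parent u = x := by
  obtain ⟨-, h | h⟩ := (T.graph_adj).1 hadj
  · exact absurd (hy.trans (h ▸ T.isAncestor_parent x)) hx
  · rcases hy.eq_or_parent with h1 | ⟨-, h1⟩
    · exact ⟨h1.symm, h1 ▸ h⟩
    · exact absurd (h ▸ h1) hx

/-! ### Spanned subtrees -/

variable [Fintype V]

variable (T) in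
/-- The edges (given by their lower endpoints) of the subtree spanned by the root and `U`. -/
def span (U : Set V) : Finset V := {u | u ≠ T.root ∧ ∃ x ∈ U, T.IsAncestor u x}

theorem mem_span {U : Set V} {u : V} :
    u ∈ T.span U ↔ u ≠ T.root ∧ ∃ x ∈ U, T.IsAncestor u x := by
  simp [span]

variable (T) in
/-- The total weight of the subtree spanned by the root and `U`; a tour that visits `U` costs at
least twice as much, and a depth first traversal of this subtree costs exactly that. -/
def spanWeight (U : Set V) : ℝ := ∑ u ∈ T.span U, T.weight u

theorem spanWeight_nonneg (hw : ∀ v, v ≠ T.root → 0 ≤ T.weight v) (U : Set V) :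
    0 ≤ T.spanWeight U :=
  sum_nonneg fun u hu => hw u (mem_span.1 hu).1

theorem mem_span_singleton {u v : V} :
    u ∈ T.span {v} ↔ u ≠ T.root ∧ T.IsAncestor u v := by
  simp [mem_span]

theorem span_singleton_eq {v : V} (hv : v ≠ T.root) :
    T.span {v} = insert v (T.span {T.parent v}) := by
  ext u
  rw [mem_insert, mem_span_singleton, mem_span_singleton]
  constructor
  · rintro ⟨h1, h2⟩
    rcases h2.eq_or_parent with h | h
    · exact Or.inl h
    · exact Or.inr ⟨h1, h.2⟩
  · rintro (rfl | h)
    · exact ⟨hv, T.isAncestor_refl u⟩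
    · exact ⟨h.1, h.2.trans (T.isAncestor_parent v)⟩

theorem dist_eq_spanWeight (v : V) : T.dist v = T.spanWeight {v} := by
  refine (T.isAncestor_root v).induction (p := fun v => T.dist v = T.spanWeight {v}) ?_ ?_
  · rw [dist_root, spanWeight, sum_eq_zero]
    intro u hu
    obtain ⟨h1, h2⟩ := mem_span_singleton.1 hu
    exact absurd (h2.antisymm (T.isAncestor_root u)) h1
  · intro v hv _ ih
    rw [dist_eq hv, ih, spanWeight, spanWeight, span_singleton_eq hv, sum_insert]
    rw [mem_span_singleton]
    exact fun h => not_isAncestor_parent hv h.2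

theorem dist_le_spanWeight (hw : ∀ v, v ≠ T.root → 0 ≤ T.weight v) {U : Set V} {x v : V}
    (hx : x ∈ U) (hv : T.IsAncestor v x) : T.dist v ≤ T.spanWeight U := by
  rw [dist_eq_spanWeight]
  refine sum_le_sum_of_subset_of_nonneg ?_ fun u hu _ => hw u (mem_span.1 hu).1
  intro u hu
  obtain ⟨h1, h2⟩ := mem_span_singleton.1 hu
  exact mem_span.2 ⟨h1, x, hx, h2.trans hv⟩

/-- Below each vertex there is a leaf. -/
theorem exists_leaf (v : V) : ∃ x ∈ T.leaves, T.IsAncestor v x := by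
  obtain ⟨x, hx, hmax⟩ := exists_max_image (univ.filter fun x => T.IsAncestor v x) T.depth
    ⟨v, by simp [T.isAncestor_refl]⟩
  refine ⟨x, ?_, by simpa using hx⟩
  by_contra hleaf
  obtain ⟨y, hy1, hy2⟩ : (T.children x).Nonempty := Set.nonempty_iff_ne_empty.2 hleaf
  have h1 := hmax y (by
    simp only [mem_filter, mem_univ, true_and] at hx ⊢
    exact hx.trans (hy2 ▸ T.isAncestor_parent y))
  have h2 := T.depth_parent y hy1
  rw [hy2] at h2
  omega

/-- A closed walk from the root that visits all of `U` uses each edge of the spanned subtree at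
least once in each direction. -/
theorem two_mul_spanWeight_le_walkCost (hw : ∀ v, v ≠ T.root → 0 ≤ T.weight v) {U : Set V}
    (p : T.graph.Walk T.root T.root) (hU : ∀ x ∈ U, x ∈ p.support) :
    2 * T.spanWeight U ≤ walkCost p := by
  have down : ∀ u ∈ T.span U, ∃ d ∈ p.darts, d.fst = T.parent u ∧ d.snd = u := by
    intro u hu
    obtain ⟨h1, x, hx, h2⟩ := mem_span.1 hu
    obtain ⟨d, hd, hd1, hd2⟩ := (p.takeUntil x (hU x hx)).exists_boundary_dart
      {y | ¬ T.IsAncestor u y}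
      (fun h => h1 (h.antisymm (T.isAncestor_root u))) (fun h => h h2)
    obtain ⟨e1, e2⟩ := eq_of_boundary d.adj hd1 (not_not.1 hd2)
    exact ⟨d, p.darts_takeUntil_subset_darts _ hd, e2.symm, e1⟩
  have up : ∀ u ∈ T.span U, ∃ d ∈ p.darts, d.fst = u ∧ d.snd = T.parent u := by
    intro u hu
    obtain ⟨h1, x, hx, h2⟩ := mem_span.1 hu
    obtain ⟨d, hd, hd1, hd2⟩ := (p.dropUntil x (hU x hx)).exists_boundary_dart
      {y | T.IsAncestor u y} h2 (fun h => h1 (IsAncestor.antisymm h (T.isAncestor_root u)))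
    obtain ⟨e1, e2⟩ := eq_of_boundary d.adj.symm hd2 hd1
    exact ⟨d, p.darts_dropUntil_subset_darts _ hd, e1, e2.symm⟩
  have : Nonempty (T.graph.Dart) ∨ T.span U = ∅ := by
    rcases (T.span U).eq_empty_or_nonempty with h | ⟨u, hu⟩
    · exact Or.inr h
    · obtain ⟨d, -⟩ := down u hu
      exact Or.inl ⟨d⟩
  rcases this with hne | hemp
  swap
  · rw [spanWeight, hemp, sum_empty, mul_zero]
    exact walkCost_nonneg hw p
  choose! f hf hf1 hf2 using down
  choose! g hg hg1 hg2 using up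
  -- it suffices to count each dart once; the darts `f u` and `g u` are pairwise different
  have key : ∑ d ∈ p.darts.toFinset, T.edgeWeight d.fst d.snd ≤ walkCost p := by
    unfold walkCost
    rw [Finset.sum_list_map_count]
    refine sum_le_sum fun d hd => ?_
    have h1 := edgeWeight_nonneg hw d.adj
    have h2 : 1 ≤ p.darts.count d := List.count_pos_iff.2 (List.mem_toFinset.1 hd)
    have h3 : (1 : ℝ) ≤ (p.darts.count d : ℝ) := by exact_mod_cast h2
    rw [nsmul_eq_mul]
    nlinarith
  refine le_trans ?_ key
  have hdisj : Disjoint ((T.span U).image f) ((T.span U).image g) := by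
    rw [Finset.disjoint_left]
    intro d hd hd'
    obtain ⟨u, hu, rfl⟩ := mem_image.1 hd
    obtain ⟨u', hu', he⟩ := mem_image.1 hd'
    have e1 : u' = T.parent u := by rw [← hg1 u' hu', he, hf1 u hu]
    have e2 : T.parent u' = u := by rw [← hg2 u' hu', he, hf2 u hu]
    have h1 := T.depth_parent u (mem_span.1 hu).1
    have h2 := T.depth_parent u' (mem_span.1 hu').1
    rw [e2] at h2
    rw [← e1] at h1
    omega
  have hsub : (T.span U).image f ∪ (T.span U).image g ⊆ p.darts.toFinset := by
    intro d hd
    rw [List.mem_toFinset]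
    rcases mem_union.1 hd with hd | hd
    · obtain ⟨u, hu, rfl⟩ := mem_image.1 hd
      exact hf u hu
    · obtain ⟨u, hu, rfl⟩ := mem_image.1 hd
      exact hg u hu
  refine le_trans ?_ (sum_le_sum_of_subset_of_nonneg hsub
    fun d _ _ => edgeWeight_nonneg hw d.adj)
  rw [sum_union hdisj, sum_image, sum_image, spanWeight, two_mul]
  · refine le_of_eq (congrArg₂ _ (sum_congr rfl fun u hu => ?_) (sum_congr rfl fun u hu => ?_))
    · rw [hf1 u hu, hf2 u hu, edgeWeight_parent_self (mem_span.1 hu).1]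
    · rw [hg1 u hu, hg2 u hu, edgeWeight_self_parent]
  · intro u hu u' hu' h
    rw [← hg1 u hu, ← hg1 u' hu', h]
  · intro u hu u' hu' h
    rw [← hf2 u hu, ← hf2 u' hu', h]

end RootedTree

/-! ### Depth first traversals of forests lying over a tree -/

/-- `n` is reached from `m` by iterating the parent map `par` of a forest. -/
def Below {ν : Type*} (par : ν → ν) (n m : ν) : Prop := ∃ i : ℕ, par^[i] m = n

namespace Below

variable {ν : Type*} {par : ν → ν} {n m l : ν}

theorem refl (n : ν) : Below par n n := ⟨0, rfl⟩

theorem trans (h : Below par n m) (h' : Below par m l) : Below par n l := by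
  obtain ⟨i, rfl⟩ := h
  obtain ⟨j, rfl⟩ := h'
  exact ⟨i + j, by rw [Function.iterate_add_apply]⟩

theorem of_parent (h : Below par n (par m)) : Below par n m := h.trans ⟨1, rfl⟩

theorem eq_or_parent (h : Below par n m) : n = m ∨ Below par n (par m) := by
  obtain ⟨i, hi⟩ := h
  cases i with
  | zero => exact Or.inl hi.symm
  | succ i => exact Or.inr ⟨i, by rwa [Function.iterate_succ_apply] at hi⟩

theorem mem {N : Finset ν} (hN : ∀ n ∈ N, par n ∈ N) (h : Below par n m) (hm : m ∈ N) :
    n ∈ N := by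
  obtain ⟨i, rfl⟩ := h
  induction i with
  | zero => exact hm
  | succ i ih => rw [Function.iterate_succ_apply']; exact hN _ ih

theorem eq_of_fixed (h : Below par n m) (hm : par m = m) : n = m := by
  obtain ⟨i, rfl⟩ := h
  exact Function.iterate_fixed hm i

theorem total (h : Below par n l) (h' : Below par m l) : Below par n m ∨ Below par m n := by
  obtain ⟨i, rfl⟩ := h
  obtain ⟨j, rfl⟩ := h'
  rcases le_total i j with hij | hij
  · right
    exact ⟨j - i, by rw [← Function.iterate_add_apply, Nat.sub_add_cancel hij]⟩
  · left
    exact ⟨i - j, by rw [← Function.iterate_add_apply, Nat.sub_add_cancel hij]⟩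

end Below

section Traversal

variable {V ν : Type*}

/-- A depth first traversal of a tree with node set `N`, root `r` and parent map `par`, which lies
over `T` by means of `φ`: a closed walk in `T` together with the node `pos j` at which the
traversal is at time `j`. Each edge is traversed once in each direction, so that the times spent
below any given node form an interval. -/
structure Traversal (T : RootedTree V) (par : ν → ν) (φ : ν → V) (N : Finset ν) (r : ν) where
  walk : T.graph.Walk T.root T.root
  pos : ℕ → ν
  pos_mem : ∀ j ≤ walk.length, pos j ∈ N
  map_pos : ∀ j ≤ walk.length, φ (pos j) = walk.getVert j
  step : ∀ j < walk.length, (φ (pos j) ≠ T.root ∧ par (pos j) = pos (j + 1)) ∨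
    par (pos (j + 1)) = pos j
  surj : ∀ n ∈ N, ∃ j ≤ walk.length, pos j = n
  convex : ∀ n a b c, a ≤ b → b ≤ c → c ≤ walk.length → Below par n (pos a) →
    Below par n (pos c) → Below par n (pos b)
  cost_eq : RootedTree.walkCost walk = 2 * ∑ n ∈ N.erase r, T.weight (φ n)

variable {T : RootedTree V} {par : ν → ν} {φ : ν → V}

/-- A traversal is extended to one more node `n`, none of whose children have been visited, by the
detour `par n → n → par n`. -/
theorem Traversal.extend {N : Finset ν} {r n : ν} (t : Traversal T par φ (N.erase n) r)
    (hn : n ∈ N) (hnr : n ≠ r) (hφn : φ n ≠ T.root) (hpn : par n ∈ N.erase n)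
    (hφ : φ (par n) = T.parent (φ n)) (hchild : ∀ m ∈ N.erase n, par m ∈ N.erase n) :
    Nonempty (Traversal T par φ N r) := by
  obtain ⟨j, hj, hjn⟩ := t.surj _ hpn
  have hadj : T.graph.Adj (t.walk.getVert j) (φ n) := by
    rw [← t.map_pos j hj, hjn, hφ]
    exact RootedTree.adj_parent hφn
  let w : T.graph.Walk T.root T.root := (t.walk.take j).append
    (SimpleGraph.Walk.cons hadj (SimpleGraph.Walk.cons hadj.symm (t.walk.drop j)))
  have hlen : w.length = t.walk.length + 2 := by
    simp only [w, SimpleGraph.Walk.length_append, SimpleGraph.Walk.take_length,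
      SimpleGraph.Walk.length_cons, SimpleGraph.Walk.drop_length]
    omega
  let pos : ℕ → ν := fun i => if i ≤ j then t.pos i else if i = j + 1 then n else t.pos (i - 2)
  have hvert : ∀ i, w.getVert i = if i ≤ j then t.walk.getVert i else
      if i = j + 1 then φ n else t.walk.getVert (i - 2) := by
    intro i
    simp only [w, SimpleGraph.Walk.getVert_append, SimpleGraph.Walk.take_length,
      SimpleGraph.Walk.take_getVert, min_eq_left hj]
    split_ifs with h1 h2 h3 h4 h5
    · rw [min_eq_right h2]
    · omega
    · omega
    · have : i = j := by omega
      subst this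
      simp
    · subst h5
      simp [SimpleGraph.Walk.getVert_cons_succ]
    · obtain ⟨l, rfl⟩ : ∃ l, i = j + 2 + l := ⟨i - (j + 2), by omega⟩
      rw [show j + 2 + l - j = l + 1 + 1 by omega, SimpleGraph.Walk.getVert_cons_succ,
        SimpleGraph.Walk.getVert_cons_succ, SimpleGraph.Walk.drop_getVert]
      congr 1
      omega
  have hne : ∀ i ≤ t.walk.length, t.pos i ≠ n := fun i hi =>
    (mem_erase.1 (t.pos_mem i hi)).1
  -- the new node is the only one below itself, as it has no children
  have hbelow : ∀ i ≤ t.walk.length, ¬ Below par n (t.pos i) := fun i hi h =>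
    (mem_erase.1 (h.mem hchild (t.pos_mem i hi))).1 rfl
  -- the time in the old traversal that corresponds to the time `i`
  let old : ℕ → ℕ := fun i => if i ≤ j then i else if i = j + 1 then j else i - 2
  have hold_mono : ∀ a b, a ≤ b → old a ≤ old b := by
    intro a b hab
    simp only [old]
    split_ifs <;> omega
  have hold_le : ∀ i ≤ t.walk.length + 2, old i ≤ t.walk.length := by
    intro i hi
    simp only [old]
    split_ifs <;> omega
  have hpos_old : ∀ i, i ≠ j + 1 → pos i = t.pos (old i) := by
    intro i hi
    simp only [pos, old, if_neg hi]
    split_ifs <;> rfl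
  have hpos_new : pos (j + 1) = n := by simp [pos]
  have hiff : ∀ m, m ≠ n → ∀ i, Below par m (pos i) ↔ Below par m (t.pos (old i)) := by
    intro m hm i
    by_cases hi : i = j + 1
    · subst hi
      have : old (j + 1) = j := by simp [old]
      rw [hpos_new, this, hjn]
      exact ⟨fun h => h.eq_or_parent.resolve_left hm, fun h => h.of_parent⟩
    · rw [hpos_old i hi]
  refine ⟨⟨w, pos, ?_, ?_, ?_, ?_, ?_, ?_⟩⟩
  · intro i hi
    by_cases h : i = j + 1
    · rw [h, hpos_new]
      exact hn
    · rw [hpos_old i h]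
      exact (mem_erase.1 (t.pos_mem _ (hold_le i (by omega)))).2
  · intro i hi
    rw [hvert]
    simp only [pos]
    split_ifs with h1 h2
    · exact t.map_pos i (by omega)
    · rfl
    · exact t.map_pos _ (by omega)
  · intro i hi
    rcases lt_trichotomy i j with h | rfl | h
    · have h1 := t.step i (by omega)
      simpa only [pos, if_pos h.le, if_pos (Nat.succ_le_of_lt h)] using h1
    · right
      simp [pos, hjn]
    · by_cases h1 : i = j + 1
      · subst h1
        left
        simp [pos, hjn, hφn]
      · have h2 := t.step (i - 2) (by omega)
        rw [show i - 2 + 1 = i + 1 - 2 by omega] at h2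
        simpa only [pos, if_neg (not_le.2 h), if_neg h1, if_neg (show ¬ i + 1 ≤ j by omega),
          if_neg (show ¬ i + 1 = j + 1 by omega)] using h2
  · intro m hm
    by_cases hmn : m = n
    · exact ⟨j + 1, by omega, by rw [hpos_new, hmn]⟩
    · obtain ⟨i, hi, him⟩ := t.surj m (mem_erase.2 ⟨hmn, hm⟩)
      by_cases hij : i ≤ j
      · exact ⟨i, by omega, by simp [pos, hij, him]⟩
      · refine ⟨i + 2, by omega, ?_⟩
        simp only [pos]
        rw [if_neg (by omega), if_neg (by omega)]
        exact him
  · intro m a b c hab hbc hc ha hc'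
    by_cases hm : m = n
    · subst hm
      have key : ∀ i ≤ w.length, Below par m (pos i) → i = j + 1 := by
        intro i hi h
        by_contra hne
        rw [hpos_old i hne] at h
        exact hbelow _ (hold_le i (by omega)) h
      have h1 := key a (by omega) ha
      have h2 := key c hc hc'
      have : b = j + 1 := by omega
      rw [this, ← h1]
      exact ha
    · rw [hiff m hm] at ha hc' ⊢
      exact t.convex m _ _ _ (hold_mono _ _ hab) (hold_mono _ _ hbc)
        (hold_le c (by omega)) ha hc'
  · have h1 : RootedTree.walkCost t.walk = RootedTree.walkCost (t.walk.take j)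
        + RootedTree.walkCost (t.walk.drop j) := by
      rw [← RootedTree.walkCost_append, SimpleGraph.Walk.append_take_drop_eq]
    have h2 : T.edgeWeight (t.walk.getVert j) (φ n) = T.weight (φ n) := by
      rw [← t.map_pos j hj, hjn, hφ]
      exact RootedTree.edgeWeight_parent_self hφn
    have h3 : T.edgeWeight (φ n) (t.walk.getVert j) = T.weight (φ n) := by
      rw [← t.map_pos j hj, hjn, hφ]
      exact RootedTree.edgeWeight_self_parent _
    have h4 := t.cost_eq
    rw [erase_right_comm] at h4
    have h5 := Finset.add_sum_erase (N.erase r) (fun n => T.weight (φ n))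
      (mem_erase.2 ⟨hnr, hn⟩)
    simp only [w, RootedTree.walkCost_append, RootedTree.walkCost_cons, h2, h3]
    rw [← h5]
    linarith

/-- The traversal is built by adding the nodes in the order of their depths. -/
theorem exists_traversal (N : Finset ν) (r : ν) (hr : r ∈ N) (hφr : φ r = T.root)
    (hparr : par r = r) (hroot : ∀ n ∈ N, φ n = T.root → n = r) (hpar : ∀ n ∈ N, par n ∈ N)
    (hφ : ∀ n ∈ N, φ (par n) = T.parent (φ n)) : Nonempty (Traversal T par φ N r) := by
  induction hcard : #N generalizing N with
  | zero =>
    rw [card_eq_zero] at hcard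
    rw [hcard] at hr
    exact absurd hr (notMem_empty r)
  | succ c ih =>
    rcases (N.erase r).eq_empty_or_nonempty with hemp | hne
    · have hN : ∀ n ∈ N, n = r := by
        intro n hn
        by_contra h
        have : n ∈ N.erase r := mem_erase.2 ⟨h, hn⟩
        rw [hemp] at this
        exact absurd this (notMem_empty n)
      refine ⟨⟨SimpleGraph.Walk.nil, fun _ => r, fun _ _ => hr, ?_, ?_, ?_, ?_, ?_⟩⟩
      · intro j _
        simp [hφr]
      · intro j hj
        simp at hj
      · intro n hn
        exact ⟨0, le_rfl, (hN n hn).symm⟩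
      · intro n a b c _ _ _ h _
        exact h
      · simp [RootedTree.walkCost, hemp]
    -- a deepest node has no children and is visited last
    · obtain ⟨n, hn, hmax⟩ := exists_max_image (N.erase r) (fun n => T.depth (φ n)) hne
      obtain ⟨hnr, hnN⟩ := mem_erase.1 hn
      have hφn : φ n ≠ T.root := fun h => hnr (hroot n hnN h)
      have hchild : ∀ m ∈ N.erase n, par m ∈ N.erase n := by
        intro m hm
        obtain ⟨hmn, hmN⟩ := mem_erase.1 hm
        refine mem_erase.2 ⟨fun h => ?_, hpar m hmN⟩
        by_cases hmr : m = r
        · rw [hmr, hparr] at h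
          exact hnr h.symm
        · have h1 := hmax m (mem_erase.2 ⟨hmr, hmN⟩)
          have h2 := T.depth_parent (φ m) (fun h => hmr (hroot m hmN h))
          rw [← hφ m hmN, h] at h2
          omega
      have hpn : par n ∈ N.erase n := by
        refine mem_erase.2 ⟨fun h => ?_, hpar n hnN⟩
        have := hφ n hnN
        rw [h] at this
        exact RootedTree.parent_ne hφn this.symm
      obtain ⟨t⟩ := ih (N.erase n) (mem_erase.2 ⟨hnr.symm, hr⟩)
        (fun m hm => hroot m (mem_of_mem_erase hm)) hchild
        (fun m hm => hφ m (mem_of_mem_erase hm)) (by rw [card_erase_of_mem hnN, hcard]; rfl)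
      exact t.extend hnN hnr hφn hpn (hφ n hnN) hchild

/-- Nodes of the traversal over the subtree rooted at `u` lie below a unique node over `u`, and
during a subtour at `u` this node does not change: the subtours at `u` are exactly the time
intervals that the traversal spends below the nodes over `u`. -/
theorem Traversal.exists_of_isSubtour {N : Finset ν} {r : ν} (t : Traversal T par φ N r)
    (hpar : ∀ n ∈ N, par n ∈ N) (hφ : ∀ n ∈ N, φ (par n) = T.parent (φ n))
    {u : V} (hu : u ≠ T.root) {a b : ℕ} (h : RootedTree.IsSubtour t.walk u a b) :
    ∃ n ∈ N, φ n = u ∧ ∀ j ≤ t.walk.length, Below par n (t.pos j) ↔ a ≤ j ∧ j ≤ b := by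
  obtain ⟨hab, hb, hin, hbefore, hafter⟩ := h
  have hiter : ∀ i, ∀ m ∈ N, par^[i] m ∈ N ∧ φ (par^[i] m) = T.parent^[i] (φ m) := by
    intro i m hm
    induction i with
    | zero => exact ⟨hm, rfl⟩
    | succ i ih =>
      rw [Function.iterate_succ_apply', Function.iterate_succ_apply', hφ _ ih.1, ih.2]
      exact ⟨hpar _ ih.1, rfl⟩
  have hanc : ∀ m n, m ∈ N → Below par n m → T.IsAncestor (φ n) (φ m) := by
    rintro m n hm ⟨i, rfl⟩
    exact ⟨i, ((hiter i m hm).2).symm⟩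
  obtain ⟨i, hi⟩ := hin a le_rfl hab
  rw [← t.map_pos a (hab.trans hb)] at hi
  have hposa := t.pos_mem a (hab.trans hb)
  obtain ⟨hn1, hn2⟩ := hiter i _ hposa
  refine ⟨par^[i] (t.pos a), hn1, hn2.trans hi, ?_⟩
  set n := par^[i] (t.pos a) with hn
  have hφn : φ n = u := hn2.trans hi
  have hna : Below par n (t.pos a) := ⟨i, rfl⟩
  -- the traversal can leave the nodes below `n` only by an upward step from `n`, which would lead
  -- out of the subtree rooted at `u`
  have hall : ∀ j, a ≤ j → j ≤ b → Below par n (t.pos j) := by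
    intro j haj
    induction j, haj using Nat.le_induction with
    | base => exact fun _ => hna
    | succ j haj ih =>
      intro hjb
      have h1 := ih (by omega)
      rcases t.step j (by omega) with ⟨h2, h3⟩ | h2
      · rcases h1.eq_or_parent with h4 | h4
        · exfalso
          have h5 := hin (j + 1) (by omega) hjb
          rw [← t.map_pos (j + 1) (by omega), ← h3, hφ _ (t.pos_mem j (by omega)), ← h4,
            hφn] at h5
          exact RootedTree.not_isAncestor_parent hu h5
        · rwa [h3] at h4
      · exact Below.of_parent (h2 ▸ h1)
  intro j hj
  constructor
  · intro h
    constructor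
    · by_contra hlt
      have h1 := t.convex n j (a - 1) a (by omega) (by omega) (hab.trans hb) h hna
      have h2 := hanc _ _ (t.pos_mem (a - 1) (by omega)) h1
      rw [t.map_pos (a - 1) (by omega), hφn] at h2
      exact hbefore (a - 1) (by omega) h2
    · by_contra hlt
      have h1 := t.convex n b (b + 1) j (by omega) (by omega) hj (hall b hab le_rfl) h
      have h2 := hanc _ _ (t.pos_mem (b + 1) (by omega)) h1
      rw [t.map_pos (b + 1) (by omega), hφn] at h2
      exact hafter (by omega) h2
  · rintro ⟨h1, h2⟩
    exact hall j h1 h2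

/-- A finite forest over `T` whose nodes carry the terminals gives a solution: the trees of the
forest are traversed depth first. Its cost is twice the weight of the forest, and the subtours at
a vertex `u` correspond to the nodes over `u`. -/
theorem exists_solution_of_forest (N : Finset ν) (hpar : ∀ n ∈ N, par n ∈ N)
    (hφ : ∀ n ∈ N, φ (par n) = T.parent (φ n))
    (hroot : ∀ n ∈ N, φ n = T.root → par n = n)
    {τ : Type*} [Finite τ] {loc : τ → V} {k : ℕ} (node : τ → ν) (hnode : ∀ x, node x ∈ N)
    (hloc : ∀ x, φ (node x) = loc x)
    (hcap : ∀ r ∈ N, φ r = T.root → {x | Below par r (node x)}.ncard ≤ k) :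
    ∃ S : Solution T loc k,
      S.cost = 2 * ∑ n ∈ N with φ n ≠ T.root, T.weight (φ n) ∧
      (∀ x y, (∃ r ∈ N, φ r = T.root ∧ Below par r (node x) ∧ Below par r (node y)) →
        S.visitor x = S.visitor y) ∧
      ∀ u, u ≠ T.root → ∀ i a b, RootedTree.IsSubtour (S.tour i) u a b →
        ∃ n ∈ N, φ n = u ∧ S.demandBetween i a b = {x | Below par n (node x)}.ncard := by
  have hiter : ∀ i, ∀ m ∈ N, par^[i] m ∈ N ∧ φ (par^[i] m) = T.parent^[i] (φ m) := by
    intro i m hm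
    induction i with
    | zero => exact ⟨hm, rfl⟩
    | succ i ih =>
      rw [Function.iterate_succ_apply', Function.iterate_succ_apply', hφ _ ih.1, ih.2]
      exact ⟨hpar _ ih.1, rfl⟩
  set R : Finset ν := {r ∈ N | φ r = T.root} with hR
  have hR' : ∀ r, r ∈ R ↔ r ∈ N ∧ φ r = T.root := fun r => by simp [hR]
  -- each root of the forest becomes a tour, and the nodes below it form its tree
  let rootOf : ν → ν := fun n => par^[T.depth (φ n)] n
  have hrootOf : ∀ n ∈ N, rootOf n ∈ R ∧ Below par (rootOf n) n := by
    intro n hn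
    obtain ⟨h1, h2⟩ := hiter (T.depth (φ n)) n hn
    exact ⟨(hR' _).2 ⟨h1, h2.trans (T.depth_spec _)⟩, ⟨_, rfl⟩⟩
  have huniq : ∀ r r' n, r ∈ R → r' ∈ R → Below par r n → Below par r' n → r = r' := by
    intro r r' n hr hr' h h'
    rcases h.total h' with h1 | h1
    · exact h1.eq_of_fixed (hroot r' ((hR' _).1 hr').1 ((hR' _).1 hr').2)
    · exact (h1.eq_of_fixed (hroot r ((hR' _).1 hr).1 ((hR' _).1 hr).2)).symm
  let tree : ν → Finset ν := fun r => {n ∈ N | Below par r n}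
  have htree : ∀ r n, n ∈ tree r ↔ n ∈ N ∧ Below par r n := fun r n => by simp [tree]
  have htpar : ∀ r ∈ R, ∀ n ∈ tree r, par n ∈ tree r := by
    intro r hr n hn
    obtain ⟨h1, h2⟩ := (htree _ _).1 hn
    refine (htree _ _).2 ⟨hpar n h1, ?_⟩
    rcases h2.eq_or_parent with h3 | h3
    · rw [← h3, hroot r ((hR' _).1 hr).1 ((hR' _).1 hr).2]
      exact Below.refl r
    · exact h3
  have htrav : ∀ r : R, Nonempty (Traversal T par φ (tree r) r) := by
    rintro ⟨r, hr⟩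
    obtain ⟨hrN, hrφ⟩ := (hR' _).1 hr
    refine exists_traversal (tree r) r ((htree _ _).2 ⟨hrN, Below.refl r⟩) hrφ
      (hroot r hrN hrφ) ?_ (htpar r hr) (fun n hn => hφ n ((htree _ _).1 hn).1)
    intro n hn hn'
    obtain ⟨h1, h2⟩ := (htree _ _).1 hn
    exact (h2.eq_of_fixed (hroot n h1 hn')).symm
  let trav : ∀ r : R, Traversal T par φ (tree r) r := fun r => (htrav r).some
  let e : Fin (Fintype.card R) ≃ R := (Fintype.equivFin R).symm
  let root' : τ → R := fun x => ⟨rootOf (node x), (hrootOf _ (hnode x)).1⟩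
  have hmem : ∀ x, node x ∈ tree (root' x) := fun x =>
    (htree _ _).2 ⟨hnode x, (hrootOf _ (hnode x)).2⟩
  have htime : ∀ x, ∃ j ≤ (trav (root' x)).walk.length, (trav (root' x)).pos j = node x :=
    fun x => (trav (root' x)).surj _ (hmem x)
  choose time htime_le htime_pos using htime
  -- a terminal is served by the tour of the root above its node
  have hvis : ∀ x i, e.symm (root' x) = i ↔ Below par (e i : ν) (node x) := by
    intro x i
    rw [Equiv.symm_apply_eq]
    constructor
    · rintro h
      rw [← h]
      exact (hrootOf _ (hnode x)).2
    · intro h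
      exact Subtype.ext (huniq _ _ _ (hrootOf _ (hnode x)).1 (e i).2
        (hrootOf _ (hnode x)).2 h)
  let S : Solution T loc k :=
    { numTours := Fintype.card R
      tour := fun i => (trav (e i)).walk
      visitor := fun x => e.symm (root' x)
      time := time
      time_le := fun x => by
        rw [Equiv.apply_symm_apply]
        exact htime_le x
      getVert_time := fun x => by
        rw [Equiv.apply_symm_apply, ← (trav (root' x)).map_pos _ (htime_le x), htime_pos, hloc]
      capacity := fun i => by
        have h := (hR' _).1 (e i).2
        simp only [hvis]
        exact hcap _ h.1 h.2 }
  refine ⟨S, ?_, ?_, ?_⟩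
  · change ∑ i, RootedTree.walkCost (trav (e i)).walk = _
    rw [Equiv.sum_comp e (fun r => RootedTree.walkCost (trav r).walk)]
    simp only [Traversal.cost_eq]
    rw [← mul_sum, Finset.sum_coe_sort R (fun r => ∑ n ∈ (tree r).erase r, T.weight (φ n)),
      ← sum_biUnion]
    · congr 2
      ext n
      simp only [mem_biUnion, mem_erase, mem_filter, htree]
      constructor
      · rintro ⟨r, hr, hne, h1, h2⟩
        exact ⟨h1, fun h => hne (h2.eq_of_fixed (hroot n h1 h)).symm⟩
      · rintro ⟨h1, h2⟩
        refine ⟨rootOf n, (hrootOf n h1).1, fun h => h2 ?_, h1, (hrootOf n h1).2⟩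
        rw [h]
        exact ((hR' _).1 (hrootOf n h1).1).2
    · intro r hr r' hr' hne
      simp only [Function.onFun]
      rw [Finset.disjoint_left]
      intro n hn hn'
      exact hne (huniq r r' n hr hr' ((htree _ _).1 (mem_of_mem_erase hn)).2
        ((htree _ _).1 (mem_of_mem_erase hn')).2)
  · rintro x y ⟨r, hrN, hrφ, hx, hy⟩
    have hr : r ∈ R := (hR' _).2 ⟨hrN, hrφ⟩
    have h1 : e.symm (root' x) = e.symm ⟨r, hr⟩ := by
      rw [hvis, Equiv.apply_symm_apply]
      exact hx
    have h2 : e.symm (root' y) = e.symm ⟨r, hr⟩ := by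
      rw [hvis, Equiv.apply_symm_apply]
      exact hy
    exact h1.trans h2.symm
  · intro u hu i a b h
    obtain ⟨n, hn, hn1, hn2⟩ := (trav (e i)).exists_of_isSubtour (htpar _ (e i).2)
      (fun n hn => hφ n ((htree _ _).1 hn).1) hu h
    obtain ⟨hnN, hnr⟩ := (htree _ _).1 hn
    refine ⟨n, hnN, hn1, ?_⟩
    unfold Solution.demandBetween
    congr 1
    ext x
    simp only [Set.mem_ofPred_eq]
    constructor
    · rintro ⟨h1, h2⟩
      have h1' : root' x = e i := by rw [← h1]; exact (Equiv.apply_symm_apply _ _).symm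
      have h3 := htime_le x
      have h4 := htime_pos x
      rw [h1'] at h3 h4
      rw [← h4]
      exact (hn2 _ h3).2 h2
    · intro h1
      have h2 : e.symm (root' x) = i := (hvis x i).2 (hnr.trans h1)
      have h1' : root' x = e i := by rw [← h2, Equiv.apply_symm_apply]
      refine ⟨h2, ?_⟩
      have h3 := htime_le x
      have h4 := htime_pos x
      rw [h1'] at h3 h4
      rw [← h4] at h1
      exact (hn2 _ h3).1 h1

end Traversal

/-! ### Grouping, rounding of assignments, and rounding of demands -/

/-- Items of size less than `A` can be put into groups of total size in `[A, 2 A)`, up to a rest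
(the group `0`) of total size less than `A`. -/
theorem exists_grouping {ι : Type*} (s : Finset ι) (w : ι → ℝ) {A : ℝ} (hA : 0 < A)
    (hw : ∀ i ∈ s, w i < A) :
    ∃ g : ι → ℕ, ∑ i ∈ s with g i = 0, w i < A ∧
      ∀ n, n ≠ 0 → (∃ i ∈ s, g i = n) →
        A ≤ ∑ i ∈ s with g i = n, w i ∧ ∑ i ∈ s with g i = n, w i < 2 * A := by
  induction s using Finset.induction_on with
  | empty => exact ⟨fun _ => 0, by simpa using hA, by simp⟩
  | insert a s ha ih =>
    obtain ⟨g, hg0, hg⟩ := ih fun i hi => hw i (mem_insert_of_mem hi)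
    have hwa := hw a (mem_insert_self a s)
    -- the new item first joins the rest
    set g₁ : ι → ℕ := fun i => if i = a then 0 else g i with hg₁
    have hg₁s : ∀ i ∈ s, g₁ i = g i := fun i hi => by
      have : i ≠ a := fun h => ha (h ▸ hi)
      simp [hg₁, this]
    have hg₁a : g₁ a = 0 := by simp [hg₁]
    have hf : ∀ n, s.filter (fun i => g₁ i = n) = s.filter (fun i => g i = n) := fun n =>
      filter_congr fun i hi => by rw [hg₁s i hi]
    have hsum0 : ∑ i ∈ insert a s with g₁ i = 0, w i = w a + ∑ i ∈ s with g i = 0, w i := by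
      rw [filter_insert, if_pos hg₁a, hf, sum_insert]
      exact fun h => ha (mem_filter.1 h).1
    have hsum : ∀ n, n ≠ 0 →
        ∑ i ∈ insert a s with g₁ i = n, w i = ∑ i ∈ s with g i = n, w i := by
      intro n hn
      rw [filter_insert, if_neg (by rw [hg₁a]; exact hn.symm), hf]
    by_cases hlt : w a + ∑ i ∈ s with g i = 0, w i < A
    · refine ⟨g₁, by rw [hsum0]; exact hlt, ?_⟩
      rintro n hn ⟨i, hi, hin⟩
      rw [hsum n hn]
      rcases mem_insert.1 hi with rfl | hi
      · exact absurd (hg₁a.symm.trans hin) hn.symm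
      · exact hg n hn ⟨i, hi, by rw [← hg₁s i hi, hin]⟩
    · -- the rest has become large enough for a group, which gets the new label `M + 1`
      set M := (insert a s).sup g₁ with hM
      have hMle : ∀ i ∈ insert a s, g₁ i ≤ M := fun i hi => le_sup (f := g₁) hi
      refine ⟨fun i => if g₁ i = 0 then M + 1 else g₁ i, ?_, ?_⟩
      · rw [filter_false_of_mem, sum_empty]
        · exact hA
        · intro i _
          dsimp only
          split_ifs with h
          · exact not_false
          · exact h
      · rintro n hn ⟨i, hi, hin⟩
        by_cases hnM : n = M + 1
        · have : (insert a s).filter (fun i => (if g₁ i = 0 then M + 1 else g₁ i) = n)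
              = (insert a s).filter (fun i => g₁ i = 0) := by
            refine filter_congr fun i hi => ?_
            have := hMle i hi
            split_ifs with h
            · simp [hnM, h]
            · simp only [h, iff_false]
              omega
          rw [this, hsum0]
          constructor <;> linarith
        · have : (insert a s).filter (fun i => (if g₁ i = 0 then M + 1 else g₁ i) = n)
              = (insert a s).filter (fun i => g₁ i = n) := by
            refine filter_congr fun i hi => ?_
            split_ifs with h
            · simp only [h]
              constructor <;> intro h' <;> omega
            · rfl
          rw [this, hsum n hn]
          simp only at hin
          split_ifs at hin with h
          · omega
          · rcases mem_insert.1 hi with rfl | hi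
            · exact absurd hg₁a h
            · exact hg n hn ⟨i, hi, by rw [← hg₁s i hi, hin]⟩

/-- The part of the interval `[0, y]` that lies in `[t, t + 1]`. -/
def slotPart (y : ℝ) (t : ℕ) : ℝ := max 0 (min 1 (y - t))

theorem slotPart_mono {y y' : ℝ} (h : y ≤ y') (t : ℕ) : slotPart y t ≤ slotPart y' t :=
  max_le_max le_rfl (min_le_min le_rfl (by linarith))

theorem slotPart_le_one (y : ℝ) (t : ℕ) : slotPart y t ≤ 1 :=
  max_le zero_le_one (min_le_left _ _)

theorem slotPart_zero (t : ℕ) : slotPart 0 t = 0 :=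
  max_eq_left ((min_le_right _ _).trans (by simp))

theorem slotPart_eq_one {y : ℝ} {t : ℕ} (h : (t : ℝ) + 1 ≤ y) : slotPart y t = 1 := by
  unfold slotPart
  rw [min_eq_left (by linarith), max_eq_right zero_le_one]

theorem lt_of_slotPart_pos {y : ℝ} {t : ℕ} (h : 0 < slotPart y t) : (t : ℝ) < y := by
  by_contra hle
  have : slotPart y t = 0 := max_eq_left ((min_le_right _ _).trans (by linarith))
  linarith

theorem sum_slotPart {n : ℕ} {y : ℝ} (h0 : 0 ≤ y) (hn : y ≤ n) :
    ∑ t ∈ range n, slotPart y t = y := by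
  induction n generalizing y with
  | zero =>
    simp only [range_zero, sum_empty]
    push_cast at hn
    linarith
  | succ n ih =>
    rw [sum_range_succ]
    rcases le_total y n with h | h
    · rw [ih h0 h]
      have : slotPart y n = 0 := max_eq_left ((min_le_right _ _).trans (by linarith))
      linarith
    · have h1 : ∑ t ∈ range n, slotPart y t = ∑ t ∈ range n, (1 : ℝ) := by
        refine sum_congr rfl fun t ht => slotPart_eq_one ?_
        have : (t : ℝ) + 1 ≤ n := by exact_mod_cast mem_range.1 ht
        linarith
      have h2 : slotPart y n = y - n := by
        unfold slotPart
        push_cast at hn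
        rw [min_eq_right (by linarith), max_eq_right (by linarith)]
      rw [h1, h2]
      simp

/-- The rounding of a fractional assignment for items that are sorted by decreasing size. The
fractional items assigned to `a` are packed in this order into slots of length `1`, and the items
are matched to slots which they meet. An item in a slot `t + 1` is at most as large as those that
fill the slot `t`. -/
theorem exists_rounded_assignment_of_antitone {A : Type*} [Fintype A] {n : ℕ} (w : A → ℕ → ℝ)
    (W : ℕ → ℝ) (hw : ∀ a i, 0 ≤ w a i) (hW : ∀ i < n, 0 < W i)
    (hanti : ∀ i j, i ≤ j → j < n → W j ≤ W i) (hsum : ∀ i < n, ∑ a, w a i = W i) :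
    ∃ (f : Fin n → A) (kept : Fin n → Prop), (∀ i, 0 < w (f i) i) ∧
      (∀ i j, ¬ kept i → ¬ kept j → f i = f j → i = j) ∧
      ∀ a, ∑ i with f i = a ∧ kept i, W i ≤ ∑ i : Fin n, w a i := by
  set x : A → ℕ → ℝ := fun a i => w a i / W i with hx
  have hx0 : ∀ a i, i < n → 0 ≤ x a i := fun a i hi => div_nonneg (hw a i) (hW i hi).le
  have hxsum : ∀ i < n, ∑ a, x a i = 1 := fun i hi => by
    simp only [hx]
    rw [← sum_div, hsum i hi, div_self (hW i hi).ne']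
  have hx1 : ∀ a i, i < n → x a i ≤ 1 := fun a i hi => by
    rw [← hxsum i hi]
    exact single_le_sum (f := fun a => x a i) (fun a _ => hx0 a i hi) (mem_univ a)
  -- the fraction of `i` at `a` occupies the interval from `P a i` to `P a (i + 1)`
  set P : A → ℕ → ℝ := fun a i => ∑ j ∈ range i, x a j with hP
  have hPsucc : ∀ a i, P a (i + 1) = P a i + x a i := fun a i => sum_range_succ _ _
  have hP0 : ∀ a i, i ≤ n → 0 ≤ P a i := fun a i hi =>
    sum_nonneg fun j hj => hx0 a j (by have := mem_range.1 hj; omega)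
  have hPn : ∀ a i, i ≤ n → P a i ≤ n := fun a i hi => by
    calc P a i ≤ ∑ j ∈ range i, (1 : ℝ) :=
          sum_le_sum fun j hj => hx1 a j (by have := mem_range.1 hj; omega)
      _ = i := by simp
      _ ≤ n := by exact_mod_cast hi
  -- the length of the part of the item `i` in the slot `t` of `a`
  set ov : A → ℕ → ℕ → ℝ := fun a i t => slotPart (P a (i + 1)) t - slotPart (P a i) t with hov
  have hov0 : ∀ a i t, i < n → 0 ≤ ov a i t := fun a i t hi =>
    sub_nonneg.2 (slotPart_mono (by rw [hPsucc]; linarith [hx0 a i hi]) t)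
  have hov_t : ∀ a i, i < n → ∑ t ∈ range n, ov a i t = x a i := fun a i hi => by
    simp only [hov]
    rw [sum_sub_distrib, sum_slotPart (hP0 a _ hi) (hPn a _ hi),
      sum_slotPart (hP0 a _ hi.le) (hPn a _ hi.le), hPsucc]
    ring
  have hov_i : ∀ a t m, ∑ i ∈ range m, ov a i t = slotPart (P a m) t := fun a t m => by
    simp only [hov]
    rw [sum_range_sub (fun i => slotPart (P a i) t)]
    simp [hP, slotPart_zero]
  set slots : Fin n → Finset (A × ℕ) := fun i =>
    {q ∈ (univ : Finset A) ×ˢ range n | 0 < ov q.1 i q.2} with hslots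
  -- Hall's condition: the items of `s` have total length `#s`, all of which lies in the slots that
  -- they meet, and these have length at most `1` each
  have hall : ∀ s : Finset (Fin n), #s ≤ #(s.biUnion slots) := by
    intro s
    have h1 : ∀ i ∈ s, ∑ q ∈ s.biUnion slots, ov q.1 i q.2 = 1 := by
      intro i hi
      rw [← hxsum i i.2]
      have : ∑ a, x a i = ∑ q ∈ (univ : Finset A) ×ˢ range n, ov q.1 i q.2 := by
        rw [sum_product]
        exact sum_congr rfl fun a _ => (hov_t a i i.2).symm
      rw [this]
      refine sum_subset ?_ ?_
      · intro q hq
        obtain ⟨j, _, hj⟩ := mem_biUnion.1 hq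
        exact (mem_filter.1 hj).1
      · intro q hq hq'
        have h2 := hov0 q.1 i q.2 i.2
        by_contra hne
        exact hq' (mem_biUnion.2 ⟨i, hi, mem_filter.2 ⟨hq, lt_of_le_of_ne h2 (Ne.symm hne)⟩⟩)
    have h2 : (#s : ℝ) ≤ #(s.biUnion slots) := by
      calc (#s : ℝ) = ∑ i ∈ s, ∑ q ∈ s.biUnion slots, ov q.1 i q.2 := by
            rw [sum_congr rfl h1]
            simp
        _ = ∑ q ∈ s.biUnion slots, ∑ i ∈ s, ov q.1 i q.2 := sum_comm
        _ ≤ ∑ q ∈ s.biUnion slots, (1 : ℝ) := by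
            refine sum_le_sum fun q _ => ?_
            calc ∑ i ∈ s, ov q.1 i q.2 ≤ ∑ i : Fin n, ov q.1 i q.2 :=
                  sum_le_sum_of_subset_of_nonneg (subset_univ s)
                    fun i _ _ => hov0 q.1 i q.2 i.2
              _ = slotPart (P q.1 n) q.2 := by
                  rw [Fin.sum_univ_eq_sum_range (fun i => ov q.1 i q.2) n, hov_i]
              _ ≤ 1 := slotPart_le_one _ _
        _ = #(s.biUnion slots) := by simp
    exact_mod_cast h2
  obtain ⟨m, hinj, hm⟩ := (Finset.all_card_le_biUnion_card_iff_exists_injective slots).1 hall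
  have hm' : ∀ i, (m i).2 < n ∧ 0 < ov (m i).1 i (m i).2 := fun i => by
    have := hm i
    simp only [hslots, mem_filter, mem_product, mem_univ, true_and, mem_range] at this
    exact this
  -- the item matched to the first slot of `a` is the one that `a` drops
  refine ⟨fun i => (m i).1, fun i => (m i).2 ≠ 0, ?_, ?_, ?_⟩
  · intro i
    have h1 := (hm' i).2
    have h2 : 0 < x (m i).1 i := by
      by_contra hle
      have : P (m i).1 (i + 1) ≤ P (m i).1 i := by rw [hPsucc]; linarith
      have := slotPart_mono this (m i).2
      simp only [hov] at h1
      linarith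
    have h3 := mul_pos h2 (hW i i.2)
    simp only [hx] at h3
    rwa [div_mul_cancel₀ _ (hW i i.2).ne'] at h3
  · intro i j hi hj h
    exact hinj (Prod.ext h ((not_not.1 hi).trans (not_not.1 hj).symm))
  · intro a
    -- an item matched to the slot `t + 1` is paid for by the larger items that fill the slot `t`
    have key : ∀ i : Fin n, (m i).1 = a → (m i).2 ≠ 0 →
        W i ≤ ∑ j ∈ range n, W j * ov a j ((m i).2 - 1) := by
      intro i ha h0
      obtain ⟨t, ht⟩ := Nat.exists_eq_succ_of_ne_zero h0
      have h1 := (hm' i).2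
      rw [ha, ht] at h1
      have h2 : ((t + 1 : ℕ) : ℝ) < P a (i + 1) := by
        refine lt_of_slotPart_pos (lt_of_lt_of_le h1 ?_)
        simp only [hov]
        have : 0 ≤ slotPart (P a i) (t + 1) := le_max_left _ _
        linarith
      push_cast at h2
      have h3 := hov_i a t (i + 1)
      rw [slotPart_eq_one h2.le] at h3
      rw [ht, Nat.succ_sub_one]
      calc W i = ∑ j ∈ range (i + 1), W i * ov a j t := by rw [← mul_sum, h3, mul_one]
        _ ≤ ∑ j ∈ range (i + 1), W j * ov a j t := by
            refine sum_le_sum fun j hj => ?_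
            have hji := mem_range.1 hj
            have hi := i.2
            exact mul_le_mul_of_nonneg_right (hanti j i (by omega) hi) (hov0 a j t (by omega))
        _ ≤ ∑ j ∈ range n, W j * ov a j t := by
            refine sum_le_sum_of_subset_of_nonneg ?_ ?_
            · intro j hj
              have hi := i.2
              have := mem_range.1 hj
              exact mem_range.2 (by omega)
            · intro j hj _
              have := mem_range.1 hj
              exact mul_nonneg (hW j this).le (hov0 a j t this)
    set K : Finset (Fin n) := {i | (m i).1 = a ∧ (m i).2 ≠ 0} with hK
    have hK' : ∀ i, i ∈ K ↔ (m i).1 = a ∧ (m i).2 ≠ 0 := fun i => by simp [hK]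
    refine le_trans (b := ∑ i ∈ K, W i)
      (le_of_eq (sum_congr (by ext i; simp [hK]) fun _ _ => rfl)) ?_
    calc ∑ i ∈ K, W i ≤ ∑ i ∈ K, ∑ j ∈ range n, W j * ov a j ((m i).2 - 1) :=
          sum_le_sum fun i hi => key i ((hK' i).1 hi).1 ((hK' i).1 hi).2
      _ = ∑ t ∈ K.image (fun i => (m i).2 - 1), ∑ j ∈ range n, W j * ov a j t := by
          rw [sum_image]
          intro i hi j hj h
          obtain ⟨h1, h2⟩ := (hK' i).1 hi
          obtain ⟨h3, h4⟩ := (hK' j).1 hj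
          simp only at h
          exact hinj (Prod.ext (h1.trans h3.symm) (by omega))
      _ ≤ ∑ t ∈ range n, ∑ j ∈ range n, W j * ov a j t := by
          refine sum_le_sum_of_subset_of_nonneg ?_ ?_
          · intro t ht
            obtain ⟨i, hi, rfl⟩ := mem_image.1 ht
            have := (hm' i).1
            exact mem_range.2 (by omega)
          · intro t _ _
            refine sum_nonneg fun j hj => ?_
            have := mem_range.1 hj
            exact mul_nonneg (hW j this).le (hov0 a j t this)
      _ = ∑ j ∈ range n, ∑ t ∈ range n, W j * ov a j t := sum_comm
      _ = ∑ j ∈ range n, w a j := by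
          refine sum_congr rfl fun j hj => ?_
          have := mem_range.1 hj
          rw [← mul_sum, hov_t a j this]
          simp only [hx]
          exact mul_div_cancel₀ _ (hW j this).ne'
      _ = ∑ i : Fin n, w a i := (Fin.sum_univ_eq_sum_range (fun i => w a i) n).symm

/-- The elements of a finite type can be listed by decreasing values of a function. -/
theorem exists_antitone_equiv {B R : Type*} [Fintype B] [LinearOrder R] (W : B → R) :
    ∃ e : Fin (Fintype.card B) ≃ B, ∀ i j, i ≤ j → W (e j) ≤ W (e i) := by
  let e₀ := (Fintype.equivFin B).symm
  let f : Fin (Fintype.card B) → Rᵒᵈ := fun i => OrderDual.toDual (W (e₀ i))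
  refine ⟨(Tuple.sort f).trans e₀, fun i j hij => ?_⟩
  exact Tuple.monotone_sort f hij

/-- Rounding of a fractional assignment: the items `b`, of size `W b`, are distributed over the
elements `a`, which hold `w a b` of `b`. If each `a` is allowed to drop one item, each item can be
given to some `a` that holds a part of it such that no load increases. -/
theorem exists_rounded_assignment {A B : Type*} [Fintype A] [Fintype B] (w : A → B → ℝ)
    (W : B → ℝ) (hw : ∀ a b, 0 ≤ w a b) (hW : ∀ b, 0 < W b) (hsum : ∀ b, ∑ a, w a b = W b) :
    ∃ (f : B → A) (kept : B → Prop), (∀ b, 0 < w (f b) b) ∧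
      (∀ b b', ¬ kept b → ¬ kept b' → f b = f b' → b = b') ∧
      ∀ a, ∑ b with f b = a ∧ kept b, W b ≤ ∑ b, w a b := by
  obtain ⟨e, he⟩ := exists_antitone_equiv W
  have ext_eq : ∀ (g : B → ℝ) (i : Fin (Fintype.card B)),
      (fun j : ℕ => if h : j < Fintype.card B then g (e ⟨j, h⟩) else 0) i = g (e i) :=
    fun g i => by simp
  obtain ⟨f, kept, h1, h2, h3⟩ := exists_rounded_assignment_of_antitone
    (n := Fintype.card B)
    (fun a j => if h : j < Fintype.card B then w a (e ⟨j, h⟩) else 0)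
    (fun j => if h : j < Fintype.card B then W (e ⟨j, h⟩) else 0)
    (fun a i => by
      split_ifs
      · exact hw _ _
      · exact le_rfl)
    (fun i hi => by simp only [hi, dite_true]; exact hW _)
    (fun i j hij hj => by
      simp only [hj, lt_of_le_of_lt hij hj, dite_true]
      exact he _ _ hij)
    (fun i hi => by simp only [hi, dite_true]; exact hsum _)
  refine ⟨fun b => f (e.symm b), fun b => kept (e.symm b), ?_, ?_, ?_⟩
  · intro b
    have := h1 (e.symm b)
    simpa using this
  · intro b b' hb hb' h
    exact e.symm.injective (h2 _ _ hb hb' h)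
  · intro a
    have := h3 a
    simp only [ext_eq W, ext_eq (w a)] at this
    rw [Equiv.sum_comp e (w a)] at this
    refine le_trans (le_of_eq ?_) this
    refine sum_nbij' e.symm e ?_ ?_ ?_ ?_ ?_
    · intro b hb; simpa using hb
    · intro b hb; simpa using hb
    · intro b _; simp
    · intro b _; simp
    · intro b _; simp

/-- Rounding of demands at a vertex. The demands `dem p ≤ k` are sorted by size and cut into groups
of equal cardinality. The first group `D`, of the largest demands, is detached and raised to `k`.
In the other groups the demands are raised to the largest one in the group, and `σ p` is the element
of the previous group whose place is taken by `p`. -/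
theorem exists_rounded_demands {P : Type*} [Fintype P] (dem : P → ℕ) (k : ℕ)
    (hdem : ∀ p, dem p ≤ k) {b : ℝ} (hb : 0 < b) (hb' : b ≤ 1 / 2) :
    ∃ (D : Finset P) (σ : P → P) (new : P → ℕ),
      (∀ p, dem p ≤ new p) ∧ (∀ p, new p ≤ k) ∧ (∀ p ∈ D, new p = k) ∧
      (∀ p ∉ D, new p ≤ dem (σ p)) ∧ (∀ p ∉ D, ∀ q ∉ D, σ p = σ q → p = q) ∧
      (#D : ℝ) ≤ 4 * b * Fintype.card P ∧
      (#(insert k (univ.image new)) : ℝ) ≤ 1 / b := by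
  have hinv : 2 ≤ 1 / b := by
    rw [le_div_iff₀ hb]
    linarith
  set n := Fintype.card P with hn
  -- few demands need no rounding, otherwise there are at most `1 / (2 * b)` groups of `g` demands
  by_cases hsmall : (n : ℝ) ≤ 1 / (2 * b)
  · refine ⟨∅, id, dem, fun _ => le_rfl, hdem, by simp, fun _ _ => le_rfl,
      fun _ _ _ _ h => h, ?_, ?_⟩
    · simp only [card_empty, Nat.cast_zero]
      positivity
    · have h1 : #(insert k (univ.image dem)) ≤ n + 1 :=
        (card_insert_le _ _).trans (Nat.succ_le_succ card_image_le)
      have h2 : (#(insert k (univ.image dem)) : ℝ) ≤ n + 1 := by exact_mod_cast h1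
      have h3 : 1 / (2 * b) = 1 / b / 2 := by field_simp
      linarith
  · push Not at hsmall
    obtain ⟨e, he⟩ := exists_antitone_equiv dem
    rw [div_lt_iff₀ (by positivity)] at hsmall
    set g := ⌈2 * b * n⌉₊ with hg
    have hg1 : (2 * b * n : ℝ) ≤ g := Nat.le_ceil _
    -- as `1 < 2 * b * n`, this is less than `4 * b * n`
    have hg2 : (g : ℝ) < 2 * b * n + 1 := Nat.ceil_lt_add_one (by positivity)
    have hg0 : 0 < g := by
      have : (0 : ℝ) < g := by linarith
      exact_mod_cast this
    have hle : ∀ i : Fin n, g * (i / g) < n := fun i =>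
      lt_of_le_of_lt (Nat.mul_div_le _ _) i.2
    -- the demand at position `i` takes the place of the one at position `i - g` and is rounded up
    -- to the first demand of its group, at position `top i`
    let σ' : Fin n → Fin n := fun i => ⟨i - g, lt_of_le_of_lt (Nat.sub_le _ _) i.2⟩
    let top : Fin n → Fin n := fun i => ⟨g * (i / g), hle i⟩
    refine ⟨univ.filter fun p => (e.symm p : ℕ) < g, fun p => e (σ' (e.symm p)),
      fun p => if (e.symm p : ℕ) < g then k else dem (e (top (e.symm p))), ?_, ?_, ?_, ?_, ?_, ?_,
      ?_⟩
    · intro p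
      simp only
      split_ifs with h
      · exact hdem p
      · have := he (top (e.symm p)) (e.symm p) (Nat.mul_div_le _ _)
        simpa using this
    · intro p
      simp only
      split_ifs with h
      · exact le_rfl
      · exact hdem _
    · intro p hp
      simp only [mem_filter, mem_univ, true_and] at hp
      simp [hp]
    · intro p hp
      simp only [mem_filter, mem_univ, true_and] at hp
      simp only [hp, if_false]
      refine he _ _ ?_
      change (e.symm p : ℕ) - g ≤ g * ((e.symm p : ℕ) / g)
      have h1 := Nat.div_add_mod (e.symm p : ℕ) g
      have h2 := Nat.mod_lt (e.symm p : ℕ) hg0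
      omega
    · intro p hp q hq h
      simp only [mem_filter, mem_univ, true_and] at hp hq
      have h1 := congrArg Fin.val (e.injective h)
      change (e.symm p : ℕ) - g = (e.symm q : ℕ) - g at h1
      exact e.symm.injective (Fin.ext (by omega))
    · have h1 : #(univ.filter fun p => (e.symm p : ℕ) < g) ≤ #(range g) := by
        refine card_le_card_of_injOn (fun p => (e.symm p : ℕ)) ?_ ?_
        · intro p hp
          have : (e.symm p : ℕ) < g := by simpa using hp
          simpa using this
        · intro p _ q _ h
          exact e.symm.injective (Fin.ext h)
      rw [card_range] at h1
      have h2 : (#(univ.filter fun p => (e.symm p : ℕ) < g) : ℝ) ≤ g := by exact_mod_cast h1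
      linarith
    · have hsub : insert k (univ.image fun p =>
          if (e.symm p : ℕ) < g then k else dem (e (top (e.symm p)))) ⊆
          insert k ((Icc 1 (n / g)).image fun q =>
            if h : g * q < n then dem (e ⟨g * q, h⟩) else 0) := by
        intro m hm
        rcases mem_insert.1 hm with rfl | hm
        · exact mem_insert_self _ _
        · obtain ⟨p, -, rfl⟩ := mem_image.1 hm
          split_ifs with h
          · exact mem_insert_self _ _
          · refine mem_insert_of_mem (mem_image.2 ⟨(e.symm p : ℕ) / g, ?_, ?_⟩)
            · rw [mem_Icc]
              exact ⟨(Nat.one_le_div_iff hg0).2 (not_lt.1 h),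
                Nat.div_le_div_right (e.symm p).2.le⟩
            · rw [dif_pos (hle (e.symm p))]
      have h1 := (card_le_card hsub).trans ((card_insert_le _ _).trans
        (Nat.succ_le_succ card_image_le))
      rw [Nat.card_Icc, Nat.add_sub_cancel] at h1
      refine le_trans (b := ((n / g : ℕ) : ℝ) + 1) (by exact_mod_cast h1) ?_
      have h2 : ((n / g : ℕ) : ℝ) ≤ 1 / (2 * b) := by
        refine Nat.cast_div_le.trans ?_
        rw [div_le_div_iff₀ (by exact_mod_cast hg0) (by positivity)]
        linarith
      have h3 : 1 / (2 * b) = 1 / b / 2 := by field_simp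
      linarith

set_option maxHeartbeats 1000000 in
/-- Redistribution of small pieces. The tour `i` holds `a (i, c)` terminals in the component `c`,
and `pass` tells whether it continues to components below `c`. Pieces of less than `K` terminals are
grouped, separately for each component and each value of `pass`, into groups of between `K` and
`2 K` terminals; the groups are given to tours that hold a part of them, where each tour may
refuse one group; and for each component `c` the refused groups and the ungrouped pieces are packed
into new tours `(c, n)`, where only `(c, 0)` may hold less than `K` terminals. -/
theorem exists_redistribution {I C : Type*} [Fintype I] [Fintype C] (a : I × C → ℕ)
    (pass : I × C → Prop) {K : ℝ} {k : ℕ} (hK : 0 < K) (hKk : 4 * K ≤ k) :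
    ∃ ρ : I × C → I ⊕ (C × ℕ),
      (∀ p i, 0 < a p → ρ p = .inl i → 0 < a (i, p.2) ∧ (pass p → pass (i, p.2))) ∧
      (∀ p q, 0 < a p → ρ p = .inr q → q.1 = p.2) ∧
      (∀ p i, 0 < a p → ρ p = .inl i →
        K ≤ ∑ p' with p'.2 = p.2 ∧ ρ p' = .inl i, (a p' : ℝ)) ∧
      (∀ i, ∑ p with ρ p = .inl i, (a p : ℝ) ≤ ∑ p with p.1 = i, (a p : ℝ)) ∧
      (∀ q, ∑ p with ρ p = .inr q, (a p : ℝ) ≤ k) ∧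
      (∀ p q, 0 < a p → ρ p = .inr q → q.2 ≠ 0 → K ≤ ∑ p' with ρ p' = .inr q, (a p' : ℝ)) ∧
      ∀ (ovh : C → ℝ) (M : ℝ), 0 ≤ M → (∀ c, 0 ≤ ovh c) → (∀ c, ovh c ≤ M) →
        ∃ used : Finset (C × ℕ), (∀ p q, 0 < a p → ρ p = .inr q → q ∈ used) ∧
          ∑ q ∈ used, ovh q.1 ≤ (1 + 4 * K / k) * ∑ c, ovh c +
            4 * K / k * M * #{i : I | ∃ c, 0 < a (i, c)} := by
  have hk : (0 : ℝ) < k := by linarith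
  -- the small pieces; their classes `cls`; and their groups `key`, of size `W`, where the label `0`
  -- stands for the pieces of a class that are not grouped
  set small : Finset (I × C) := {p | 0 < a p ∧ (a p : ℝ) < K} with hsmall
  have hsmall' : ∀ p, p ∈ small ↔ 0 < a p ∧ (a p : ℝ) < K := fun p => by simp [hsmall]
  set cls : I × C → C × Bool := fun p => (p.2, decide (pass p)) with hcls
  have hgroup := fun κ : C × Bool => exists_grouping (small.filter fun p => cls p = κ)
    (fun p => (a p : ℝ)) hK (fun p hp => ((hsmall' p).1 (mem_filter.1 hp).1).2)
  choose g hg0 hg using hgroup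
  set key : I × C → (C × Bool) × ℕ := fun p => (cls p, g (cls p) p) with hkey
  set W : (C × Bool) × ℕ → ℝ := fun q => ∑ p ∈ small with key p = q, (a p : ℝ) with hW
  have hWeq : ∀ κ n, W (κ, n) =
      ∑ p ∈ small.filter (fun p => cls p = κ) with g κ p = n, (a p : ℝ) := by
    intro κ n
    simp only [hW, filter_filter]
    refine sum_congr (filter_congr fun p _ => ?_) fun _ _ => rfl
    simp only [hkey, Prod.mk.injEq]
    constructor
    · rintro ⟨h1, h2⟩
      exact ⟨h1, by rw [← h1]; exact h2⟩
    · rintro ⟨h1, h2⟩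
      exact ⟨h1, by rw [h1]; exact h2⟩
  have hW0 : ∀ κ, W (κ, 0) < K := fun κ => by
    rw [hWeq]
    exact hg0 κ
  have hWn : ∀ p ∈ small, (key p).2 ≠ 0 → K ≤ W (key p) ∧ W (key p) < 2 * K := by
    intro p hp hn
    have := hg (cls p) (g (cls p) p) hn ⟨p, mem_filter.2 ⟨hp, rfl⟩, rfl⟩
    rw [← hWeq] at this
    exact this
  have hWnn : ∀ q, 0 ≤ W q := fun q => sum_nonneg fun p _ => Nat.cast_nonneg _
  -- the groups that are to be assigned
  set B : Finset ((C × Bool) × ℕ) := (small.image key).filter fun q => q.2 ≠ 0 with hB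
  have hB' : ∀ q, q ∈ B ↔ (∃ p ∈ small, key p = q) ∧ q.2 ≠ 0 := fun q => by simp [hB]
  have hWB : ∀ q ∈ B, K ≤ W q ∧ W q < 2 * K := by
    intro q hq
    obtain ⟨⟨p, hp, rfl⟩, hn⟩ := (hB' q).1 hq
    exact hWn p hp hn
  -- the part of the group `q` that the tour `i` holds
  set w : I → {q // q ∈ B} → ℝ :=
    fun i q => ∑ p ∈ small with key p = q.1 ∧ p.1 = i, (a p : ℝ) with hw
  have hwsum : ∀ q : {q // q ∈ B}, ∑ i, w i q = W q.1 := by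
    intro q
    simp only [hw, hW]
    rw [← sum_fiberwise (small.filter fun p => key p = q.1) Prod.fst (fun p => (a p : ℝ))]
    refine sum_congr rfl fun i _ => sum_congr ?_ fun _ _ => rfl
    ext p
    simp only [mem_filter, and_assoc]
  obtain ⟨f, kept, hf, hinj, hload⟩ := exists_rounded_assignment w (fun q => W q.1)
    (fun i q => sum_nonneg fun p _ => Nat.cast_nonneg _)
    (fun q => lt_of_lt_of_le hK (hWB q.1 q.2).1) hwsum
  -- the tour `f q` holds a part of the group `q`; so it visits the component of `q` already, and
  -- continues below it if the pieces of `q` come from tours that do so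
  have hf' : ∀ q, ∃ p ∈ small, key p = q.1 ∧ p.1 = f q := by
    intro q
    by_contra hno
    push Not at hno
    have : w (f q) q = 0 := by
      simp only [hw]
      rw [filter_false_of_mem, sum_empty]
      rintro p hp ⟨h1, h2⟩
      exact hno p hp h1 h2
    linarith [hf q]
  -- the packing of refused groups and of ungrouped pieces
  set size : C → {q // q ∈ B} ⊕ Bool → ℝ :=
    fun c => Sum.elim (fun q => W q.1) (fun b => W ((c, b), 0)) with hsize
  have hsizel : ∀ c q, size c (.inl q) = W q.1 := fun c q => rfl
  have hsizer : ∀ c b, size c (.inr b) = W ((c, b), 0) := fun c b => rfl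
  set refused : C → Finset {q // q ∈ B} := fun c => {q | ¬ kept q ∧ q.1.1.1 = c} with hrefused
  set items : C → Finset ({q // q ∈ B} ⊕ Bool) :=
    fun c => (refused c).disjSum univ with hitems
  -- items are smaller than `2 * K ≤ k / 2`, so that they can be packed into groups of at least half
  -- of, and at most, the capacity, up to a rest
  have hpack := fun c => exists_grouping (items c) (size c) (A := (k : ℝ) / 2) (by positivity)
    (fun y _ => by
      rcases y with q | b
      · have := (hWB q.1 q.2).2
        simp only [hsize, Sum.elim_inl]
        linarith
      · have := hW0 (c, b)
        simp only [hsize, Sum.elim_inr]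
        linarith)
  choose h hh0 hh using hpack
  -- the item and the destination of a group; large pieces stay where they are
  set item : (C × Bool) × ℕ → {q // q ∈ B} ⊕ Bool :=
    fun q => if hq : q ∈ B then .inl ⟨q, hq⟩ else .inr q.1.2 with hitem
  set dest : (C × Bool) × ℕ → I ⊕ (C × ℕ) := fun q =>
    if hq : ∃ hq : q ∈ B, kept ⟨q, hq⟩ then .inl (f ⟨q, hq.1⟩)
    else .inr (q.1.1, h q.1.1 (item q)) with hdest
  set ρ : I × C → I ⊕ (C × ℕ) := fun p => if p ∈ small then dest (key p) else .inl p.1 with hρ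
  have hρs : ∀ p ∈ small, ρ p = dest (key p) := fun p hp => if_pos hp
  have hρl : ∀ p, p ∉ small → ρ p = .inl p.1 := fun p hp => if_neg hp
  have hdestl : ∀ q i, dest q = .inl i → ∃ hq : q ∈ B, kept ⟨q, hq⟩ ∧ f ⟨q, hq⟩ = i := by
    intro q i hqi
    simp only [hdest] at hqi
    split_ifs at hqi with h1
    exact ⟨h1.1, h1.2, Sum.inl_injective hqi⟩
  have hdestr : ∀ q r, dest q = .inr r →
      (∀ hq : q ∈ B, ¬ kept ⟨q, hq⟩) ∧ r.1 = q.1.1 ∧ r.2 = h q.1.1 (item q) := by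
    intro q r hqr
    simp only [hdest] at hqr
    split_ifs at hqr with h1
    have := Sum.inr_injective hqr
    refine ⟨fun hq hk => h1 ⟨hq, hk⟩, ?_⟩
    rw [← this]
    exact ⟨rfl, rfl⟩
  have hρr : ∀ p r, ρ p = .inr r → p ∈ small := by
    intro p r hpr
    by_contra hp
    rw [hρl p hp] at hpr
    exact absurd hpr (by simp)
  have hitem_mem : ∀ p ∈ small, (∀ hq : key p ∈ B, ¬ kept ⟨key p, hq⟩) →
      item (key p) ∈ items p.2 := by
    intro p hp hk
    simp only [hitem]
    split_ifs with hq
    · rw [hitems, inl_mem_disjSum, hrefused]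
      simpa using ⟨hk hq, rfl⟩
    · rw [hitems, inr_mem_disjSum]
      exact mem_univ _
  -- the new tour `(c, n)` holds exactly the items of the group `n`
  have hnew : ∀ r : C × ℕ, ∑ p with ρ p = .inr r, (a p : ℝ) =
      ∑ y ∈ items r.1 with h r.1 y = r.2, size r.1 y := by
    rintro ⟨c, n⟩
    have hmaps : ∀ p ∈ univ.filter (fun p => ρ p = .inr (c, n)),
        item (key p) ∈ (items c).filter fun y => h c y = n := by
      intro p hp
      have hp1 : ρ p = .inr (c, n) := by simpa using hp
      have hp2 := hρr p _ hp1
      rw [hρs p hp2] at hp1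
      obtain ⟨h1, h2, h3⟩ := hdestr _ _ hp1
      have h2' : c = p.2 := h2
      refine mem_filter.2 ⟨h2' ▸ hitem_mem p hp2 h1, ?_⟩
      rw [h2']
      exact h3.symm
    rw [← sum_fiberwise_of_maps_to hmaps]
    refine sum_congr rfl fun y hy => ?_
    obtain ⟨hy1, hy2⟩ := mem_filter.1 hy
    rcases y with q | b
    · have hq : ¬ kept q ∧ q.1.1.1 = c := by
        rw [hitems, inl_mem_disjSum, hrefused] at hy1
        simpa using hy1
      simp only [hsize, Sum.elim_inl, hW]
      refine sum_congr ?_ fun _ _ => rfl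
      ext p
      simp only [mem_filter, mem_univ, true_and]
      constructor
      · rintro ⟨h1, h2⟩
        refine ⟨hρr p _ h1, ?_⟩
        simp only [hitem] at h2
        split_ifs at h2 with h3
        rw [← Sum.inl_injective h2]
      · rintro ⟨h1, h2⟩
        have h3 : item (key p) = .inl q := by
          simp only [hitem, h2, q.2, dite_true]
        refine ⟨?_, h3⟩
        rw [hρs p h1, hdest]
        simp only
        rw [dif_neg]
        · rw [h3, h2, hq.2, hy2]
        · rintro ⟨h4, h5⟩
          apply hq.1
          have : (⟨key p, h4⟩ : {q // q ∈ B}) = q := Subtype.ext h2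
          rwa [this] at h5
    · simp only [hsize, Sum.elim_inr, hW]
      refine sum_congr ?_ fun _ _ => rfl
      ext p
      simp only [mem_filter, mem_univ, true_and]
      constructor
      · rintro ⟨h1, h2⟩
        have h4 := hρr p _ h1
        refine ⟨h4, ?_⟩
        rw [hρs p h4] at h1
        obtain ⟨-, h5, -⟩ := hdestr _ _ h1
        simp only [hitem] at h2
        split_ifs at h2 with h3
        have h6 : (key p).2 = 0 := by
          by_contra h6
          exact h3 ((hB' _).2 ⟨⟨p, h4, rfl⟩, h6⟩)
        exact Prod.ext (Prod.ext h5.symm (Sum.inr_injective h2)) h6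
      · rintro ⟨h1, h2⟩
        have h3 : key p ∉ B := fun hq => ((hB' _).1 hq).2 (by rw [h2])
        have h4 : item (key p) = .inr b := by
          simp only [hitem]
          rw [dif_neg h3, h2]
        refine ⟨?_, h4⟩
        rw [hρs p h1, hdest]
        simp only
        rw [dif_neg (fun h5 => h3 h5.1), h4, h2, hy2]
  have hused : ∀ p r, ρ p = .inr r → ∃ y ∈ items r.1, h r.1 y = r.2 := by
    intro p r hpr
    have hp2 := hρr p _ hpr
    rw [hρs p hp2] at hpr
    obtain ⟨h1, h2, h3⟩ := hdestr _ _ hpr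
    have h2' : r.1 = p.2 := h2
    refine ⟨item (key p), h2' ▸ hitem_mem p hp2 h1, ?_⟩
    rw [h2']
    exact h3.symm
  refine ⟨ρ, ?_, ?_, ?_, ?_, ?_, ?_, ?_⟩
  · intro p i hp hpi
    by_cases hps : p ∈ small
    · rw [hρs p hps] at hpi
      obtain ⟨hq, -, rfl⟩ := hdestl _ _ hpi
      obtain ⟨p', hp', h1, h2⟩ := hf' ⟨key p, hq⟩
      have h3 : cls p' = cls p := congrArg Prod.fst h1
      have h4 : p'.2 = p.2 := congrArg Prod.fst h3
      have h5 : decide (pass p') = decide (pass p) := congrArg Prod.snd h3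
      have h6 : (f ⟨key p, hq⟩, p.2) = p' := Prod.ext h2.symm h4.symm
      rw [h6]
      exact ⟨((hsmall' _).1 hp').1, fun h7 => by simpa [h7] using h5⟩
    · rw [hρl p hps] at hpi
      rw [← Sum.inl_injective hpi]
      exact ⟨hp, id⟩
  · intro p q _ hpq
    have hps := hρr p _ hpq
    rw [hρs p hps] at hpq
    exact (hdestr _ _ hpq).2.1
  · intro p i hp hpi
    by_cases hps : p ∈ small
    · have hpi' := hpi
      rw [hρs p hps] at hpi
      obtain ⟨hq, -, -⟩ := hdestl _ _ hpi
      refine (hWB _ hq).1.trans ?_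
      refine sum_le_sum_of_subset_of_nonneg ?_ fun _ _ _ => Nat.cast_nonneg _
      intro p' hp'
      obtain ⟨h1, h2⟩ := mem_filter.1 hp'
      have h3 : cls p' = cls p := congrArg Prod.fst h2
      refine mem_filter.2 ⟨mem_univ _, congrArg Prod.fst h3, ?_⟩
      rw [hρs p' h1, h2, hpi]
    · have h1 : K ≤ a p := by
        by_contra h1
        exact hps ((hsmall' p).2 ⟨hp, not_le.1 h1⟩)
      refine h1.trans ?_
      exact single_le_sum (f := fun p => (a p : ℝ)) (fun _ _ => Nat.cast_nonneg _)
        (mem_filter.2 ⟨mem_univ p, rfl, hpi⟩)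
  · intro i
    rw [← sum_filter_add_sum_filter_not (univ.filter fun p => ρ p = .inl i) (· ∈ small),
      ← sum_filter_add_sum_filter_not (univ.filter fun p : I × C => p.1 = i) (· ∈ small)]
    refine add_le_add ?_ (le_of_eq ?_)
    · have hmaps : ∀ p ∈ (univ.filter fun p => ρ p = .inl i).filter (· ∈ small),
          key p ∈ B.filter fun q => dest q = .inl i := by
        intro p hp
        simp only [mem_filter, mem_univ, true_and] at hp
        have h1 := hp.1
        rw [hρs p hp.2] at h1
        exact mem_filter.2 ⟨(hdestl _ _ h1).1, h1⟩
      calc ∑ p ∈ (univ.filter fun p => ρ p = .inl i).filter (· ∈ small), (a p : ℝ)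
          ≤ ∑ q : {q // q ∈ B} with f q = i ∧ kept q, W q.1 := by
            rw [← sum_fiberwise_of_maps_to hmaps]
            refine (sum_le_sum (g := W) fun q _ => ?_).trans (le_of_eq ?_)
            · refine sum_le_sum_of_subset_of_nonneg ?_ fun _ _ _ => Nat.cast_nonneg _
              intro p hp
              simp only [mem_filter, mem_univ, true_and] at hp ⊢
              exact ⟨hp.1.2, hp.2⟩
            · symm
              refine sum_bij (fun q _ => q.1) ?_ ?_ ?_ ?_
              · intro q hq
                simp only [mem_filter, mem_univ, true_and] at hq
                refine mem_filter.2 ⟨q.2, ?_⟩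
                simp only [hdest]
                rw [dif_pos ⟨q.2, hq.2⟩]
                exact congrArg _ hq.1
              · intro q _ q' _ hqq
                exact Subtype.ext hqq
              · intro q hq
                obtain ⟨h1, h2⟩ := mem_filter.1 hq
                obtain ⟨h3, h4, h5⟩ := hdestl _ _ h2
                exact ⟨⟨q, h3⟩, by simp [h4, h5], rfl⟩
              · intro q _
                rfl
        _ ≤ ∑ q, w i q := hload i
        _ = ∑ q ∈ B, ∑ p ∈ ((univ.filter fun p : I × C => p.1 = i).filter (· ∈ small))
              with key p = q, (a p : ℝ) := by
            rw [← Finset.sum_coe_sort B]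
            refine sum_congr rfl fun q _ => sum_congr ?_ fun _ _ => rfl
            ext p
            simp only [mem_filter, mem_univ, true_and]
            tauto
        _ ≤ _ := by
            rw [← sum_biUnion]
            · refine sum_le_sum_of_subset_of_nonneg ?_ fun _ _ _ => Nat.cast_nonneg _
              intro p hp
              obtain ⟨q, -, hp⟩ := mem_biUnion.1 hp
              exact (mem_filter.1 hp).1
            · intro q _ q' _ hne
              simp only [Function.onFun]
              rw [Finset.disjoint_left]
              intro p hp hp'
              exact hne ((mem_filter.1 hp).2.symm.trans (mem_filter.1 hp').2)
    · refine sum_congr ?_ fun _ _ => rfl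
      ext p
      simp only [mem_filter, mem_univ, true_and]
      constructor
      · rintro ⟨h1, h2⟩
        rw [hρl p h2] at h1
        exact ⟨Sum.inl_injective h1, h2⟩
      · rintro ⟨h1, h2⟩
        exact ⟨by rw [hρl p h2, h1], h2⟩
  · rintro ⟨c, n⟩
    rw [hnew]
    by_cases hn : n = 0
    · have := hh0 c
      simp only [hn]
      linarith
    · by_cases hex : ∃ y ∈ items c, h c y = n
      · have := (hh c n hn hex).2
        simp only
        linarith
      · rw [filter_false_of_mem, sum_empty]
        · exact hk.le
        · intro y hy hyn
          exact hex ⟨y, hy, hyn⟩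
  · rintro p ⟨c, n⟩ hp hpq hn
    rw [hnew]
    have hex := hused p _ hpq
    have := (hh c n hn hex).1
    simp only
    linarith
  · intro ovh M hM0 hovh hM
    -- the new tours `(c, n)` with `n ≠ 0`: each of them is at least half full, so that there are
    -- few compared to the refused groups
    set E : C → Finset ℕ := fun c => ((items c).image (h c)).erase 0 with hE
    have hEcard : ∀ c, (#(E c) : ℝ) ≤ 4 * K / k * (#(refused c) + 1) := by
      intro c
      have h1 : (#(E c) : ℝ) * ((k : ℝ) / 2) ≤ ∑ y ∈ items c, size c y := by
        have hnn : ∀ y ∈ items c, 0 ≤ size c y := by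
          rintro (q | b) _
          · exact hWnn _
          · exact hWnn _
        calc (#(E c) : ℝ) * ((k : ℝ) / 2) = ∑ n ∈ E c, (k : ℝ) / 2 := by simp
          _ ≤ ∑ n ∈ E c, ∑ y ∈ items c with h c y = n, size c y := by
              refine sum_le_sum fun n hn => ?_
              obtain ⟨h1, h2⟩ := mem_erase.1 hn
              exact (hh c n h1 (mem_image.1 h2)).1
          _ ≤ ∑ n ∈ (items c).image (h c), ∑ y ∈ items c with h c y = n, size c y :=
              sum_le_sum_of_subset_of_nonneg (erase_subset _ _) fun n _ _ =>
                sum_nonneg fun y hy => hnn y (mem_filter.1 hy).1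
          _ = ∑ y ∈ items c, size c y :=
              sum_fiberwise_of_maps_to (fun y hy => mem_image_of_mem _ hy) _
      have h2 : ∑ y ∈ items c, size c y ≤ 2 * K * (#(refused c) + 1) := by
        simp only [hitems]
        rw [sum_disjSum]
        have h3 : ∑ q ∈ refused c, size c (.inl q) ≤ ∑ q ∈ refused c, 2 * K :=
          sum_le_sum fun q _ => by
            rw [hsizel]
            exact (hWB q.1 q.2).2.le
        have h4 : ∑ b : Bool, size c (.inr b) ≤ ∑ b : Bool, K :=
          sum_le_sum fun b _ => by
            rw [hsizer]
            exact (hW0 (c, b)).le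
        refine (add_le_add h3 h4).trans (le_of_eq ?_)
        simp only [sum_const, card_univ, Fintype.card_bool, nsmul_eq_mul, Nat.cast_ofNat]
        ring
      rw [div_mul_eq_mul_div, le_div_iff₀ hk]
      linarith
    refine ⟨univ.biUnion fun c => (insert 0 (E c)).image fun n => (c, n), ?_, ?_⟩
    · rintro p ⟨c, n⟩ _ hpq
      refine mem_biUnion.2 ⟨c, mem_univ c, mem_image.2 ⟨n, ?_, rfl⟩⟩
      by_cases hn : n = 0
      · rw [hn]
        exact mem_insert_self _ _
      · obtain ⟨y, hy, hyn⟩ := hused p _ hpq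
        exact mem_insert_of_mem (mem_erase.2 ⟨hn, mem_image.2 ⟨y, hy, hyn⟩⟩)
    · -- each tour refuses at most one group
      have hrefcard : ∑ c, #(refused c) ≤ #{i : I | ∃ c, 0 < a (i, c)} := by
        rw [← card_biUnion]
        · refine card_le_card_of_injOn f ?_ ?_
          · intro q _
            obtain ⟨p, hp, -, h2⟩ := hf' q
            simp only [coe_filter, mem_univ, true_and, Set.mem_ofPred_eq]
            refine ⟨p.2, ?_⟩
            rw [← h2]
            exact ((hsmall' p).1 hp).1
          · intro q hq q' hq' hff
            have h1 : ¬ kept q := by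
              obtain ⟨c, -, hc⟩ := mem_biUnion.1 hq
              exact (mem_filter.1 hc).2.1
            have h2 : ¬ kept q' := by
              obtain ⟨c, -, hc⟩ := mem_biUnion.1 hq'
              exact (mem_filter.1 hc).2.1
            exact hinj q q' h1 h2 hff
        · intro c _ c' _ hne
          simp only [Function.onFun]
          rw [Finset.disjoint_left]
          intro q hq hq'
          exact hne ((mem_filter.1 hq).2.2.symm.trans (mem_filter.1 hq').2.2)
      have hrefcard' : ∑ c, (#(refused c) : ℝ) ≤ #{i : I | ∃ c, 0 < a (i, c)} := by
        exact_mod_cast hrefcard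
      have hq : 0 ≤ 4 * K / k := by positivity
      calc ∑ q ∈ univ.biUnion fun c => (insert 0 (E c)).image fun n => (c, n), ovh q.1
          ≤ ∑ c, (1 + #(E c)) * ovh c := by
            rw [sum_biUnion]
            · refine sum_le_sum fun c _ => ?_
              rw [sum_image (fun n _ n' _ hnn => congrArg Prod.snd hnn)]
              simp only [sum_const, nsmul_eq_mul]
              refine mul_le_mul_of_nonneg_right ?_ (hovh c)
              have := card_insert_le 0 (E c)
              have h2 : (#(insert 0 (E c)) : ℝ) ≤ #(E c) + 1 := by exact_mod_cast this
              linarith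
            · intro c _ c' _ hne
              simp only [Function.onFun]
              rw [Finset.disjoint_left]
              intro q hq hq'
              obtain ⟨n, -, rfl⟩ := mem_image.1 hq
              obtain ⟨n', -, h2⟩ := mem_image.1 hq'
              exact hne (congrArg Prod.fst h2).symm
        _ ≤ ∑ c, ((1 + 4 * K / k) * ovh c + 4 * K / k * M * #(refused c)) := by
            refine sum_le_sum fun c _ => ?_
            have h1 := hEcard c
            have h2 := hM c
            have h3 := hovh c
            have h4 : (#(E c) : ℝ) * ovh c ≤ 4 * K / k * (#(refused c) + 1) * ovh c :=
              mul_le_mul_of_nonneg_right h1 h3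
            have h5 : 4 * K / k * #(refused c) * ovh c ≤ 4 * K / k * #(refused c) * M :=
              mul_le_mul_of_nonneg_left h2 (mul_nonneg hq (Nat.cast_nonneg _))
            linarith
        _ = (1 + 4 * K / k) * ∑ c, ovh c + 4 * K / k * M * ∑ c, (#(refused c) : ℝ) := by
            rw [sum_add_distrib, mul_sum, mul_sum]
        _ ≤ _ := by
            have := mul_le_mul_of_nonneg_left hrefcard' (mul_nonneg hq hM0)
            linarith

open _root_.TreeCVRP.RootedTree

/-! ### The structure of component decompositions -/

namespace Decomposition

variable {V : Type*} [Fintype V] [DecidableEq V] {T : RootedTree V} {D : Decomposition T}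

theorem ne_root_of_mem {c : D.Comp} {v : V} (hv : v ∈ c.1) : v ≠ T.root := by
  have h : v ∈ T.edges := D.partition.le c.2 hv
  simpa [RootedTree.edges] using h

theorem exists_comp {v : V} (hv : v ≠ T.root) : ∃ c : D.Comp, v ∈ c.1 := by
  have h : v ∈ T.edges := by simp [RootedTree.edges, hv]
  exact ⟨⟨D.partition.part v, D.partition.part_mem.2 h⟩, D.partition.mem_part h⟩

theorem comp_eq_of_mem {c c' : D.Comp} {v : V} (h : v ∈ c.1) (h' : v ∈ c'.1) : c = c' :=
  Subtype.ext (D.partition.eq_of_mem_parts c.2 c'.2 h h')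

theorem comp_nonempty (c : D.Comp) : ∃ v, v ∈ c.1 := D.partition.nonempty_of_mem_parts c.2

/-- An ancestor of a vertex of a component lies in the component or above its root. -/
theorem mem_or_isAncestor_top {c : D.Comp} {u v : V} (hv : v ∈ c.1) (h : T.IsAncestor u v) :
    u ∈ c.1 ∨ T.IsAncestor u (D.top c) := by
  refine h.induction (p := fun v => v ∈ c.1 → u ∈ c.1 ∨ T.IsAncestor u (D.top c)) Or.inl ?_ hv
  intro v _ h1 ih hv
  rcases D.connected c v hv with h2 | h2
  · exact Or.inr (h2 ▸ h1)
  · exact ih h2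

theorem top_isAncestor {c : D.Comp} {v : V} (hv : v ∈ c.1) : T.IsAncestor (D.top c) v := by
  have key : ∀ n, ∀ v ∈ c.1, T.depth v ≤ n → T.IsAncestor (D.top c) v := by
    intro n
    induction n with
    | zero =>
      intro v hv hd
      exact absurd (depth_eq_zero.1 (Nat.le_zero.1 hd)) (ne_root_of_mem hv)
    | succ n ih =>
      intro v hv hd
      have h1 := T.depth_parent v (ne_root_of_mem hv)
      rcases D.connected c v hv with h2 | h2
      · exact h2 ▸ T.isAncestor_parent v
      · exact (ih _ h2 (by omega)).trans (T.isAncestor_parent v)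
  exact key _ v hv le_rfl

theorem top_ne {c : D.Comp} {v : V} (hv : v ∈ c.1) : D.top c ≠ v :=
  fun h => D.top_notMem c (h ▸ hv)

theorem not_isAncestor_top {c : D.Comp} {v : V} (hv : v ∈ c.1) : ¬ T.IsAncestor v (D.top c) :=
  fun h => top_ne hv ((top_isAncestor hv).antisymm h)

theorem mem_of_isAncestor {c : D.Comp} {u v : V} (hv : v ∈ c.1) (h : T.IsAncestor u v)
    (h' : T.IsAncestor (D.top c) u) (hne : D.top c ≠ u) : u ∈ c.1 :=
  (mem_or_isAncestor_top hv h).resolve_right fun h2 => hne (h'.antisymm h2)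

theorem depth_top_lt {c : D.Comp} {v : V} (hv : v ∈ c.1) : T.depth (D.top c) < T.depth v :=
  (top_isAncestor hv).depth_lt (top_ne hv)

theorem exists_child_top (c : D.Comp) : ∃ v ∈ c.1, T.parent v = D.top c := by
  obtain ⟨v, hv⟩ := comp_nonempty c
  obtain ⟨w, h1, h2, h3⟩ := (top_isAncestor hv).exists_child (top_ne hv)
  refine ⟨w, mem_of_isAncestor hv h3 (h2 ▸ T.isAncestor_parent w) ?_, h2⟩
  rw [← h2]
  exact parent_ne h1

theorem mem_verts {c : D.Comp} {v : V} : v ∈ D.verts c ↔ v = D.top c ∨ v ∈ c.1 := mem_insert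

theorem top_isAncestor_of_mem_verts {c : D.Comp} {v : V} (hv : v ∈ D.verts c) :
    T.IsAncestor (D.top c) v := by
  rcases mem_verts.1 hv with rfl | h
  · exact T.isAncestor_refl _
  · exact top_isAncestor h

/-- If an edge that does not belong to `c` hangs below a vertex of `c`, it starts a new
component there. -/
theorem top_eq_of_notMem {c c' : D.Comp} {w : V} (hw : w ∈ c'.1) (hp : T.parent w ∈ c.1)
    (hwc : w ∉ c.1) : D.top c' = T.parent w := by
  rcases D.connected c' w hw with h | h
  · exact h.symm
  · have := comp_eq_of_mem h hp
    rw [this] at hw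
    exact absurd hw hwc

/-- On the way from a vertex `v` of `c` down to a vertex outside of `c`, one passes through the
root of another component. -/
theorem exists_top_mem {c : D.Comp} {v x : V} (hv : v ∈ c.1) (hx : x ∉ c.1)
    (h : T.IsAncestor v x) : ∃ m : D.Comp, D.top m ∈ c.1 ∧ T.IsAncestor v (D.top m) ∧
      T.IsAncestor (D.top m) x := by
  refine h.induction (p := fun x => x ∉ c.1 → ∃ m : D.Comp, D.top m ∈ c.1 ∧
    T.IsAncestor v (D.top m) ∧ T.IsAncestor (D.top m) x) (fun h => absurd hv h) ?_ hx
  intro x hx0 h1 ih hx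
  by_cases hp : T.parent x ∈ c.1
  · obtain ⟨m, hm⟩ := exists_comp (D := D) hx0
    have h2 := top_eq_of_notMem hm hp hx
    rw [← h2] at hp h1
    exact ⟨m, hp, h1, h2 ▸ T.isAncestor_parent x⟩
  · obtain ⟨m, h2, h3, h4⟩ := ih hp
    exact ⟨m, h2, h3, h4.trans (T.isAncestor_parent x)⟩

variable {Γ : ℝ} {k : ℕ}

/-- A vertex of `c` that is the root of a component is the exit vertex of `c`. -/
theorem Admissible.exit_unique (hA : D.Admissible Γ k) {c : D.Comp} {v m : V} {b : D.Comp}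
    (hb : D.top b ∈ c.1) (hv : v ∈ c.1) (hm : m = D.top b) : T.parent v ≠ m ∧
      ∀ b' : D.Comp, D.top b' ∈ c.1 → D.top b' = m := by
  subst hm
  have hne : ∀ b : D.Comp, D.top b ∈ c.1 → b ≠ c := fun b hb h => D.top_notMem b (h ▸ hb)
  have hint : ¬ D.IsLeaf c := fun hl =>
    top_ne hb (hA.leaf_meets c hl b (hne b hb) _ (mem_verts.2 (Or.inr hb))
      (mem_verts.2 (Or.inl rfl))).symm
  obtain ⟨e, he, hchild, -, hmeet⟩ := hA.internal_meets c hint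
  have hex : ∀ b : D.Comp, D.top b ∈ c.1 → D.top b = e := fun b hb =>
    (hmeet b (hne b hb) _ (mem_verts.2 (Or.inr hb)) (mem_verts.2 (Or.inl rfl))).resolve_left
      (top_ne hb).symm
  rw [hex b hb]
  exact ⟨hchild v hv, hex⟩

theorem Admissible.eq_of_top_mem (hA : D.Admissible Γ k) {c b b' : D.Comp}
    (hb : D.top b ∈ c.1) (hb' : D.top b' ∈ c.1) : D.top b' = D.top b :=
  (hA.exit_unique hb hb rfl).2 b' hb'

/-- Below each component there is a leaf component. -/
theorem Admissible.exists_isLeaf (hA : D.Admissible Γ k) (c : D.Comp) :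
    ∃ b : D.Comp, D.IsLeaf b ∧ T.IsAncestor (D.top c) (D.top b) := by
  obtain ⟨b, hb, hmax⟩ := exists_max_image
    (univ.filter fun b : D.Comp => T.IsAncestor (D.top c) (D.top b))
    (fun b => T.depth (D.top b)) ⟨c, by simp [T.isAncestor_refl]⟩
  simp only [mem_filter, mem_univ, true_and] at hb hmax
  refine ⟨b, ?_, hb⟩
  by_contra hl
  obtain ⟨e, he, -, ⟨b', hne, hb'⟩, -⟩ := hA.internal_meets b hl
  rcases mem_verts.1 hb' with h | h
  · subst h
    have h1 := hmax b' (hb.trans (top_isAncestor he))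
    have h2 := depth_top_lt he
    omega
  · exact hne (comp_eq_of_mem h he)

variable (D) in
/-- The spine of a component: the path from its root to its exit vertex, which every tour that
visits terminals below the component has to use. -/
def spine (c : D.Comp) : Finset V := {v ∈ c.1 | ∃ x ∈ T.leaves, x ∉ c.1 ∧ T.IsAncestor v x}

theorem mem_spine {c : D.Comp} {v : V} :
    v ∈ D.spine c ↔ v ∈ c.1 ∧ ∃ x ∈ T.leaves, x ∉ c.1 ∧ T.IsAncestor v x := by
  simp [spine]

theorem Admissible.isAncestor_of_mem_spine (hA : D.Admissible Γ k) {c : D.Comp} {u v x : V}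
    (hu : u ∈ D.spine c) (hv : v ∈ c.1) (hx : x ∉ c.1) (h : T.IsAncestor v x) :
    T.IsAncestor u x := by
  obtain ⟨hu, y, -, hy, huy⟩ := mem_spine.1 hu
  obtain ⟨m, h1, h2, -⟩ := exists_top_mem hu hy huy
  obtain ⟨m', h3, -, h4⟩ := exists_top_mem hv hx h
  rw [hA.eq_of_top_mem h1 h3] at h4
  exact h2.trans h4

variable (D) in
/-- The length of the way from the depot through the spine of `c`: what a new tour for terminals
of `c` has to pay in addition to the edges off the spine. -/
def overhead (c : D.Comp) : ℝ := T.dist (D.top c) + ∑ v ∈ D.spine c, T.weight v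

theorem overhead_nonneg (hw : ∀ v, v ≠ T.root → 0 ≤ T.weight v) (c : D.Comp) :
    0 ≤ D.overhead c :=
  add_nonneg (dist_nonneg hw _)
    (sum_nonneg fun v hv => hw v (ne_root_of_mem (mem_spine.1 hv).1))

theorem Admissible.overhead_le (hA : D.Admissible Γ k)
    (hw : ∀ v, v ≠ T.root → 0 ≤ T.weight v) {M : ℝ} (hM : ∀ x ∈ T.leaves, T.dist x ≤ M)
    (c : D.Comp) : D.overhead c ≤ M := by
  rcases (D.spine c).eq_empty_or_nonempty with h | ⟨v, hv⟩
  · obtain ⟨x, hx, hx'⟩ := T.exists_leaf (D.top c)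
    rw [overhead, h, sum_empty, add_zero]
    exact (hx'.dist_le hw).trans (hM x hx)
  · obtain ⟨hv1, x, hx, hxc, hvx⟩ := mem_spine.1 hv
    refine le_trans ?_ (hM x hx)
    rw [overhead, dist_eq_spanWeight, dist_eq_spanWeight, spanWeight, spanWeight, ← sum_union]
    · refine sum_le_sum_of_subset_of_nonneg ?_ fun u hu _ => hw u (mem_span.1 hu).1
      intro u hu
      rw [mem_span_singleton]
      rcases mem_union.1 hu with hu | hu
      · obtain ⟨h1, h2⟩ := mem_span_singleton.1 hu
        exact ⟨h1, h2.trans ((top_isAncestor hv1).trans hvx)⟩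
      · exact ⟨ne_root_of_mem (mem_spine.1 hu).1, hA.isAncestor_of_mem_spine hu hv1 hxc hvx⟩
    · rw [Finset.disjoint_left]
      intro u hu hu'
      exact not_isAncestor_top (mem_spine.1 hu').1 (mem_span_singleton.1 hu).2

variable (D) in
/-- The terminals of a component. -/
def terminals (c : D.Comp) : Finset T.leaves := {x | (x : V) ∈ c.1}

theorem mem_terminals {c : D.Comp} {x : T.leaves} : x ∈ D.terminals c ↔ (x : V) ∈ c.1 := by
  simp [terminals]

theorem numTerminals_eq (c : D.Comp) : D.numTerminals c = #(D.terminals c) := by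
  have h : {v | v ∈ D.verts c ∧ v ∈ T.leaves} =
      (((D.terminals c).map (Function.Embedding.subtype _) : Finset V) : Set V) := by
    ext v
    simp only [coe_map, Set.mem_image, mem_coe, mem_terminals, Set.mem_ofPred_eq, mem_verts,
      Function.Embedding.subtype_apply]
    constructor
    · rintro ⟨rfl | h1, h2⟩
      · exfalso
        obtain ⟨w, hw, hw'⟩ := exists_child_top c
        have : w ∈ T.children (D.top c) := ⟨ne_root_of_mem hw, hw'⟩
        rw [show T.children (D.top c) = ∅ from h2] at this
        exact this
      · exact ⟨⟨v, h2⟩, h1, rfl⟩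
    · rintro ⟨x, hx, rfl⟩
      exact ⟨Or.inr hx, x.2⟩
  rw [numTerminals, h, Set.ncard_coe_finset, card_map]

theorem top_eq_root_of_card_le_one (h : #D.partition.parts ≤ 1) (c : D.Comp) :
    D.top c = T.root := by
  by_contra hne
  obtain ⟨c', hc'⟩ := exists_comp (D := D) hne
  have : c' = c := Subtype.ext (Finset.card_le_one.1 h _ c'.2 _ c.2)
  rw [this] at hc'
  exact D.top_notMem c hc'

end Decomposition

/-- A sum over a covered set is at most the sum over the covering sets. -/
theorem sum_le_sum_of_subset_biUnion {α ι : Type*} [DecidableEq α] {s : Finset α} {I : Finset ι}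
    {t : ι → Finset α} {f : α → ℝ} (h : s ⊆ I.biUnion t) (hf : ∀ i ∈ I, ∀ v ∈ t i, 0 ≤ f v) :
    ∑ v ∈ s, f v ≤ ∑ i ∈ I, ∑ v ∈ t i, f v := by
  calc ∑ v ∈ s, f v ≤ ∑ v ∈ I.biUnion t, f v :=
        sum_le_sum_of_subset_of_nonneg h fun v hv _ => by
          obtain ⟨i, hi, hv⟩ := mem_biUnion.1 hv
          exact hf i hi v hv
    _ ≤ ∑ v ∈ I.biUnion t, ∑ i ∈ I, if v ∈ t i then f v else 0 := by
        refine sum_le_sum fun v hv => ?_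
        obtain ⟨i, hi, hvi⟩ := mem_biUnion.1 hv
        refine le_trans ?_ (single_le_sum (f := fun i => if v ∈ t i then f v else 0) ?_ hi)
        · simp [hvi]
        · intro j hj
          split_ifs with hvj
          · exact hf j hj v hvj
          · exact le_rfl
    _ = ∑ i ∈ I, ∑ v ∈ I.biUnion t, if v ∈ t i then f v else 0 := sum_comm
    _ = ∑ i ∈ I, ∑ v ∈ t i, f v := by
        refine sum_congr rfl fun i hi => ?_
        rw [← sum_filter]
        refine sum_congr ?_ fun _ _ => rfl
        ext v
        simp only [mem_filter, mem_biUnion]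
        exact ⟨fun hv => hv.2, fun hv => ⟨⟨i, hi, hv⟩, hv⟩⟩

theorem sum_le_sum_of_subset_union {α : Type*} [DecidableEq α] {s a b : Finset α} {f : α → ℝ}
    (h : s ⊆ a ∪ b)
    (ha : ∀ v ∈ a, 0 ≤ f v) (hb : ∀ v ∈ b, 0 ≤ f v) :
    ∑ v ∈ s, f v ≤ ∑ v ∈ a, f v + ∑ v ∈ b, f v := by
  have := sum_le_sum_of_subset_biUnion (s := s) (I := (univ : Finset Bool))
    (t := fun i => if i then a else b) (f := f) (fun v hv => by simpa [or_comm] using h hv)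
    (fun i _ v hv => by cases i <;> simp_all)
  simpa [Fintype.sum_bool] using this

/-! ### Bounds for the cost of a distribution of the terminals to tours -/

section Distribution

variable {V : Type*} {T : RootedTree V} {I : Type*}

/-- The set of locations of the terminals that are assigned to the tour `i`. -/
def tourSet (t : T.leaves → I) (i : I) : Set V := {v | ∃ x, t x = i ∧ (x : V) = v}

theorem mem_tourSet (t : T.leaves → I) (x : T.leaves) : (x : V) ∈ tourSet t (t x) :=
  ⟨x, rfl, rfl⟩

variable [Fintype V] [Fintype I]

/-- The total weight of the subtrees spanned by the tours. -/
def totalSpan (t : T.leaves → I) : ℝ := ∑ i, T.spanWeight (tourSet t i)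

variable {t : T.leaves → I} {k : ℕ} (hw : ∀ v, v ≠ T.root → 0 ≤ T.weight v)
  (hcap : ∀ i, #{x | t x = i} ≤ k)

include hw hcap

/-- The radial lower bound: a tour costs at least the average distance of the terminals that it
visits, times their number, divided by the capacity. -/
theorem sum_dist_le : ∑ x : T.leaves, T.dist x ≤ k * totalSpan t := by
  rw [← sum_fiberwise univ t, totalSpan, mul_sum]
  refine sum_le_sum fun i _ => ?_
  calc ∑ x with t x = i, T.dist x ≤ ∑ x with t x = i, T.spanWeight (tourSet t i) := by
        refine sum_le_sum fun x hx => ?_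
        have : t x = i := by simpa using hx
        exact dist_le_spanWeight hw (this ▸ mem_tourSet t x) (T.isAncestor_refl _)
    _ = #{x | t x = i} * T.spanWeight (tourSet t i) := by simp
    _ ≤ k * T.spanWeight (tourSet t i) :=
        mul_le_mul_of_nonneg_right (by exact_mod_cast hcap i) (spanWeight_nonneg hw _)

variable [DecidableEq V] {D : Decomposition T} {Γ : ℝ} (hA : D.Admissible Γ k) (hk : 1 ≤ k)

include hA hk

/-- Below each spine there is a big leaf component, so that many tours use the spine. -/
theorem sum_spine_le : Γ * ∑ c, ∑ v ∈ D.spine c, T.weight v ≤ totalSpan t := by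
  have hk' : (0 : ℝ) < k := by exact_mod_cast hk
  -- a big component has at least `Γ k` terminals, which need at least `Γ` tours
  have hmany : ∀ c, ∀ v ∈ D.spine c, Γ ≤ #{i | v ∈ T.span (tourSet t i)} := by
    intro c v hv
    obtain ⟨hvc, x, -, hx, hvx⟩ := Decomposition.mem_spine.1 hv
    obtain ⟨m, hm1, hm2, -⟩ := Decomposition.exists_top_mem hvc hx hvx
    have hcard : 1 < #D.partition.parts := by
      by_contra h
      have := Decomposition.top_eq_root_of_card_le_one (not_lt.1 h) m
      exact Decomposition.ne_root_of_mem hm1 this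
    obtain ⟨b, hb, hmb⟩ := hA.exists_isLeaf m
    have h1 := hA.leaf_big hcard b hb
    rw [Decomposition.IsBig, Decomposition.numTerminals_eq] at h1
    have h2 : #(D.terminals b) ≤ k * #{i | v ∈ T.span (tourSet t i)} := by
      refine card_le_mul_card_image_of_maps_to (f := t) ?_ k ?_
      · intro y hy
        simp only [mem_filter, mem_univ, true_and]
        exact mem_span.2 ⟨Decomposition.ne_root_of_mem hvc, y, mem_tourSet t y,
          (hm2.trans hmb).trans
            (Decomposition.top_isAncestor (Decomposition.mem_terminals.1 hy))⟩
      · intro i _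
        exact (card_le_card (filter_subset_filter _ (subset_univ _))).trans (hcap i)
    have h3 : (#(D.terminals b) : ℝ) ≤ k * #{i | v ∈ T.span (tourSet t i)} := by
      exact_mod_cast h2
    have h4 : (k : ℝ) * Γ ≤ k * #{i | v ∈ T.span (tourSet t i)} := by linarith
    exact le_of_mul_le_mul_left h4 hk'
  -- the total span, computed edge by edge
  have hswap : totalSpan t = ∑ v with v ≠ T.root,
      T.weight v * #{i | v ∈ T.span (tourSet t i)} := by
    simp only [totalSpan, spanWeight]
    rw [sum_congr rfl (g := fun i => ∑ v with v ≠ T.root,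
      if v ∈ T.span (tourSet t i) then T.weight v else 0)]
    · rw [sum_comm]
      refine sum_congr rfl fun v _ => ?_
      rw [← sum_filter, sum_const, nsmul_eq_mul, mul_comm]
    · intro i _
      rw [← sum_filter, filter_filter]
      refine sum_congr ?_ fun _ _ => rfl
      ext v
      simp only [mem_filter, mem_univ, true_and]
      exact ⟨fun h => ⟨(mem_span.1 h).1, h⟩, fun h => h.2⟩
  rw [hswap, ← sum_biUnion, mul_sum]
  · calc ∑ v ∈ univ.biUnion D.spine, Γ * T.weight v
        ≤ ∑ v ∈ univ.biUnion D.spine, T.weight v * #{i | v ∈ T.span (tourSet t i)} := by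
          refine sum_le_sum fun v hv => ?_
          obtain ⟨c, -, hv⟩ := mem_biUnion.1 hv
          rw [mul_comm]
          exact mul_le_mul_of_nonneg_left (hmany c v hv)
            (hw v (Decomposition.ne_root_of_mem (Decomposition.mem_spine.1 hv).1))
      _ ≤ _ := by
          refine sum_le_sum_of_subset_of_nonneg ?_ fun v hv _ =>
            mul_nonneg (hw v (mem_filter.1 hv).2) (Nat.cast_nonneg _)
          intro v hv
          obtain ⟨c, -, hv⟩ := mem_biUnion.1 hv
          exact mem_filter.2 ⟨mem_univ v,
            Decomposition.ne_root_of_mem (Decomposition.mem_spine.1 hv).1⟩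
  · intro c _ c' _ hne
    simp only [Function.onFun]
    rw [Finset.disjoint_left]
    intro v hv hv'
    exact hne (Decomposition.comp_eq_of_mem (Decomposition.mem_spine.1 hv).1
      (Decomposition.mem_spine.1 hv').1)

variable (hΓ : 0 < Γ)

include hΓ

/-- The distances of the components are charged to big components, at most three to each. -/
theorem sum_dist_top_le : Γ * ∑ c, T.dist (D.top c) ≤ 3 * totalSpan t := by
  have hspan : 0 ≤ totalSpan t := sum_nonneg fun i _ => spanWeight_nonneg hw _
  have hk' : (0 : ℝ) < k := by exact_mod_cast hk
  rcases le_or_gt #D.partition.parts 1 with h | h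
  · rw [sum_eq_zero, mul_zero]
    · positivity
    · intro c _
      rw [Decomposition.top_eq_root_of_card_le_one h, dist_root]
  · obtain ⟨f, hf, hf3⟩ := hA.exists_map h
    have h1 : ∑ c, T.dist (D.top c) ≤ 3 * ∑ b ∈ univ.image f, T.dist (D.top b) := by
      calc ∑ c, T.dist (D.top c) ≤ ∑ c, T.dist (D.top (f c)) := by
            refine sum_le_sum fun c _ => IsAncestor.dist_le hw ?_
            rcases (hf c).2 with h2 | ⟨v, hv, h2⟩
            · rw [h2]
              exact T.isAncestor_refl _
            · exact (Decomposition.top_isAncestor hv).trans h2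
        _ = ∑ b ∈ univ.image f, ∑ c with f c = b, T.dist (D.top (f c)) :=
            (sum_fiberwise_of_maps_to (fun c _ => mem_image_of_mem f (mem_univ c)) _).symm
        _ ≤ ∑ b ∈ univ.image f, 3 * T.dist (D.top b) := by
            refine sum_le_sum fun b _ => ?_
            rw [sum_congr rfl (g := fun _ => T.dist (D.top b))
              (fun c hc => by rw [(mem_filter.1 hc).2]), sum_const, nsmul_eq_mul]
            refine mul_le_mul_of_nonneg_right ?_ (dist_nonneg hw _)
            have h3 := hf3 b
            rw [Set.ncard_eq_toFinset_card'] at h3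
            simp only [Set.toFinset_ofPred] at h3
            exact_mod_cast h3
        _ = 3 * ∑ b ∈ univ.image f, T.dist (D.top b) := (mul_sum _ _ _).symm
    -- a big component has at least `Γ k` terminals that are at least as far away as its root
    have h2 : Γ * k * ∑ b ∈ univ.image f, T.dist (D.top b) ≤ ∑ x : T.leaves, T.dist x := by
      rw [mul_sum]
      calc ∑ b ∈ univ.image f, Γ * k * T.dist (D.top b)
          ≤ ∑ b ∈ univ.image f, ∑ x ∈ D.terminals b, T.dist x := by
            refine sum_le_sum fun b hb => ?_
            obtain ⟨c, -, rfl⟩ := mem_image.1 hb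
            have h3 := (hf c).1
            rw [Decomposition.IsBig, Decomposition.numTerminals_eq] at h3
            calc Γ * k * T.dist (D.top (f c))
                ≤ #(D.terminals (f c)) * T.dist (D.top (f c)) :=
                  mul_le_mul_of_nonneg_right h3 (dist_nonneg hw _)
              _ = ∑ x ∈ D.terminals (f c), T.dist (D.top (f c)) := by simp
              _ ≤ _ := sum_le_sum fun x hx => IsAncestor.dist_le hw
                  (Decomposition.top_isAncestor (Decomposition.mem_terminals.1 hx))
        _ = ∑ x ∈ (univ.image f).biUnion D.terminals, T.dist x := by
            rw [sum_biUnion]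
            intro b _ b' _ hne
            simp only [Function.onFun]
            rw [Finset.disjoint_left]
            intro x hx hx'
            exact hne (Decomposition.comp_eq_of_mem (Decomposition.mem_terminals.1 hx)
              (Decomposition.mem_terminals.1 hx'))
        _ ≤ _ := sum_le_sum_of_subset_of_nonneg (subset_univ _) fun x _ _ => dist_nonneg hw _
    have h3 := sum_dist_le hw hcap
    have h4 : k * (Γ * ∑ b ∈ univ.image f, T.dist (D.top b)) ≤ k * totalSpan t := by
      linarith
    have h5 := le_of_mul_le_mul_left h4 hk'
    have h6 := mul_le_mul_of_nonneg_left h1 hΓ.le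
    linarith

/-- One additional tour for each component is affordable. -/
theorem sum_overhead_le : ∑ c, D.overhead c ≤ 4 / Γ * totalSpan t := by
  have h1 := sum_dist_top_le hw hcap hA hk hΓ
  have h2 := sum_spine_le hw hcap hA hk
  simp only [Decomposition.overhead]
  rw [sum_add_distrib, div_mul_eq_mul_div, le_div_iff₀ hΓ]
  linarith

end Distribution

/-! ### Few tours in each component -/

universe u v

section Local

variable {V : Type u} [Fintype V] [DecidableEq V] {T : RootedTree V}

/-- The terminals in the component `c` that are assigned to the tour `i`. -/
def Decomposition.held (D : Decomposition T) {I : Type*} (t : T.leaves → I) (i : I)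
    (c : D.Comp) : Finset T.leaves := {x | t x = i ∧ (x : V) ∈ c.1}

variable {D : Decomposition T} {I : Type v}

namespace Decomposition

theorem mem_held {t : T.leaves → I} {i : I} {c : D.Comp} {x : T.leaves} :
    x ∈ D.held t i c ↔ t x = i ∧ (x : V) ∈ c.1 := by
  simp [held]

variable (D) in
/-- The tour `i` continues from `c` to terminals below `c`. -/
def Passes (t : T.leaves → I) (p : I × D.Comp) : Prop :=
  ∃ x, t x = p.1 ∧ (x : V) ∉ p.2.1 ∧ ∃ v ∈ p.2.1, T.IsAncestor v x

variable (D) in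
/-- The edges of the spine of `c` if the tour passes `c`, and none otherwise. -/
def passedSpine (t : T.leaves → I) (p : I × D.Comp) : Finset V :=
  if D.Passes t p then D.spine p.2 else ∅

variable (D) in
/-- The edges of `c` that a tour uses only to visit terminals in `c`. -/
def branches (t : T.leaves → I) (p : I × D.Comp) : Finset V :=
  {v ∈ p.2.1 | v ∉ D.passedSpine t p ∧ ∃ x ∈ D.held t p.1 p.2, T.IsAncestor v x}

theorem mem_branches {t : T.leaves → I} {p : I × D.Comp} {v : V} :
    v ∈ D.branches t p ↔ v ∈ p.2.1 ∧ v ∉ D.passedSpine t p ∧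
      ∃ x ∈ D.held t p.1 p.2, T.IsAncestor v x := by
  simp [branches]

theorem mem_passedSpine {t : T.leaves → I} {p : I × D.Comp} {v : V} :
    v ∈ D.passedSpine t p ↔ D.Passes t p ∧ v ∈ D.spine p.2 := by
  unfold passedSpine
  split_ifs with h <;> simp [h]

theorem mem_of_mem_passedSpine {t : T.leaves → I} {p : I × D.Comp} {v : V}
    (h : v ∈ D.passedSpine t p) : v ∈ p.2.1 :=
  (mem_spine.1 (mem_passedSpine.1 h).2).1

/-- Each edge of `c` on the way to a terminal of the tour `i` belongs to the spine, if the tour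
passes `c`, or to the branches. -/
theorem mem_passedSpine_or_mem_branches {t : T.leaves → I} {c : D.Comp} {v : V} {x : T.leaves}
    (hv : v ∈ c.1) (h : T.IsAncestor v x) :
    v ∈ D.passedSpine t (t x, c) ∨ v ∈ D.branches t (t x, c) := by
  by_cases hs : v ∈ D.passedSpine t (t x, c)
  · exact Or.inl hs
  · right
    refine mem_branches.2 ⟨hv, hs, x, mem_held.2 ⟨rfl, ?_⟩, h⟩
    by_contra hx
    exact hs (mem_passedSpine.2 ⟨⟨x, rfl, hx, v, hv, h⟩, mem_spine.2 ⟨hv, x, x.2, hx, h⟩⟩)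

/-- The edges of the tours, sorted by components. -/
theorem Admissible.sum_passedSpine_add_sum_branches_le {Γ : ℝ} {k : ℕ}
    (hA : D.Admissible Γ k) [Fintype I] (hw : ∀ v, v ≠ T.root → 0 ≤ T.weight v)
    (t : T.leaves → I) :
    ∑ p, ∑ v ∈ D.passedSpine t p, T.weight v + ∑ p, ∑ v ∈ D.branches t p, T.weight v ≤
      totalSpan t := by
  rw [← sum_add_distrib, Fintype.sum_prod_type, totalSpan]
  refine sum_le_sum fun i _ => ?_
  calc ∑ c, (∑ v ∈ D.passedSpine t (i, c), T.weight v + ∑ v ∈ D.branches t (i, c), T.weight v)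
      = ∑ c, ∑ v ∈ D.passedSpine t (i, c) ∪ D.branches t (i, c), T.weight v := by
        refine sum_congr rfl fun c _ => (sum_union ?_).symm
        rw [Finset.disjoint_left]
        exact fun v hv hv' => (mem_branches.1 hv').2.1 hv
    _ = ∑ v ∈ univ.biUnion fun c => D.passedSpine t (i, c) ∪ D.branches t (i, c), T.weight v := by
        rw [sum_biUnion]
        intro c _ c' _ hne
        simp only [Function.onFun]
        rw [Finset.disjoint_left]
        have key : ∀ c : D.Comp, ∀ v ∈ D.passedSpine t (i, c) ∪ D.branches t (i, c), v ∈ c.1 := by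
          intro c v hv
          rcases mem_union.1 hv with h | h
          · exact mem_of_mem_passedSpine h
          · exact (mem_branches.1 h).1
        exact fun v hv hv' => hne (comp_eq_of_mem (key c v hv) (key c' v hv'))
    _ ≤ T.spanWeight (tourSet t i) := by
        refine sum_le_sum_of_subset_of_nonneg ?_ fun v hv _ => hw v (mem_span.1 hv).1
        intro v hv
        obtain ⟨c, -, hv⟩ := mem_biUnion.1 hv
        rw [mem_span]
        rcases mem_union.1 hv with h | h
        · obtain ⟨⟨x, hx, hxc, u, hu, hux⟩, h2⟩ := mem_passedSpine.1 h
          exact ⟨ne_root_of_mem (mem_spine.1 h2).1, x, ⟨x, hx, rfl⟩,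
            hA.isAncestor_of_mem_spine h2 hu hxc hux⟩
        · obtain ⟨h1, -, x, hx, h2⟩ := mem_branches.1 h
          exact ⟨ne_root_of_mem h1, x, ⟨x, (mem_held.1 hx).1, rfl⟩, h2⟩

variable (comp : T.leaves → D.Comp) (hcomp : ∀ x : T.leaves, (x : V) ∈ (comp x).1)
  {t : T.leaves → I} {ρ : I × D.Comp → I ⊕ (D.Comp × ℕ)}

include hcomp

/-- The cost of an old tour after the redistribution: it still has to pay for the spines of
components that it has passed, and it has to pay for the branches of all pieces that it holds. -/
theorem spanWeight_redistribute_inl [Fintype I] (hw : ∀ v, v ≠ T.root → 0 ≤ T.weight v)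
    (h1 : ∀ p i, (D.held t p.1 p.2).Nonempty → ρ p = .inl i →
      (D.held t i p.2).Nonempty ∧ (D.Passes t p → D.Passes t (i, p.2))) (i : I) :
    T.spanWeight (tourSet (fun x => ρ (t x, comp x)) (.inl i)) ≤
      ∑ c, ∑ v ∈ D.passedSpine t (i, c), T.weight v +
        ∑ p with ρ p = .inl i, ∑ v ∈ D.branches t p, T.weight v := by
  have hsub : T.span (tourSet (fun x => ρ (t x, comp x)) (.inl i)) ⊆
      (univ.biUnion fun c => D.passedSpine t (i, c)) ∪
        (univ.filter fun p => ρ p = .inl i).biUnion (D.branches t) := by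
    intro v hv
    obtain ⟨hv0, _, ⟨x, hx, rfl⟩, hvx⟩ := mem_span.1 hv
    obtain ⟨c, hc⟩ := exists_comp (D := D) hv0
    have hheld : (D.held t (t x) (comp x)).Nonempty := ⟨x, mem_held.2 ⟨rfl, hcomp x⟩⟩
    obtain ⟨⟨y, hy⟩, h3⟩ := h1 (t x, comp x) i hheld hx
    by_cases hcx : c = comp x
    · rcases mem_passedSpine_or_mem_branches (t := t) hc hvx with h4 | h4
      · obtain ⟨h5, h6⟩ := mem_passedSpine.1 h4
        refine mem_union_left _ (mem_biUnion.2 ⟨c, mem_univ c, mem_passedSpine.2 ⟨?_, h6⟩⟩)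
        rw [hcx] at h5 ⊢
        exact h3 h5
      · refine mem_union_right _ (mem_biUnion.2 ⟨(t x, c), ?_, h4⟩)
        rw [hcx]
        simpa using hx
    · have hxc : (x : V) ∉ c.1 := fun h => hcx (comp_eq_of_mem h (hcomp x))
      have hvt : T.IsAncestor v (D.top (comp x)) :=
        (mem_or_isAncestor_top (hcomp x) hvx).resolve_left
          fun h => hcx (comp_eq_of_mem hc h)
      obtain ⟨hy1, hy2⟩ := mem_held.1 hy
      have hyc : (y : V) ∉ c.1 := fun h => hcx (comp_eq_of_mem h hy2)
      refine mem_union_left _ (mem_biUnion.2 ⟨c, mem_univ c, mem_passedSpine.2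
        ⟨⟨y, hy1, hyc, v, hc, hvt.trans (top_isAncestor hy2)⟩,
          mem_spine.2 ⟨hc, x, x.2, hxc, hvx⟩⟩⟩)
  have hnn : ∀ c, ∀ v ∈ D.passedSpine t (i, c), 0 ≤ T.weight v := fun c v hv =>
    hw v (ne_root_of_mem (mem_of_mem_passedSpine hv))
  have hnn' : ∀ p, ∀ v ∈ D.branches t p, 0 ≤ T.weight v := fun p v hv =>
    hw v (ne_root_of_mem (mem_branches.1 hv).1)
  refine (sum_le_sum_of_subset_union hsub ?_ ?_).trans (add_le_add
      (sum_le_sum_of_subset_biUnion (Subset.refl _) fun c _ => hnn c)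
      (sum_le_sum_of_subset_biUnion (Subset.refl _) fun p _ => hnn' p))
  · intro v hv
    obtain ⟨c, -, hv⟩ := mem_biUnion.1 hv
    exact hnn c v hv
  · intro v hv
    obtain ⟨p, -, hv⟩ := mem_biUnion.1 hv
    exact hnn' p v hv

/-- The cost of a new tour for terminals of `c`. -/
theorem spanWeight_redistribute_inr [Fintype I] (hw : ∀ v, v ≠ T.root → 0 ≤ T.weight v)
    (h2 : ∀ p q, (D.held t p.1 p.2).Nonempty → ρ p = .inr q → q.1 = p.2) (q : D.Comp × ℕ) :
    T.spanWeight (tourSet (fun x => ρ (t x, comp x)) (.inr q)) ≤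
      D.overhead q.1 + ∑ p with ρ p = .inr q, ∑ v ∈ D.branches t p, T.weight v := by
  have hsub : T.span (tourSet (fun x => ρ (t x, comp x)) (.inr q)) ⊆
      (T.span {D.top q.1} ∪ D.spine q.1) ∪
        (univ.filter fun p => ρ p = .inr q).biUnion (D.branches t) := by
    intro v hv
    obtain ⟨hv0, _, ⟨x, hx, rfl⟩, hvx⟩ := mem_span.1 hv
    have hheld : (D.held t (t x) (comp x)).Nonempty := ⟨x, mem_held.2 ⟨rfl, hcomp x⟩⟩
    have hq := h2 (t x, comp x) q hheld hx
    rcases mem_or_isAncestor_top (hcomp x) hvx with h | h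
    · rcases mem_passedSpine_or_mem_branches (t := t) h hvx with h4 | h4
      · refine mem_union_left _ (mem_union_right _ ?_)
        rw [hq]
        exact (mem_passedSpine.1 h4).2
      · exact mem_union_right _ (mem_biUnion.2 ⟨_, by simpa using hx, h4⟩)
    · refine mem_union_left _ (mem_union_left _ (mem_span_singleton.2 ⟨hv0, ?_⟩))
      rw [hq]
      exact h
  have hnn' : ∀ p, ∀ v ∈ D.branches t p, 0 ≤ T.weight v := fun p v hv =>
    hw v (ne_root_of_mem (mem_branches.1 hv).1)
  have hnn : ∀ v ∈ T.span {D.top q.1} ∪ D.spine q.1, 0 ≤ T.weight v := by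
    intro v hv
    rcases mem_union.1 hv with h | h
    · exact hw v (mem_span.1 h).1
    · exact hw v (ne_root_of_mem (mem_spine.1 h).1)
  refine (sum_le_sum_of_subset_union hsub hnn ?_).trans (add_le_add ?_
      (sum_le_sum_of_subset_biUnion (Subset.refl _) fun p _ => hnn' p))
  · intro v hv
    obtain ⟨p, -, hv⟩ := mem_biUnion.1 hv
    exact hnn' p v hv
  · rw [overhead, dist_eq_spanWeight]
    exact sum_le_sum_of_subset_union (Subset.refl _)
      (fun v hv => hnn v (mem_union_left _ hv)) (fun v hv => hnn v (mem_union_right _ hv))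

end Decomposition

/-- The terminals can be redistributed at small additional cost such that few tours visit each
component and such that each tour remains feasible even if it has to visit at least `α k` terminals
(possibly dummy ones) in each component that it visits. -/
theorem exists_few_tours_per_component [Fintype I] {Γ : ℝ} {k : ℕ} (t : T.leaves → I)
    (hw : ∀ v, v ≠ T.root → 0 ≤ T.weight v) (hcap : ∀ i, #{x | t x = i} ≤ k)
    (hA : D.Admissible Γ k) (hk : 1 ≤ k) (hΓ : 0 < Γ) (hroot : T.root ∉ T.leaves)
    {α M m : ℝ} (hα : 0 < α) (hα4 : 4 * α ≤ 1) (hM : ∀ x ∈ T.leaves, T.dist x ≤ M)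
    (hm : ∀ x ∈ T.leaves, m ≤ T.dist x) (hm0 : 0 < m) :
    ∃ (J : Type (max u v)) (_ : Fintype J) (t' : T.leaves → J),
      (∀ j, ∑ c with (D.held t' j c).Nonempty, max #(D.held t' j c) ⌈α * k⌉₊ ≤ k) ∧
      (∀ c, (#{j | (D.held t' j c).Nonempty} : ℝ) ≤ 2 * Γ / α + 1) ∧
      totalSpan t' ≤ (1 + (1 + 4 * α) * (4 / Γ) + 4 * α * M / m) * totalSpan t := by
  have hk0 : (0 : ℝ) < k := by exact_mod_cast hk
  have hleaf_ne : ∀ x : T.leaves, (x : V) ≠ T.root := fun x h => hroot (h ▸ x.2)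
  choose comp hcomp using fun x : T.leaves => Decomposition.exists_comp (D := D) (hleaf_ne x)
  have hcomp' : ∀ (x : T.leaves) c, (x : V) ∈ c.1 ↔ comp x = c := fun x c =>
    ⟨fun h => Decomposition.comp_eq_of_mem (hcomp x) h, fun h => h ▸ hcomp x⟩
  -- the pieces are the sets of terminals that a tour holds in a component; `ρ` says where they go
  set a : I × D.Comp → ℕ := fun p => #(D.held t p.1 p.2) with ha
  have ha0 : ∀ p, 0 < a p ↔ (D.held t p.1 p.2).Nonempty := fun p => card_pos
  have hax : ∀ x, 0 < a (t x, comp x) := fun x =>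
    (ha0 _).2 ⟨x, Decomposition.mem_held.2 ⟨rfl, hcomp x⟩⟩
  obtain ⟨ρ, h1, h2, h3, h4, h5, h6, h7⟩ := exists_redistribution a (D.Passes t)
    (K := α * k) (k := k) (by positivity) (by nlinarith)
  replace h3 : ∀ p i, 0 < a p → ρ p = .inl i →
      α * k ≤ ∑ p' with p'.2 = p.2 ∧ ρ p' = .inl i, (a p' : ℝ) := fun p i hp hpi => by
    convert h3 p i hp hpi
  replace h4 : ∀ i, ∑ p with ρ p = .inl i, (a p : ℝ) ≤ ∑ p with p.1 = i, (a p : ℝ) := fun i => by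
    convert h4 i
  replace h5 : ∀ q, ∑ p with ρ p = .inr q, (a p : ℝ) ≤ k := fun q => by convert h5 q
  replace h6 : ∀ p q, 0 < a p → ρ p = .inr q → q.2 ≠ 0 →
      α * k ≤ ∑ p' with p'.2 = p.2 ∧ ρ p' = .inr q, (a p' : ℝ) := fun p q hp hpq hq => by
    refine (h6 p q hp hpq hq).trans (le_of_eq ?_)
    rw [sum_filter, sum_filter]
    refine sum_congr rfl fun p' _ => ?_
    by_cases hp' : ρ p' = .inr q
    · rcases Nat.eq_zero_or_pos (a p') with h0 | h0
      · simp [h0]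
      · simp [hp', (h2 p' q h0 hp').symm.trans (h2 p q hp hpq)]
    · simp [hp']
  have hM0 : 0 ≤ M := by
    obtain ⟨x, hx, -⟩ := T.exists_leaf T.root
    exact (dist_nonneg hw x).trans (hM x hx)
  obtain ⟨used, hused, hcost⟩ := h7 D.overhead M hM0
    (fun c => Decomposition.overhead_nonneg hw c) (hA.overhead_le hw hM)
  -- the tours after the redistribution are the old ones and the new ones that are used
  set JJ : Finset (I ⊕ (D.Comp × ℕ)) := univ.disjSum used with hJJ
  have hmem : ∀ x, ρ (t x, comp x) ∈ JJ := by
    intro x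
    rcases hρ : ρ (t x, comp x) with i | q
    · exact inl_mem_disjSum.2 (mem_univ i)
    · exact inr_mem_disjSum.2 (hused _ q (hax x) hρ)
  set t' : T.leaves → {j // j ∈ JJ} := fun x => ⟨ρ (t x, comp x), hmem x⟩ with ht'
  have ht'_iff : ∀ x j, t' x = j ↔ ρ (t x, comp x) = j.1 := fun x j => Subtype.ext_iff
  -- the number of terminals that a tour holds after the redistribution
  have hheld : ∀ j c, (#(D.held t' j c) : ℝ) = ∑ p with p.2 = c ∧ ρ p = j.1, (a p : ℝ) := by
    intro j c
    have : #(D.held t' j c) = ∑ p with p.2 = c ∧ ρ p = j.1, a p := by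
      rw [card_eq_sum_card_fiberwise (f := fun x => (t x, comp x))
        (t := univ.filter fun p => p.2 = c ∧ ρ p = j.1)]
      · refine sum_congr rfl fun p hp => ?_
        simp only [mem_filter, mem_univ, true_and] at hp
        simp only [ha]
        congr 1
        ext x
        simp only [mem_filter, Decomposition.mem_held, hcomp', ht'_iff, Prod.ext_iff]
        constructor
        · rintro ⟨-, h8, h9⟩
          exact ⟨h8, h9⟩
        · rintro ⟨h8, h9⟩
          have h10 : (t x, comp x) = p := Prod.ext h8 h9
          exact ⟨⟨by rw [h10]; exact hp.2, h9.trans hp.1⟩, h8, h9⟩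
      · intro x hx
        rw [mem_coe, Decomposition.mem_held, hcomp', ht'_iff] at hx
        simpa using ⟨hx.2, hx.1⟩
    rw [this]
    push_cast
    rfl
  -- what a tour holds comes from some piece that has been sent to it
  have hsource : ∀ j c, (D.held t' j c).Nonempty → ∃ p, 0 < a p ∧ p.2 = c ∧ ρ p = j.1 := by
    rintro j c ⟨x, hx⟩
    rw [Decomposition.mem_held, hcomp', ht'_iff] at hx
    exact ⟨(t x, comp x), hax x, hx.2, hx.1⟩
  have hsum_le : ∀ j, ∑ c, (#(D.held t' j c) : ℝ) ≤ k := by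
    intro j
    have h8 : ∑ c, (#(D.held t' j c) : ℝ) = ∑ p with ρ p = j.1, (a p : ℝ) := by
      simp only [hheld]
      rw [← sum_fiberwise (univ.filter fun p => ρ p = j.1) Prod.snd]
      refine sum_congr rfl fun c _ => sum_congr ?_ fun _ _ => rfl
      ext p
      simp only [mem_filter, mem_univ, true_and]
      exact and_comm
    rw [h8]
    rcases hj : j.1 with i | q
    · refine (h4 i).trans ?_
      have h9 : ∑ p with p.1 = i, a p ≤ k := by
        refine le_trans (le_of_eq ?_) (hcap i)
        rw [card_eq_sum_card_fiberwise (f := fun x => (t x, comp x))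
          (t := univ.filter fun p => p.1 = i)]
        · refine sum_congr rfl fun p hp => ?_
          simp only [mem_filter, mem_univ, true_and] at hp
          simp only [ha]
          congr 1
          ext x
          simp only [mem_filter, Decomposition.mem_held, hcomp', Prod.ext_iff, mem_univ, true_and]
          exact ⟨fun h => ⟨h.1.trans hp, h⟩, fun h => h.2⟩
        · intro x hx
          simpa using hx
      exact_mod_cast h9
    · exact h5 q
  -- only one tour per component holds less than `α k` terminals
  have hlarge : ∀ j c, (D.held t' j c).Nonempty → (∀ c', j.1 ≠ .inr (c', 0)) →
      α * k ≤ #(D.held t' j c) := by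
    intro j c hne hj0
    obtain ⟨p, hp, rfl, hpj⟩ := hsource j c hne
    rw [hheld]
    rcases hj : j.1 with i | q
    · rw [hj] at hpj
      exact h3 p i hp hpj
    · rw [hj] at hpj
      have hq0 : q.2 ≠ 0 := fun h => hj0 q.1 (by rw [hj, ← h])
      exact h6 p q hp hpj hq0
  have hceil : ⌈α * k⌉₊ ≤ k := by
    refine Nat.ceil_le.2 ?_
    nlinarith
  refine ⟨{j // j ∈ JJ}, inferInstance, t', ?_, ?_, ?_⟩
  · intro j
    -- the tours `(c, 0)` visit a single component, the others hold at least `α k` in each component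
    by_cases hj : ∃ c, j.1 = .inr (c, 0)
    · obtain ⟨c, hj⟩ := hj
      have hsub : univ.filter (fun c' => (D.held t' j c').Nonempty) ⊆ {c} := by
        intro c' hc'
        simp only [mem_filter, mem_univ, true_and] at hc'
        obtain ⟨p, hp, rfl, hpj⟩ := hsource j c' hc'
        rw [hj] at hpj
        exact mem_singleton.2 (h2 p _ hp hpj).symm
      refine (sum_le_sum_of_subset hsub).trans ?_
      rw [sum_singleton]
      refine max_le ?_ hceil
      have h8 : (#(D.held t' j c) : ℝ) ≤ k :=
        (single_le_sum (f := fun c => (#(D.held t' j c) : ℝ)) (fun _ _ => Nat.cast_nonneg _)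
          (mem_univ c)).trans (hsum_le j)
      exact_mod_cast h8
    · push Not at hj
      have h8 : ∑ c, #(D.held t' j c) ≤ k := by exact_mod_cast hsum_le j
      refine le_trans ?_ h8
      refine (sum_le_sum fun c hc => ?_).trans (sum_le_sum_of_subset (subset_univ _))
      simp only [mem_filter, mem_univ, true_and] at hc
      exact max_le le_rfl (Nat.ceil_le.2 (hlarge j c hc hj))
  · intro c
    set F : Finset {j // j ∈ JJ} := {j | (D.held t' j c).Nonempty} with hF
    set F' : Finset {j // j ∈ JJ} := F.filter fun j => α * k ≤ #(D.held t' j c) with hF'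
    have h8 : #F ≤ #F' + 1 := by
      have h9 : #(F.filter fun j => ¬ α * k ≤ #(D.held t' j c)) ≤ 1 := by
        refine card_le_one.2 ?_
        have key : ∀ j ∈ F.filter (fun j => ¬ α * k ≤ #(D.held t' j c)), j.1 = .inr (c, 0) := by
          intro j hj
          obtain ⟨h10, h11⟩ := mem_filter.1 hj
          have h12 : (D.held t' j c).Nonempty := (mem_filter.1 h10).2
          obtain ⟨c', hc'⟩ : ∃ c', j.1 = .inr (c', 0) := by
            by_contra hno
            push Not at hno
            exact h11 (hlarge j c h12 hno)
          obtain ⟨p, hp, rfl, hpj⟩ := hsource j c h12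
          rw [hc'] at hpj
          have : c' = p.2 := h2 p _ hp hpj
          rw [hc', this]
        intro j hj j' hj'
        exact Subtype.ext ((key j hj).trans (key j' hj').symm)
      have h10 : #F' + #(F.filter fun j => ¬ α * k ≤ #(D.held t' j c)) = #F := by
        convert card_filter_add_card_filter_not (s := F) (fun j => α * k ≤ #(D.held t' j c))
      omega
    -- the tours in `F'` hold at least `α k` of the at most `2 Γ k` terminals of `c` each
    have h9 : (#F' : ℝ) * (α * k) ≤ 2 * Γ * k := by
      calc (#F' : ℝ) * (α * k) = ∑ j ∈ F', α * k := by simp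
        _ ≤ ∑ j ∈ F', (#(D.held t' j c) : ℝ) := sum_le_sum fun j hj => (mem_filter.1 hj).2
        _ = (#(F'.biUnion fun j => D.held t' j c) : ℝ) := by
            rw [card_biUnion]
            · push_cast
              rfl
            · intro j _ j' _ hne
              simp only [Function.onFun]
              rw [Finset.disjoint_left]
              intro x hx hx'
              exact hne ((Decomposition.mem_held.1 hx).1.symm.trans
                (Decomposition.mem_held.1 hx').1)
        _ ≤ #(D.terminals c) := by
            refine Nat.cast_le.2 (card_le_card ?_)
            intro x hx
            obtain ⟨j, -, hx⟩ := mem_biUnion.1 hx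
            exact Decomposition.mem_terminals.2 (Decomposition.mem_held.1 hx).2
        _ ≤ 2 * Γ * k := by
            rw [← Decomposition.numTerminals_eq]
            exact hA.numTerminals_le c
    have h10 : (#F' : ℝ) ≤ 2 * Γ / α := by
      rw [le_div_iff₀ hα]
      refine le_of_mul_le_mul_right ?_ hk0
      linarith
    have h11 : (#F : ℝ) ≤ #F' + 1 := by exact_mod_cast h8
    linarith
  · have hspan0 : 0 ≤ totalSpan t := sum_nonneg fun i _ => spanWeight_nonneg hw _
    have hbr0 : ∀ p, 0 ≤ ∑ v ∈ D.branches t p, T.weight v := fun p => sum_nonneg fun v hv =>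
      hw v (Decomposition.ne_root_of_mem (Decomposition.mem_branches.1 hv).1)
    have htour : ∀ j : {j // j ∈ JJ}, tourSet t' j =
        tourSet (fun x => ρ (t x, comp x)) j.1 := by
      intro j
      ext v
      simp only [tourSet, Set.mem_ofPred_eq, ht'_iff]
    have h8 : totalSpan t' ≤ (∑ p, ∑ v ∈ D.passedSpine t p, T.weight v + ∑ q ∈ used,
        D.overhead q.1) + ∑ p, ∑ v ∈ D.branches t p, T.weight v := by
      calc totalSpan t' = ∑ j ∈ JJ, T.spanWeight (tourSet (fun x => ρ (t x, comp x)) j) := by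
            simp only [totalSpan, htour]
            exact Finset.sum_coe_sort JJ
              (fun j => T.spanWeight (tourSet (fun x => ρ (t x, comp x)) j))
        _ ≤ ∑ j ∈ JJ, (Sum.elim (fun i => ∑ c, ∑ v ∈ D.passedSpine t (i, c), T.weight v)
              (fun q => D.overhead q.1) j +
                ∑ p with ρ p = j, ∑ v ∈ D.branches t p, T.weight v) := by
            refine sum_le_sum fun j _ => ?_
            rcases j with i | q
            · exact Decomposition.spanWeight_redistribute_inl comp hcomp hw
                (fun p i hp hpi => by
                  have := h1 p i ((ha0 p).2 hp) hpi
                  exact ⟨(ha0 _).1 this.1, this.2⟩) i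
            · exact Decomposition.spanWeight_redistribute_inr comp hcomp hw
                (fun p q hp hpq => h2 p q ((ha0 p).2 hp) hpq) q
        _ = (∑ p, ∑ v ∈ D.passedSpine t p, T.weight v + ∑ q ∈ used, D.overhead q.1) +
              ∑ j ∈ JJ, ∑ p with ρ p = j, ∑ v ∈ D.branches t p, T.weight v := by
            rw [sum_add_distrib, hJJ, sum_disjSum, Fintype.sum_prod_type]
            rfl
        _ ≤ _ := by
            refine add_le_add le_rfl ?_
            rw [sum_fiberwise_eq_sum_filter]
            exact sum_le_sum_of_subset_of_nonneg (filter_subset _ _) fun p _ _ => hbr0 p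
    have h9 := hA.sum_passedSpine_add_sum_branches_le hw t
    have h10 := sum_overhead_le hw hcap hA hk hΓ
    have h11 : 4 * (α * k) / k = 4 * α := by field_simp
    rw [h11] at hcost
    -- each tour that visits a terminal costs at least the minimum distance
    have h12 : (#{i : I | ∃ c, 0 < a (i, c)} : ℝ) ≤ totalSpan t / m := by
      rw [le_div_iff₀ hm0]
      calc (#{i : I | ∃ c, 0 < a (i, c)} : ℝ) * m = ∑ i with ∃ c, 0 < a (i, c), m := by simp
        _ ≤ ∑ i with ∃ c, 0 < a (i, c), T.spanWeight (tourSet t i) := by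
            refine sum_le_sum fun i hi => ?_
            obtain ⟨c, hc⟩ := (mem_filter.1 hi).2
            obtain ⟨x, hx⟩ := (ha0 _).1 hc
            have hx1 : t x = i := (Decomposition.mem_held.1 hx).1
            exact (hm x x.2).trans (dist_le_spanWeight hw (hx1 ▸ mem_tourSet t x)
              (T.isAncestor_refl _))
        _ ≤ totalSpan t := sum_le_sum_of_subset_of_nonneg (subset_univ _)
            fun i _ _ => spanWeight_nonneg hw _
    have h13 : (1 + 4 * α) * ∑ c, D.overhead c ≤ (1 + 4 * α) * (4 / Γ * totalSpan t) :=
      mul_le_mul_of_nonneg_left h10 (by positivity)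
    have h14 : 4 * α * M * #{i : I | ∃ c, 0 < a (i, c)} ≤ 4 * α * M * (totalSpan t / m) :=
      mul_le_mul_of_nonneg_left h12 (by positivity)
    have h15 : (1 + (1 + 4 * α) * (4 / Γ) + 4 * α * M / m) * totalSpan t = totalSpan t +
        (1 + 4 * α) * (4 / Γ * totalSpan t) + 4 * α * M * (totalSpan t / m) := by ring
    rw [h15]
    linarith

end Local

/-! ### The tree of reduced height -/

namespace Decomposition

variable {V : Type*} [Fintype V] [DecidableEq V] {T : RootedTree V} {D : Decomposition T} {s : ℝ}

variable (D s) in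
/-- The class of a component for the step length `s`, numbered from `0`. -/
def lvl (c : D.Comp) : ℕ := ⌊T.dist (D.top c) / s⌋₊

theorem mem_level_iff (hw : ∀ v, v ≠ T.root → 0 ≤ T.weight v) (hs : 0 < s) {i : ℕ} {c : D.Comp} :
    c ∈ D.level s i ↔ D.lvl s c + 1 = i := by
  have h0 : 0 ≤ T.dist (D.top c) := dist_nonneg hw _
  rcases i with _ | i
  · simp [level, h0]
  · rw [lvl, Nat.add_right_cancel_iff, Nat.floor_eq_iff (by positivity), div_lt_iff₀ hs,
      le_div_iff₀ hs]
    simp [level]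

theorem linked_iff (hw : ∀ v, v ≠ T.root → 0 ≤ T.weight v) (hs : 0 < s) {c c' : D.Comp} :
    D.Linked s c c' ↔ D.lvl s c = D.lvl s c' ∧ ∃ x, x ∈ D.verts c ∧ x ∈ D.verts c' := by
  simp only [Linked, mem_level_iff hw hs]
  refine and_congr_left fun _ => ⟨?_, fun h => ⟨_, rfl, by rw [h]⟩⟩
  rintro ⟨i, h1, h2⟩
  omega

theorem Linked.symm {c c' : D.Comp} (h : D.Linked s c c') : D.Linked s c' c := by
  obtain ⟨⟨i, h1, h2⟩, x, h3, h4⟩ := h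
  exact ⟨⟨i, h2, h1⟩, x, h4, h3⟩

theorem mem_cluster_symm {c c' : D.Comp} (h : c' ∈ D.cluster s c) : c ∈ D.cluster s c' :=
  Relation.ReflTransGen.head_induction_on (motive := fun a _ => Relation.ReflTransGen _ c' a) h
    .refl fun h1 _ ih => ih.tail (Linked.symm h1)

theorem cluster_eq {c c' : D.Comp} (h : c' ∈ D.cluster s c) : D.cluster s c' = D.cluster s c := by
  ext c''
  exact ⟨fun h' => Relation.ReflTransGen.trans h h',
    fun h' => Relation.ReflTransGen.trans (mem_cluster_symm h) h'⟩

theorem critical_eq_of_mem_cluster {c c' : D.Comp} (h : c' ∈ D.cluster s c) :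
    D.critical s c' = D.critical s c := by
  unfold critical
  congr 2
  exact cluster_eq h

/-- The component whose root is the critical vertex. -/
theorem exists_mem_cluster_top_eq_critical (c : D.Comp) : ∃ m ∈ D.cluster s c,
    D.top m = D.critical s c ∧ ∀ c' ∈ D.cluster s c, T.depth (D.top m) ≤ T.depth (D.top c') :=
  ⟨_, Function.argminOn_mem _ _ _, rfl, fun _ hc' =>
    Function.argminOn_le (fun c' => T.depth (D.top c')) _ hc'⟩

theorem lvl_eq_of_mem_cluster (hw : ∀ v, v ≠ T.root → 0 ≤ T.weight v) (hs : 0 < s)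
    {c c' : D.Comp} (h : c' ∈ D.cluster s c) : D.lvl s c' = D.lvl s c := by
  induction h with
  | refl => rfl
  | tail _ h ih => exact ((linked_iff hw hs).1 h).1.symm.trans ih

theorem isAncestor_top_of_mem_cluster {m c : D.Comp} (h : c ∈ D.cluster s m)
    (hm : ∀ c' ∈ D.cluster s m, T.depth (D.top m) ≤ T.depth (D.top c')) :
    T.IsAncestor (D.top m) (D.top c) := by
  induction h with
  | refl => exact T.isAncestor_refl _
  | @tail c₁ c₂ h1 h2 ih =>
    have h4 := hm _ (h1.tail h2)
    obtain ⟨-, x, hx1, hx2⟩ := h2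
    rcases (top_isAncestor_of_mem_verts hx1).total (top_isAncestor_of_mem_verts hx2) with h3 | h3
    · exact ih.trans h3
    · exact ih.of_depth_le h3 h4

theorem critical_isAncestor_top (c : D.Comp) : T.IsAncestor (D.critical s c) (D.top c) := by
  obtain ⟨m, h1, h2, h3⟩ := exists_mem_cluster_top_eq_critical (s := s) c
  rw [← h2]
  rw [← cluster_eq h1] at h3
  exact isAncestor_top_of_mem_cluster (mem_cluster_symm h1) h3

theorem dist_top_sub_dist_critical_lt (hw : ∀ v, v ≠ T.root → 0 ≤ T.weight v) (hs : 0 < s)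
    (c : D.Comp) : T.dist (D.top c) - T.dist (D.critical s c) < s := by
  obtain ⟨m, h1, h2, -⟩ := exists_mem_cluster_top_eq_critical (s := s) c
  have h3 := lvl_eq_of_mem_cluster hw hs h1
  rw [← h2]
  have h4 := ((mem_level_iff hw hs).2 (congrArg (· + 1) h3) : m ∈ D.level s (D.lvl s c + 1)).1
  have h5 := ((mem_level_iff hw hs).2 rfl : c ∈ D.level s (D.lvl s c + 1)).2
  push_cast at h4 h5
  linarith

/-- The path between the critical vertex of a maximally connected set and the root of one of its
components stays in that set. -/
theorem mem_cluster_of_between {c c' : D.Comp} {v : V} (hv : v ∈ c'.1)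
    (h : T.IsAncestor v (D.top c)) (h1 : T.IsAncestor (D.critical s c) v)
    (h2 : D.critical s c ≠ v) : c' ∈ D.cluster s c := by
  obtain ⟨m, hm, htop, -⟩ := exists_mem_cluster_top_eq_critical (s := s) c
  rw [← htop] at h1 h2
  rw [← cluster_eq hm]
  have key : ∀ a ∈ D.cluster s m, T.IsAncestor v (D.top a) → c' ∈ D.cluster s m := by
    intro a ha
    induction ha with
    | refl => exact fun h => absurd (h1.antisymm h) h2
    | @tail a b ha hab ih =>
      intro hvb
      obtain ⟨-, x, hxa, hxb⟩ := hab
      have hvx := hvb.trans (top_isAncestor_of_mem_verts hxb)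
      rcases mem_verts.1 hxa with rfl | hxa
      · exact ih hvx
      · rcases mem_or_isAncestor_top hxa hvx with h3 | h3
        · rw [comp_eq_of_mem hv h3]
          exact ha
        · exact ih h3
  exact key c (mem_cluster_symm hm) h

theorem lvl_lt_of_critical_mem (hw : ∀ v, v ≠ T.root → 0 ≤ T.weight v) (hs : 0 < s)
    {c c' : D.Comp} (h : D.critical s c' ∈ c.1) : D.lvl s c < D.lvl s c' := by
  obtain ⟨m, h1, h2, h3⟩ := exists_mem_cluster_top_eq_critical (s := s) c'
  rw [← h2] at h
  rw [← lvl_eq_of_mem_cluster hw hs h1]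
  refine lt_of_le_of_ne (Nat.floor_le_floor ?_) fun heq => ?_
  · exact div_le_div_of_nonneg_right ((top_isAncestor h).dist_le hw) hs.le
  · have h4 : c ∈ D.cluster s c' := Relation.ReflTransGen.tail h1
      ((linked_iff hw hs).2 ⟨heq.symm, D.top m, mem_verts.2 (Or.inl rfl), mem_verts.2 (Or.inr h)⟩)
    have := h3 c h4
    have := depth_top_lt h
    omega

/-! ### Ancestors in the tree of reduced height -/

theorem hatParent_inl {c : D.Comp} {v : V} (hv : v ∈ c.1) : (D.hat s).parent (.inl v) =
    if T.parent v = D.top c then .inr c else .inl (T.parent v) := by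
  have h : v ∈ T.edges := by simp [RootedTree.edges, ne_root_of_mem hv]
  have hc : (⟨D.partition.part v, D.partition.part_mem.2 h⟩ : D.Comp) = c :=
    comp_eq_of_mem (D.partition.mem_part h) hv
  change D.hatParent s (.inl v) = _
  simp only [hatParent, h, dite_true, hc]

theorem hat_root : (D.hat s).root = .inl T.root := rfl

theorem hatParent_inr (c : D.Comp) : (D.hat s).parent (.inr c) = .inl (D.critical s c) := rfl

variable (D) in
/-- The vertex of `T` that a vertex of the tree of reduced height is a copy of. -/
def shadow : V ⊕ D.Comp → V := Sum.elim id D.top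

theorem shadow_isAncestor {y y' : V ⊕ D.Comp} (h : (D.hat s).IsAncestor y y') :
    T.IsAncestor (D.shadow y) (D.shadow y') := by
  refine h.induction (p := fun y' => T.IsAncestor (D.shadow y) (D.shadow y'))
    (T.isAncestor_refl _) ?_
  rintro (v | c) hne - ih
  · have hv : v ≠ T.root := fun h => hne (by rw [h]; rfl)
    obtain ⟨c, hc⟩ := exists_comp (D := D) hv
    rw [hatParent_inl hc] at ih
    refine ih.trans ?_
    split_ifs with h1
    · exact top_isAncestor hc
    · exact T.isAncestor_parent v
  · exact ih.trans (critical_isAncestor_top c)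

theorem inr_isAncestor_inl_iff {c c' : D.Comp} {v : V} (hv : v ∈ c'.1) :
    (D.hat s).IsAncestor (.inr c) (.inl v) ↔ (D.hat s).IsAncestor (.inr c) (.inr c') := by
  suffices H : ∀ n, ∀ v ∈ c'.1, T.depth v ≤ n →
      ((D.hat s).IsAncestor (.inr c) (.inl v) ↔ (D.hat s).IsAncestor (.inr c) (.inr c')) from
    H _ v hv le_rfl
  intro n
  induction n with
  | zero =>
    intro v hv hd
    exact absurd (depth_eq_zero.1 (Nat.le_zero.1 hd)) (ne_root_of_mem hv)
  | succ n ih =>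
    intro v hv hd
    have hp := hatParent_inl (s := s) hv
    have h1 : (D.hat s).IsAncestor (.inr c) (.inl v) ↔
        (D.hat s).IsAncestor (.inr c) ((D.hat s).parent (.inl v)) :=
      ⟨fun h => h.parent_of_ne Sum.inr_ne_inl, fun h => h.trans (isAncestor_parent _ _)⟩
    rw [h1, hp]
    split_ifs with h2
    · rfl
    · refine ih _ ((D.connected c' v hv).resolve_left h2) ?_
      have := T.depth_parent v (ne_root_of_mem hv)
      omega

theorem inr_isAncestor_inl {c : D.Comp} {v : V} (hv : v ∈ c.1) :
    (D.hat s).IsAncestor (.inr c) (.inl v) :=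
  (inr_isAncestor_inl_iff hv).2 (isAncestor_refl _ _)

theorem not_inr_isAncestor_inl_root (c : D.Comp) :
    ¬ (D.hat s).IsAncestor (.inr c) (.inl T.root) := by
  intro h
  have := h.ne_root (by rw [hat_root]; exact Sum.inr_ne_inl)
  exact this rfl

/-- A component that is properly above another one (in the tree of reduced height) contains the
critical vertex of a component that is above the other one. -/
theorem exists_critical_mem {c c' : D.Comp} (h : (D.hat s).IsAncestor (.inr c) (.inr c'))
    (hne : c ≠ c') : ∃ m : D.Comp, (D.hat s).IsAncestor (.inr c) (.inr m) ∧
      (D.hat s).IsAncestor (.inr m) (.inr c') ∧ D.critical s m ∈ c.1 := by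
  suffices H : ∀ n c', (D.hat s).depth (.inr c') ≤ n → (D.hat s).IsAncestor (.inr c) (.inr c') →
      c ≠ c' → ∃ m : D.Comp, (D.hat s).IsAncestor (.inr c) (.inr m) ∧
        (D.hat s).IsAncestor (.inr m) (.inr c') ∧ D.critical s m ∈ c.1 from
    H _ c' le_rfl h hne
  intro n
  induction n with
  | zero =>
    intro c' hd
    exact absurd (depth_eq_zero.1 (Nat.le_zero.1 hd)) Sum.inr_ne_inl
  | succ n ih =>
    intro c' hd h hne
    have h1 := h.parent_of_ne fun h => hne (Sum.inr_injective h)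
    rw [hatParent_inr] at h1
    have h2 : D.critical s c' ≠ T.root := fun h2 => not_inr_isAncestor_inl_root c (h2 ▸ h1)
    obtain ⟨c'', hc''⟩ := exists_comp (D := D) h2
    by_cases hcc : c = c''
    · exact ⟨c', h, isAncestor_refl _ _, hcc ▸ hc''⟩
    · have h3 := inr_isAncestor_inl (s := s) hc''
      have h4 : (D.hat s).IsAncestor (.inr c'') (.inr c') := h3.trans (isAncestor_parent _ _)
      have h5 := h4.depth_lt fun h => (by
        have := Sum.inr_injective h
        subst this
        exact absurd (hc'') (fun h6 => by
          have := h3.depth_le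
          have := (D.hat s).depth_parent (.inr c'') Sum.inr_ne_inl
          rw [hatParent_inr] at this
          omega))
      obtain ⟨m, h6, h7, h8⟩ := ih c'' (by omega) ((inr_isAncestor_inl_iff hc'').1 h1) hcc
      exact ⟨m, h6, h7.trans h4, h8⟩

/-- Along each path of the tree of reduced height the classes of the components increase. -/
theorem lvl_lt_of_isAncestor (hw : ∀ v, v ≠ T.root → 0 ≤ T.weight v) (hs : 0 < s)
    {c c' : D.Comp} (h : (D.hat s).IsAncestor (.inr c) (.inr c')) (hne : c ≠ c') :
    D.lvl s c < D.lvl s c' := by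
  obtain ⟨m, -, h1, h2⟩ := exists_critical_mem h hne
  refine (lvl_lt_of_critical_mem hw hs h2).trans_le (Nat.floor_le_floor ?_)
  exact div_le_div_of_nonneg_right ((shadow_isAncestor h1).dist_le hw) hs.le

/-- The children of a critical vertex are the copies of the roots of the components that have
been moved there. -/
theorem Admissible.exists_of_mem_children {Γ : ℝ} {k : ℕ} (hA : D.Admissible Γ k) {z : V}
    (hz : z ∈ Set.range (D.critical s)) {u : V ⊕ D.Comp}
    (hu : u ∈ (D.hat s).children (.inl z)) : ∃ c, u = .inr c ∧ D.critical s c = z := by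
  obtain ⟨hu0, hu⟩ := hu
  obtain ⟨c₀, rfl⟩ := hz
  rcases u with v | c
  · exfalso
    have hv : v ≠ T.root := fun h => hu0 (by rw [h]; rfl)
    obtain ⟨c, hc⟩ := exists_comp (D := D) hv
    rw [hatParent_inl hc] at hu
    split_ifs at hu with h1
    have h2 := Sum.inl_injective hu
    obtain ⟨m, -, h3, -⟩ := exists_mem_cluster_top_eq_critical (s := s) c₀
    have h4 : D.top m ∈ c.1 := by
      rw [h3, ← h2]
      exact (D.connected c v hc).resolve_left h1
    exact (hA.exit_unique h4 hc rfl).1 (h2.trans h3.symm)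
  · exact ⟨c, rfl, Sum.inl_injective hu⟩

theorem inr_notMem_leaves_hat (c : D.Comp) : (.inr c : V ⊕ D.Comp) ∉ (D.hat s).leaves := by
  intro h
  obtain ⟨v, h1, h2⟩ := exists_child_top c
  have : (.inl v : V ⊕ D.Comp) ∈ (D.hat s).children (.inr c) :=
    ⟨fun h => ne_root_of_mem h1 (Sum.inl_injective h), by rw [hatParent_inl h1, if_pos h2]⟩
  rw [show (D.hat s).children (.inr c) = ∅ from h] at this
  exact this

theorem dist_hat (y : V ⊕ D.Comp) : (D.hat s).dist y = T.dist (D.shadow y) := by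
  refine (isAncestor_root (D.hat s) y).induction
    (p := fun y => (D.hat s).dist y = T.dist (D.shadow y)) ?_ ?_
  · rw [dist_root]
    exact dist_root.symm
  · rintro (v | c) hne - ih
    · have hv : v ≠ T.root := fun h => hne (by rw [h]; rfl)
      obtain ⟨c, hc⟩ := exists_comp (D := D) hv
      rw [RootedTree.dist_eq hne, ih, hatParent_inl hc, shadow, Sum.elim_inl, id,
        RootedTree.dist_eq hv]
      have : Sum.elim id D.top (if T.parent v = D.top c then .inr c else .inl (T.parent v)) =
          T.parent v := by
        split_ifs with h
        · exact h.symm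
        · rfl
      rw [this]
      rfl
    · rw [RootedTree.dist_eq hne, ih]
      change T.dist (D.top c) - T.dist (D.critical s c) + T.dist (D.critical s c) = T.dist (D.top c)
      ring

end Decomposition

/-! ### The cost of a tour in the tree of reduced height -/

namespace Decomposition

variable {V : Type*} [Fintype V] [DecidableEq V] {T : RootedTree V} {D : Decomposition T} {s : ℝ}

variable (D) in
/-- The components that contain a vertex of `U`. -/
def visited (U : Set V) : Finset D.Comp := {c | ∃ x ∈ U, x ∈ c.1}

variable (D s) in
/-- The components that, in the tree of reduced height, lie on a path from the root to `U`. -/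
def traversed (U : Set V) : Finset D.Comp :=
  {c | ∃ x ∈ U, (D.hat s).IsAncestor (.inr c) (.inl x)}

theorem mem_visited {U : Set V} {c : D.Comp} : c ∈ D.visited U ↔ ∃ x ∈ U, x ∈ c.1 := by
  simp [visited]

theorem mem_traversed {U : Set V} {c : D.Comp} :
    c ∈ D.traversed s U ↔ ∃ x ∈ U, (D.hat s).IsAncestor (.inr c) (.inl x) := by
  simp [traversed]

theorem inl_mem_span_hat {U : Set V} {v : V} : .inl v ∈ (D.hat s).span (Sum.inl '' U) ↔
    v ≠ T.root ∧ ∃ x ∈ U, (D.hat s).IsAncestor (.inl v) (.inl x) := by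
  rw [mem_span, hat_root, Sum.inl_injective.ne_iff]
  simp

theorem inr_mem_span_hat {U : Set V} {c : D.Comp} :
    .inr c ∈ (D.hat s).span (Sum.inl '' U) ↔ c ∈ D.traversed s U := by
  rw [mem_span, hat_root, mem_traversed]
  simp

/-- Below each traversed component there is a visited one. -/
theorem exists_visited {U : Set V} {c : D.Comp} (h : c ∈ D.traversed s U) :
    ∃ c' ∈ D.visited U, (D.hat s).IsAncestor (.inr c) (.inr c') := by
  obtain ⟨x, hx, h⟩ := mem_traversed.1 h
  have hx0 : x ≠ T.root := fun h0 => not_inr_isAncestor_inl_root c (h0 ▸ h)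
  obtain ⟨c', hc'⟩ := exists_comp (D := D) hx0
  exact ⟨c', mem_visited.2 ⟨x, hx, hc'⟩, (inr_isAncestor_inl_iff hc').1 h⟩

theorem mem_traversed_of_isAncestor {U : Set V} {c c' : D.Comp} (h : c' ∈ D.traversed s U)
    (h' : (D.hat s).IsAncestor (.inr c) (.inr c')) : c ∈ D.traversed s U := by
  obtain ⟨x, hx, h⟩ := mem_traversed.1 h
  exact mem_traversed.2 ⟨x, hx, h'.trans h⟩

theorem mem_traversed_of_mem_visited {U : Set V} {c : D.Comp} (h : c ∈ D.visited U) :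
    c ∈ D.traversed s U := by
  obtain ⟨x, hx, h⟩ := mem_visited.1 h
  exact mem_traversed.2 ⟨x, hx, inr_isAncestor_inl h⟩

/-- A tour traverses few components: below a visited component there is at most one traversed
component of each class. -/
theorem card_traversed_le (hw : ∀ v, v ≠ T.root → 0 ≤ T.weight v) (hs : 0 < s) {U : Set V}
    {M : ℝ} (hM : ∀ x ∈ U, T.dist x ≤ M) (hM0 : 0 ≤ M) :
    (#(D.traversed s U) : ℝ) ≤ #(D.visited U) * (M / s + 1) := by
  choose! g hg using fun c (hc : c ∈ D.traversed s U) => exists_visited hc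
  have h1 : #(D.traversed s U) ≤ #(D.visited U ×ˢ range (⌊M / s⌋₊ + 1)) := by
    refine card_le_card_of_injOn (fun c => (g c, D.lvl s c)) ?_ ?_
    · intro c hc
      obtain ⟨x, hx, h⟩ := mem_traversed.1 hc
      rw [mem_coe, mem_product, mem_range]
      refine ⟨(hg c hc).1, Nat.lt_succ_of_le (Nat.floor_le_floor ?_)⟩
      exact div_le_div_of_nonneg_right (((shadow_isAncestor h).dist_le hw).trans (hM x hx)) hs.le
    · intro c hc c' hc' h
      obtain ⟨h2, h3⟩ := Prod.ext_iff.1 h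
      have h4 := (hg c' hc').2
      have h5 := (hg c hc).2
      simp only at h2 h3
      rw [h2] at h5
      by_contra hne
      rcases h4.total h5 with h6 | h6
      · exact (lvl_lt_of_isAncestor hw hs h6 (Ne.symm hne)).ne' h3
      · exact (lvl_lt_of_isAncestor hw hs h6 hne).ne h3
  rw [card_product, card_range] at h1
  have h2 : (⌊M / s⌋₊ : ℝ) ≤ M / s := Nat.floor_le (by positivity)
  calc (#(D.traversed s U) : ℝ) ≤ #(D.visited U) * (⌊M / s⌋₊ + 1) := by exact_mod_cast h1
    _ ≤ _ := by gcongr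

/-- Different traversed components are moved to different critical vertices, up to a number of
exceptions: the components that are not visited are continued by pairwise different critical
vertices. -/
theorem card_traversed_le_card_image_add (U : Set V) :
    #(D.traversed s U) ≤ #((D.traversed s U).image (D.critical s)) + #(D.visited U) := by
  have h1 : ∀ c ∈ D.traversed s U \ D.visited U,
      ∃ z ∈ (D.traversed s U).image (D.critical s), z ∈ c.1 := by
    intro c hc
    obtain ⟨hc, hcv⟩ := mem_sdiff.1 hc
    obtain ⟨c', hc', h⟩ := exists_visited hc
    obtain ⟨m, h2, h3, h4⟩ := exists_critical_mem h fun h => hcv (h ▸ hc')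
    exact ⟨_, mem_image_of_mem _
      (mem_traversed_of_isAncestor (mem_traversed_of_mem_visited hc') h3), h4⟩
  have : Nonempty V := ⟨T.root⟩
  choose! g hg hg' using h1
  have h2 : #(D.traversed s U \ D.visited U) ≤ #((D.traversed s U).image (D.critical s)) :=
    card_le_card_of_injOn g hg fun c hc c' hc' h =>
      comp_eq_of_mem (hg' c hc) (h ▸ hg' c' hc')
  have := card_le_card_sdiff_add_card (s := D.traversed s U) (t := D.visited U)
  omega

theorem dist_sub_dist_eq {u v : V} (h : T.IsAncestor u v) :
    T.dist v - T.dist u = ∑ a ∈ T.span {v} \ T.span {u}, T.weight a := by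
  have hsub : T.span {u} ⊆ T.span {v} := fun a ha => by
    rw [mem_span_singleton] at ha ⊢
    exact ⟨ha.1, ha.2.trans h⟩
  rw [dist_eq_spanWeight, dist_eq_spanWeight, spanWeight, spanWeight, ← sum_sdiff hsub]
  ring

/-- Reducing the height increases the cost of a tour by at most `s` for each component that the
tour visits: of the traversed components that are moved to the critical vertex `z`, the topmost
one is charged to the path from `z` to its root, which is no longer used, the others cost less
than `s` each. -/
theorem spanWeight_hat_le (hw : ∀ v, v ≠ T.root → 0 ≤ T.weight v) (hs : 0 < s) (U : Set V) :
    (D.hat s).spanWeight (Sum.inl '' U) ≤ T.spanWeight U + #(D.visited U) * s := by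
  set H := (D.hat s).span (Sum.inl '' U) with hH
  set P := D.traversed s U with hP
  set Z := P.image (D.critical s) with hZ
  -- the weight of the edge of the tree of reduced height above the copy of the root of `c`
  set δ : D.Comp → ℝ := fun c => T.dist (D.top c) - T.dist (D.critical s c) with hδ
  have hright : H.toRight = P := by
    ext c
    rw [mem_toRight, hH, inr_mem_span_hat]
  have hsum : (D.hat s).spanWeight (Sum.inl '' U) = ∑ v ∈ H.toLeft, T.weight v + ∑ c ∈ P, δ c := by
    rw [spanWeight, ← hH, ← toLeft_disjSum_toRight (u := H), sum_disjSum, hright]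
    simp only [toLeft_disjSum]
    rfl
  have hleft : H.toLeft ⊆ T.span U := fun v h => by
    obtain ⟨h1, x, hx, h2⟩ := inl_mem_span_hat.1 (mem_toLeft.1 h)
    exact mem_span.2 ⟨h1, x, hx, shadow_isAncestor h2⟩
  rcases isEmpty_or_nonempty D.Comp with hempty | hne
  · rw [hsum, P.eq_empty_of_isEmpty, sum_empty, add_zero]
    refine le_add_of_le_of_nonneg
      (sum_le_sum_of_subset_of_nonneg hleft fun v hv _ => hw v (mem_span.1 hv).1) ?_
    positivity
  -- the topmost component at each critical vertex
  have hex : ∀ z ∈ Z, ∃ c ∈ P, D.critical s c = z ∧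
      ∀ c' ∈ P, D.critical s c' = z → T.depth (D.top c) ≤ T.depth (D.top c') := by
    intro z hz
    obtain ⟨c₁, hc₁, hz₁⟩ := mem_image.1 hz
    obtain ⟨c, hc, hmin⟩ := exists_min_image (P.filter fun c => D.critical s c = z)
      (fun c => T.depth (D.top c)) ⟨c₁, mem_filter.2 ⟨hc₁, hz₁⟩⟩
    exact ⟨c, (mem_filter.1 hc).1, (mem_filter.1 hc).2,
      fun c' h1 h2 => hmin c' (mem_filter.2 ⟨h1, h2⟩)⟩
  choose! f hfP hfz hfmin using hex
  have hinj : Set.InjOn f Z := fun z hz z' hz' h => by rw [← hfz z hz, h, hfz z' hz']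
  have himage : Z.image f ⊆ P := fun c hc => by
    obtain ⟨z, hz, rfl⟩ := mem_image.1 hc
    exact hfP z hz
  set path : V → Finset V := fun z => T.span {D.top (f z)} \ T.span {z} with hpath
  -- the path from `z` to the root of the topmost component runs through components that are moved
  -- to `z` as well, and whose roots are higher than those of the traversed ones
  have hmem_path : ∀ z ∈ Z, ∀ v ∈ path z, v ≠ T.root ∧ T.IsAncestor v (D.top (f z)) ∧
      ∀ c : D.Comp, v ∈ c.1 → D.critical s c = z ∧ T.depth (D.top c) < T.depth (D.top (f z)) := by
    intro z hz v hv
    simp only [hpath, mem_sdiff, mem_span_singleton, not_and] at hv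
    obtain ⟨⟨h1, h2⟩, h3⟩ := hv
    refine ⟨h1, h2, fun c hc => ?_⟩
    have h4 : T.IsAncestor z (D.top (f z)) := by
      conv_lhs => rw [← hfz z hz]
      exact critical_isAncestor_top _
    have h5 : T.IsAncestor z v := (h4.total h2).resolve_right (h3 h1)
    have h6 : z ≠ v := fun h => h3 h1 (h ▸ T.isAncestor_refl _)
    refine ⟨?_, (depth_top_lt hc).trans_le h2.depth_le⟩
    rw [← hfz z hz] at h5 h6
    rw [critical_eq_of_mem_cluster (mem_cluster_of_between hc h2 h5 h6), hfz z hz]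
  -- the topmost components are paid for by these paths, which are disjoint
  have hδf : ∑ c ∈ Z.image f, δ c = ∑ v ∈ Z.biUnion path, T.weight v := by
    rw [sum_image hinj, sum_biUnion]
    · refine sum_congr rfl fun z hz => ?_
      have h4 : T.IsAncestor z (D.top (f z)) := by
        conv_lhs => rw [← hfz z hz]
        exact critical_isAncestor_top _
      rw [← dist_sub_dist_eq h4, hδ]
      simp only [hfz z hz]
    · intro z hz z' hz' hne
      simp only [Function.onFun]
      rw [Finset.disjoint_left]
      intro v hv hv'
      obtain ⟨h1, -, h2⟩ := hmem_path z hz v hv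
      obtain ⟨c, hc⟩ := exists_comp (D := D) h1
      exact hne ((h2 c hc).1.symm.trans ((hmem_path z' hz' v hv').2.2 c hc).1)
  -- the other ones cost at most `s` each, and there are at most as many as visited components
  have hrest : ∑ c ∈ P \ Z.image f, δ c ≤ #(D.visited U) * s := by
    calc ∑ c ∈ P \ Z.image f, δ c ≤ ∑ c ∈ P \ Z.image f, s :=
          sum_le_sum fun c _ => (dist_top_sub_dist_critical_lt hw hs c).le
      _ = #(P \ Z.image f) * s := by rw [sum_const, nsmul_eq_mul]
      _ ≤ #(D.visited U) * s := by
          refine mul_le_mul_of_nonneg_right (Nat.cast_le.2 ?_) hs.le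
          rw [card_sdiff_of_subset himage, card_image_of_injOn hinj]
          have := card_traversed_le_card_image_add (D := D) (s := s) U
          rw [← hP, ← hZ] at this
          omega
  -- a tour in the tree of reduced height does not use the edges of the paths
  have hold : ∑ v ∈ H.toLeft, T.weight v + ∑ v ∈ Z.biUnion path, T.weight v ≤
      T.spanWeight U := by
    rw [← sum_union]
    · refine sum_le_sum_of_subset_of_nonneg ?_ fun v hv _ => hw v (mem_span.1 hv).1
      refine union_subset hleft fun v h => ?_
      · obtain ⟨z, hz, h⟩ := mem_biUnion.1 h
        obtain ⟨h1, h2, -⟩ := hmem_path z hz v h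
        obtain ⟨x, hx, h3⟩ := mem_traversed.1 (hfP z hz)
        exact mem_span.2 ⟨h1, x, hx, h2.trans (shadow_isAncestor h3)⟩
    · rw [Finset.disjoint_left]
      intro v hv hv'
      obtain ⟨z, hz, hv'⟩ := mem_biUnion.1 hv'
      obtain ⟨h1, x, hx, h2⟩ := inl_mem_span_hat.1 (mem_toLeft.1 hv)
      obtain ⟨c, hc⟩ := exists_comp (D := D) h1
      obtain ⟨h3, h4⟩ := (hmem_path z hz v hv').2.2 c hc
      have h5 : c ∈ P := mem_traversed.2 ⟨x, hx, (inr_isAncestor_inl hc).trans h2⟩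
      exact absurd (hfmin z hz c h5 h3) (not_le.2 h4)
  rw [hsum, ← sum_sdiff himage, hδf]
  linarith

end Decomposition

/-! ### Rearranging the subtours below critical vertices -/

/-- Rounding the demands of a set `P` of items to few values, separately for each value of `key`.
The items of `Q` get a tour of their own; any other item `p` takes the place of the item `σ p`,
which is at least as large as the rounded demand of `p`. -/
theorem exists_rounded_demands_fiberwise {ι Z : Type*} (P : Finset ι) (key : ι → Z)
    (dem : ι → ℕ) {k : ℕ} (hdem : ∀ p ∈ P, dem p ≤ k) {b : ℝ} (hb : 0 < b) (hb' : b ≤ 1 / 2) :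
    ∃ (Q : Finset ι) (σ : ι → ι) (new : ι → ℕ) (X : Z → Finset ℕ),
      Q ⊆ P ∧ (∀ p ∈ P, dem p ≤ new p) ∧ (∀ p ∈ Q, new p = k) ∧
      (∀ p ∈ P, p ∉ Q → σ p ∈ P ∧ key (σ p) = key p ∧ new p ≤ dem (σ p)) ∧
      (∀ p ∈ P, p ∉ Q → ∀ q ∈ P, q ∉ Q → σ p = σ q → p = q) ∧
      (∀ z, (#(X z) : ℝ) ≤ 1 / b) ∧ (∀ p ∈ P, new p ∈ X (key p)) ∧ (∀ z, k ∈ X z) ∧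
      (∀ z, ∀ m ∈ X z, m = k ∨ m ≤ k ∧ ∃ p ∈ P, dem p ≤ m) ∧
      ∀ f : Z → ℝ, (∀ z, 0 ≤ f z) → ∑ p ∈ Q, f (key p) ≤ 4 * b * ∑ p ∈ P, f (key p) := by
  have h := fun z => exists_rounded_demands (P := {p // p ∈ P.filter fun p => key p = z})
    (fun p => dem p) k (fun p => hdem p (mem_filter.1 p.2).1) hb hb'
  choose Q σ new h1 h2 h3 h4 h5 h6 h7 using h
  have hP : ∀ {p z}, p ∈ P → key p = z → p ∈ P.filter fun p => key p = z :=
    fun hp hz => mem_filter.2 ⟨hp, hz⟩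
  refine ⟨P.filter fun p => ∃ h : p ∈ P, ⟨p, hP h rfl⟩ ∈ Q (key p),
    fun p => if h : p ∈ P then σ (key p) ⟨p, hP h rfl⟩ else p,
    fun p => if h : p ∈ P then new (key p) ⟨p, hP h rfl⟩ else 0,
    fun z => insert k (univ.image (new z)), filter_subset _ _, ?_, ?_, ?_, ?_, ?_, ?_, ?_, ?_, ?_⟩
  · intro p hp
    simp only [hp, dite_true]
    exact h1 _ ⟨p, hP hp rfl⟩
  · intro p hp
    obtain ⟨hp, h, hQ⟩ := mem_filter.1 hp
    simp only [hp, dite_true]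
    exact h3 _ _ hQ
  · intro p hp hQ
    simp only [mem_filter, hp, exists_true_left, true_and] at hQ
    simp only [hp, dite_true]
    have h8 := mem_filter.1 (σ (key p) ⟨p, hP hp rfl⟩).2
    exact ⟨h8.1, h8.2, h4 _ _ hQ⟩
  · intro p hp hpQ q hq hqQ h
    simp only [mem_filter, hp, exists_true_left, true_and] at hpQ
    simp only [mem_filter, hq, exists_true_left, true_and] at hqQ
    simp only [hp, hq, dite_true] at h
    have hkey : key p = key q := by
      rw [← (mem_filter.1 (σ (key p) ⟨p, hP hp rfl⟩).2).2,
        ← (mem_filter.1 (σ (key q) ⟨q, hP hq rfl⟩).2).2, h]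
    -- transport along the equality of the two fibers
    have key2 : ∀ z (hz : key q = z), (⟨q, hP hq rfl⟩ : {p // p ∈ P.filter fun p => key p = key q})
        ∉ Q (key q) → ((σ (key q) ⟨q, hP hq rfl⟩ : _) : ι) = σ z ⟨q, hP hq hz⟩ ∧
          (⟨q, hP hq hz⟩ : {p // p ∈ P.filter fun p => key p = z}) ∉ Q z := by
      rintro z rfl h
      exact ⟨rfl, h⟩
    obtain ⟨h8, h9⟩ := key2 (key p) hkey.symm hqQ
    rw [h8] at h
    exact congrArg Subtype.val (h5 _ _ hpQ _ h9 (Subtype.ext h))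
  · exact h7
  · intro p hp
    simp only [hp, dite_true]
    exact mem_insert_of_mem (mem_image_of_mem _ (mem_univ _))
  · exact fun z => mem_insert_self _ _
  · intro z m hm
    rcases mem_insert.1 hm with h | h
    · exact Or.inl h
    · obtain ⟨p, -, rfl⟩ := mem_image.1 h
      exact Or.inr ⟨h2 z p, p, (mem_filter.1 p.2).1, h1 z p⟩
  · intro f hf
    rw [← sum_fiberwise_of_maps_to (t := P.image key) (s := P.filter _) (g := key)
      fun p hp => mem_image_of_mem _ (mem_filter.1 hp).1,
      ← sum_fiberwise_of_maps_to (t := P.image key) (s := P) (g := key)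
      fun p hp => mem_image_of_mem _ hp, mul_sum]
    refine sum_le_sum fun z _ => ?_
    rw [sum_congr rfl fun p hp => by rw [(mem_filter.1 hp).2],
      sum_congr (s₁ := P.filter fun p => key p = z) rfl fun p hp => by rw [(mem_filter.1 hp).2],
      sum_const, sum_const, nsmul_eq_mul, nsmul_eq_mul, ← mul_assoc]
    refine mul_le_mul_of_nonneg_right ?_ (hf z)
    have h8 := h6 z
    rw [Fintype.card_coe] at h8
    refine le_trans (Nat.cast_le.2 ?_) h8
    rw [← card_map (Function.Embedding.subtype _)]
    refine card_le_card fun p hp => ?_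
    simp only [mem_filter] at hp
    obtain ⟨⟨hp, h, hQ⟩, rfl⟩ := hp
    exact mem_map.2 ⟨_, hQ, rfl⟩

/-- Counting the terminals below each element of a forest `P`, if the relation `Next` from an
element to its parent is a partial function. Given are the place `pc x` of each terminal and numbers
`g` that satisfy the recursion that the numbers of terminals satisfy. -/
theorem card_below_eq {ι τ : Type*} [Fintype τ] (P : Finset ι) (Next B : ι → ι → Prop)
    (hfun : ∀ q p p', Next q p → Next q p' → p = p') (hmem : ∀ q ∈ P, ∀ p, Next q p → p ∈ P)
    (hB : ∀ p q, B p q ↔ p = q ∨ ∃ q', Next q q' ∧ B p q') (rank : ι → ℕ)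
    (hrank : ∀ q p, Next q p → rank p < rank q) (pc : τ → ι) (hpc : ∀ x, pc x ∈ P) (g : ι → ℕ)
    (hg : ∀ p ∈ P, #{x | pc x = p} + ∑ q ∈ P with Next q p, g q = g p) {p : ι} (hp : p ∈ P) :
    #{x | B p (pc x)} = g p := by
  -- the basic properties of `B`, by induction along the ways upwards: `B` respects the rank; below
  -- `p` there are only `p` itself and what is below a child of `p`; and different children of `p`
  -- have nothing below them in common
  have hBrank : ∀ n p r, rank r ≤ n → B p r → rank p ≤ rank r := by
    intro n
    induction n with
    | zero =>
      intro p r hr h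
      rcases (hB p r).1 h with rfl | ⟨q', h1, -⟩
      · exact le_rfl
      · have := hrank r q' h1
        omega
    | succ n ih =>
      intro p r hr h
      rcases (hB p r).1 h with rfl | ⟨q', h1, h2⟩
      · exact le_rfl
      · have := hrank r q' h1
        have := ih p q' (by omega) h2
        omega
  have hdown : ∀ n p, ∀ r ∈ P, rank r ≤ n → B p r → r = p ∨ ∃ q ∈ P, Next q p ∧ B q r := by
    intro n
    induction n with
    | zero =>
      intro p r _ hr h
      rcases (hB p r).1 h with rfl | ⟨q', h1, -⟩
      · exact Or.inl rfl
      · have := hrank r q' h1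
        omega
    | succ n ih =>
      intro p r hrP hr h
      rcases (hB p r).1 h with rfl | ⟨q', h1, h2⟩
      · exact Or.inl rfl
      · have := hrank r q' h1
        rcases ih p q' (hmem r hrP q' h1) (by omega) h2 with rfl | ⟨q, hq, h3, h4⟩
        · exact Or.inr ⟨r, hrP, h1, (hB r r).2 (Or.inl rfl)⟩
        · exact Or.inr ⟨q, hq, h3, (hB q r).2 (Or.inr ⟨q', h1, h4⟩)⟩
  have hup : ∀ n p q r, rank r ≤ n → Next q p → B q r → B p r := by
    intro n
    induction n with
    | zero =>
      intro p q r hr hqp h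
      rcases (hB q r).1 h with rfl | ⟨q', h1, -⟩
      · have := hrank _ _ hqp
        omega
      · have := hrank r q' h1
        omega
    | succ n ih =>
      intro p q r hr hqp h
      rcases (hB q r).1 h with rfl | ⟨q', h1, h2⟩
      · exact (hB p q).2 (Or.inr ⟨p, hqp, (hB p p).2 (Or.inl rfl)⟩)
      · have := hrank r q' h1
        exact (hB p r).2 (Or.inr ⟨q', h1, ih p q q' (by omega) hqp h2⟩)
  have huniq : ∀ n p q q' r, rank r ≤ n → Next q p → Next q' p → B q r → B q' r → q = q' := by
    have hself : ∀ p q q', Next q p → Next q' p → B q' q → q = q' := by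
      intro p q q' hq hq' h
      rcases (hB q' q).1 h with h1 | ⟨p', h1, h2⟩
      · exact h1.symm
      · rw [hfun q p' p h1 hq] at h2
        have := hBrank _ q' p le_rfl h2
        have := hrank _ _ hq'
        omega
    intro n
    induction n with
    | zero =>
      intro p q q' r hr hq hq' h h'
      rcases (hB q r).1 h with rfl | ⟨r', h1, -⟩
      · have := hrank _ _ hq
        omega
      · have := hrank r r' h1
        omega
    | succ n ih =>
      intro p q q' r hr hq hq' h h'
      rcases (hB q r).1 h with rfl | ⟨r', h1, h2⟩
      · exact hself p q q' hq hq' h'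
      rcases (hB q' r).1 h' with rfl | ⟨r'', h3, h4⟩
      · exact (hself p q' q hq' hq h).symm
      have := hrank r r' h1
      rw [hfun r r'' r' h3 h1] at h4
      exact ih p q q' r' (by omega) hq hq' h2 h4
  obtain ⟨m, hm⟩ : ∃ m, ∀ q ∈ P, rank q ≤ m :=
    ⟨P.sup rank, fun q hq => le_sup (f := rank) hq⟩
  -- induction from the leaves of the forest upwards
  suffices H : ∀ n, ∀ p ∈ P, m < rank p + n → #{x | B p (pc x)} = g p from
    H (m + 1) p hp (by omega)
  intro n
  induction n with
  | zero =>
    intro p hp h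
    have := hm p hp
    omega
  | succ n ih =>
    intro p hp h
    have hset : univ.filter (fun x => B p (pc x)) = univ.filter (fun x => pc x = p) ∪
        (P.filter fun q => Next q p).biUnion fun q => univ.filter fun x => B q (pc x) := by
      ext x
      simp only [mem_filter, mem_univ, true_and, mem_union, mem_biUnion]
      constructor
      · intro hx
        rcases hdown _ p (pc x) (hpc x) le_rfl hx with h1 | ⟨q, h1, h2, h3⟩
        · exact Or.inl h1
        · exact Or.inr ⟨q, ⟨h1, h2⟩, h3⟩
      · rintro (rfl | ⟨q, ⟨-, h2⟩, h3⟩)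
        · exact (hB _ _).2 (Or.inl rfl)
        · exact hup _ p q _ le_rfl h2 h3
    rw [hset, card_union_of_disjoint, card_biUnion, ← hg p hp]
    · congr 1
      refine sum_congr rfl fun q hq => ?_
      obtain ⟨h1, h2⟩ := mem_filter.1 hq
      exact ih q h1 (by have := hrank q p h2; omega)
    · intro q hq q' hq' hne
      simp only [Function.onFun]
      rw [Finset.disjoint_left]
      intro x hx hx'
      exact hne (huniq _ p q q' (pc x) le_rfl (mem_filter.1 hq).2 (mem_filter.1 hq').2
        (mem_filter.1 hx).2 (mem_filter.1 hx').2)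
    · rw [Finset.disjoint_left]
      intro x hx hx'
      obtain ⟨q, hq, hx'⟩ := mem_biUnion.1 hx'
      have h1 := hBrank _ q (pc x) le_rfl (mem_filter.1 hx').2
      have h2 := hrank q p (mem_filter.1 hq).2
      rw [(mem_filter.1 hx).2] at h1
      omega

section Forest

open Decomposition

variable {V : Type*} [Fintype V] [DecidableEq V] {T : RootedTree V} {D : Decomposition T} {s : ℝ}
  {J : Type*} {Q : Finset (J × D.Comp)} {σ : J × D.Comp → J × D.Comp}

/-- The parent map of the forest of the rearranged tours. The node `(.inl j, y)` is the visit of the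
`j`-th tour to `y`, and the node `(.inr p, y)` is a visit to `y` on the way to the piece `p`, which
has been detached from its tour. The piece `(j, c)` is the part of the `j`-th tour below the copy of
the root of `c`; if it is not detached, then it is continued upwards by the tour of the piece
`σ (j, c)`. -/
def forestParent (D : Decomposition T) (s : ℝ) (Q : Finset (J × D.Comp))
    (σ : J × D.Comp → J × D.Comp) (n : (J ⊕ J × D.Comp) × (V ⊕ D.Comp)) :
    (J ⊕ J × D.Comp) × (V ⊕ D.Comp) :=
  (match n with
    | (.inl j, .inr c) => if (j, c) ∈ Q then .inr (j, c) else .inl (σ (j, c)).1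
    | (κ, _) => κ, (D.hat s).parent n.2)

/-- The node at which the piece `p` starts. -/
def pieceNode (p : J × D.Comp) : (J ⊕ J × D.Comp) × (V ⊕ D.Comp) := (.inl p.1, .inr p.2)

/-- The piece `q` is continued upwards by the piece `p`. -/
def NextPiece (s : ℝ) (Q : Finset (J × D.Comp)) (σ : J × D.Comp → J × D.Comp)
    (q p : J × D.Comp) : Prop :=
  q ∉ Q ∧ p.1 = (σ q).1 ∧ D.critical s q.2 ∈ p.2.1

theorem forestParent_inr (p : J × D.Comp) (y : V ⊕ D.Comp) :
    forestParent D s Q σ (.inr p, y) = (.inr p, (D.hat s).parent y) := by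
  cases y <;> rfl

theorem forestParent_inl_inl (j : J) (v : V) :
    forestParent D s Q σ (.inl j, .inl v) = (.inl j, (D.hat s).parent (.inl v)) := rfl

theorem forestParent_of_mem {p : J × D.Comp} (hp : p ∈ Q) :
    forestParent D s Q σ (pieceNode p) = (.inr p, .inl (D.critical s p.2)) := by
  simp [forestParent, pieceNode, hp, hatParent_inr]

theorem forestParent_of_notMem {p : J × D.Comp} (hp : p ∉ Q) :
    forestParent D s Q σ (pieceNode p) = (.inl (σ p).1, .inl (D.critical s p.2)) := by
  simp [forestParent, pieceNode, hp, hatParent_inr]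

theorem forestParent_of_snd_eq_root {n : (J ⊕ J × D.Comp) × (V ⊕ D.Comp)}
    (h : n.2 = (D.hat s).root) : forestParent D s Q σ n = n := by
  obtain ⟨κ, y⟩ := n
  simp only at h
  subst h
  have := (D.hat s).parent_root
  rcases κ with j | p
  · rw [hat_root] at this ⊢
    rw [forestParent_inl_inl, this]
  · rw [forestParent_inr, this]

theorem below_inr_iff {n : (J ⊕ J × D.Comp) × (V ⊕ D.Comp)} {p : J × D.Comp} {y : V ⊕ D.Comp} :
    Below (forestParent D s Q σ) n (.inr p, y) ↔ n.1 = .inr p ∧ (D.hat s).IsAncestor n.2 y := by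
  have key : ∀ i, (forestParent D s Q σ)^[i] (.inr p, y) = (.inr p, (D.hat s).parent^[i] y) := by
    intro i
    induction i with
    | zero => rfl
    | succ i ih =>
      rw [Function.iterate_succ_apply', ih, Function.iterate_succ_apply', forestParent_inr]
  simp only [Below, key, RootedTree.IsAncestor]
  constructor
  · rintro ⟨i, rfl⟩
    exact ⟨rfl, i, rfl⟩
  · rintro ⟨h, i, h'⟩
    exact ⟨i, Prod.ext h.symm h'⟩

/-- Inside a component, all ways upwards lead to the copy of its root. -/
theorem below_pieceNode_inl_iff {p : J × D.Comp} {j : J} {c : D.Comp} {v : V} (hv : v ∈ c.1) :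
    Below (forestParent D s Q σ) (pieceNode p) (.inl j, .inl v) ↔
      Below (forestParent D s Q σ) (pieceNode p) (pieceNode (j, c)) := by
  suffices H : ∀ n, ∀ v ∈ c.1, T.depth v ≤ n →
      (Below (forestParent D s Q σ) (pieceNode p) (.inl j, .inl v) ↔
        Below (forestParent D s Q σ) (pieceNode p) (pieceNode (j, c))) from H _ v hv le_rfl
  intro n
  induction n with
  | zero =>
    intro v hv hd
    exact absurd (depth_eq_zero.1 (Nat.le_zero.1 hd)) (ne_root_of_mem hv)
  | succ n ih =>
    intro v hv hd
    have h1 : Below (forestParent D s Q σ) (pieceNode p) (.inl j, .inl v) ↔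
        Below (forestParent D s Q σ) (pieceNode p) (forestParent D s Q σ (.inl j, .inl v)) :=
      ⟨fun h => h.eq_or_parent.resolve_left fun h => Sum.inr_ne_inl (congrArg Prod.snd h),
        Below.of_parent⟩
    rw [h1, forestParent_inl_inl, hatParent_inl hv]
    split_ifs with h
    · rfl
    · refine ih _ ((D.connected c v hv).resolve_left h) ?_
      have := T.depth_parent v (ne_root_of_mem hv)
      omega

theorem below_pieceNode_iff {p q : J × D.Comp} :
    Below (forestParent D s Q σ) (pieceNode p) (pieceNode q) ↔
      p = q ∨ ∃ q', NextPiece s Q σ q q' ∧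
        Below (forestParent D s Q σ) (pieceNode p) (pieceNode q') := by
  constructor
  · intro h
    rcases h.eq_or_parent with h1 | h1
    · left
      simp only [pieceNode, Prod.mk.injEq, Sum.inl.injEq, Sum.inr.injEq] at h1
      exact Prod.ext h1.1 h1.2
    right
    by_cases hq : q ∈ Q
    · rw [forestParent_of_mem hq, below_inr_iff] at h1
      exact absurd h1.1 Sum.inl_ne_inr
    · rw [forestParent_of_notMem hq] at h1
      have h2 : D.critical s q.2 ≠ T.root := by
        intro h2
        rw [h2] at h1
        have h3 := h1.eq_of_fixed (forestParent_of_snd_eq_root rfl)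
        exact Sum.inr_ne_inl (congrArg Prod.snd h3)
      obtain ⟨c, hc⟩ := exists_comp (D := D) h2
      exact ⟨((σ q).1, c), ⟨hq, rfl, hc⟩, (below_pieceNode_inl_iff hc).1 h1⟩
  · rintro (rfl | ⟨⟨j, c⟩, ⟨hq, h1, h2⟩, h3⟩)
    · exact Below.refl _
    · refine Below.of_parent ?_
      rw [forestParent_of_notMem hq]
      simp only at h1
      rw [← h1]
      exact (below_pieceNode_inl_iff h2).2 h3

/-- The demand of a node on the way to a detached piece is the demand of the piece. -/
theorem below_detour_iff {p : J × D.Comp} {y : V ⊕ D.Comp} {n : (J ⊕ J × D.Comp) × (V ⊕ D.Comp)}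
    {j : J} (hn : n.1 = .inl j) :
    Below (forestParent D s Q σ) (.inr p, y) n ↔ p ∈ Q ∧
      (D.hat s).IsAncestor y (.inl (D.critical s p.2)) ∧
      Below (forestParent D s Q σ) (pieceNode p) n := by
  constructor
  · rintro ⟨i, hi⟩
    induction i generalizing n j with
    | zero =>
      rw [Function.iterate_zero, id] at hi
      rw [hi] at hn
      exact absurd hn Sum.inr_ne_inl
    | succ i ih =>
      rw [Function.iterate_succ_apply] at hi
      obtain ⟨κ, y'⟩ := n
      simp only at hn
      subst hn
      rcases y' with v | c
      · obtain ⟨h1, h2, h3⟩ := ih (j := j) rfl hi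
        exact ⟨h1, h2, Below.of_parent h3⟩
      · by_cases hQ : (j, c) ∈ Q
        · have h4 : Below (forestParent D s Q σ) (.inr p, y) (.inr (j, c),
              .inl (D.critical s c)) := ⟨i, by rw [← hi, ← forestParent_of_mem hQ]; rfl⟩
          obtain ⟨h5, h6⟩ := below_inr_iff.1 h4
          have h7 := Sum.inr_injective h5
          subst h7
          exact ⟨hQ, h6, Below.refl _⟩
        · obtain ⟨h1, h2, h3⟩ := ih (j := (σ (j, c)).1)
            (congrArg Prod.fst (forestParent_of_notMem hQ)) hi
          exact ⟨h1, h2, Below.of_parent h3⟩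
  · rintro ⟨h1, h2, h3⟩
    refine Below.trans (Below.of_parent ?_) h3
    rw [forestParent_of_mem h1, below_inr_iff]
    exact ⟨rfl, h2⟩

/-- What a tour visits is visited below the pieces that hang at the root. -/
theorem exists_piece_of_below_root {j : J} {n : (J ⊕ J × D.Comp) × (V ⊕ D.Comp)}
    (h : Below (forestParent D s Q σ) (.inl j, .inl T.root) n) (hn : n.2 ≠ .inl T.root) :
    ∃ q ∉ Q, (σ q).1 = j ∧ D.critical s q.2 = T.root ∧
      Below (forestParent D s Q σ) (pieceNode q) n := by
  obtain ⟨i, hi⟩ := h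
  induction i generalizing n with
  | zero =>
    rw [Function.iterate_zero, id] at hi
    exact absurd (congrArg Prod.snd hi) hn
  | succ i ih =>
    rw [Function.iterate_succ_apply] at hi
    by_cases h1 : (forestParent D s Q σ n).2 = .inl T.root
    · rw [Function.iterate_fixed (forestParent_of_snd_eq_root h1)] at hi
      obtain ⟨κ | p, v | c⟩ := n
      · exfalso
        rw [forestParent_inl_inl] at h1
        have hv : v ≠ T.root := fun h => hn (congrArg Sum.inl h)
        obtain ⟨c, hc⟩ := exists_comp (D := D) hv
        simp only [hatParent_inl hc] at h1
        split_ifs at h1 with h2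
        have h3 := (D.connected c v hc).resolve_left h2
        exact ne_root_of_mem h3 (Sum.inl_injective h1)
      · by_cases hQ : (κ, c) ∈ Q
        · have h2 := congrArg Prod.fst ((forestParent_of_mem (σ := σ) (s := s) hQ).symm.trans hi)
          exact absurd h2 Sum.inr_ne_inl
        · have h2 := (forestParent_of_notMem (σ := σ) (s := s) hQ).symm.trans hi
          simp only [Prod.mk.injEq, Sum.inl.injEq] at h2
          exact ⟨(κ, c), hQ, h2.1, h2.2, Below.refl _⟩
      all_goals
        rw [forestParent_inr] at hi
        exact absurd (congrArg Prod.fst hi) Sum.inr_ne_inl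
    · obtain ⟨q, h2, h3, h4, h5⟩ := ih h1 hi
      exact ⟨q, h2, h3, h4, Below.of_parent h5⟩

end Forest

section Rearrange

open Decomposition

variable {V : Type*} [Fintype V] [DecidableEq V] {T : RootedTree V} {D : Decomposition T} {s : ℝ}
  {J : Type*}

theorem visited_tourSet (t : T.leaves → J) (j : J) :
    D.visited (tourSet t j) = ({c | (D.held t j c).Nonempty} : Finset D.Comp) := by
  ext c
  simp only [mem_visited, mem_filter, mem_univ, true_and, Finset.Nonempty, mem_held]
  constructor
  · rintro ⟨_, ⟨x, hx, rfl⟩, hc⟩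
    exact ⟨x, hx, hc⟩
  · rintro ⟨x, hx, hc⟩
    exact ⟨x, ⟨x, hx, rfl⟩, hc⟩

/-- The demand of the piece that starts at the copy of the root of `c`, if at least `K` terminals,
possibly dummy terminals, are visited in each visited component. -/
def pieceDemand (D : Decomposition T) (s : ℝ) (t : T.leaves → J) (K : ℕ) (p : J × D.Comp) : ℕ :=
  ∑ c ∈ D.visited (tourSet t p.1) with (D.hat s).IsAncestor (.inr p.2) (.inr c),
    max #(D.held t p.1 c) K

/-- Components that are moved to vertices of the same component, or to the root, lie on different
branches of the tree of reduced height. -/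
theorem sum_pieceDemand_le (t : T.leaves → J) (K : ℕ) {j : J} {F C : Finset D.Comp}
    (hF : ∀ c ∈ F, ∀ c' ∈ F, (D.hat s).IsAncestor (.inr c) (.inr c') → c = c')
    (hC : ∀ c ∈ F, ∀ c' ∈ D.visited (tourSet t j), (D.hat s).IsAncestor (.inr c) (.inr c') →
      c' ∈ C) :
    ∑ c ∈ F, pieceDemand D s t K (j, c) ≤ ∑ c ∈ C, max #(D.held t j c) K := by
  have hdisj : (F : Set D.Comp).PairwiseDisjoint fun c =>
      (D.visited (tourSet t j)).filter fun c' => (D.hat s).IsAncestor (.inr c) (.inr c') := by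
    intro c hc c' hc' hne
    simp only [Function.onFun]
    rw [Finset.disjoint_left]
    intro a ha ha'
    rcases (mem_filter.1 ha).2.total (mem_filter.1 ha').2 with h | h
    · exact hne (hF c hc c' hc' h)
    · exact hne (hF c' hc' c hc h).symm
  simp only [pieceDemand]
  rw [← sum_biUnion hdisj]
  refine sum_le_sum_of_subset fun c' hc' => ?_
  obtain ⟨c, hc, hc'⟩ := mem_biUnion.1 hc'
  exact hC c hc c' (mem_filter.1 hc').1 (mem_filter.1 hc').2

/-- Nothing is properly above a component that is moved to the root. -/
theorem eq_of_critical_eq_root {c c' : D.Comp} (hc' : D.critical s c' = T.root)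
    (h : (D.hat s).IsAncestor (.inr c) (.inr c')) : c = c' := by
  by_contra hne
  have h1 := h.parent_of_ne fun h => hne (Sum.inr_injective h)
  rw [hatParent_inr, hc'] at h1
  exact not_inr_isAncestor_inl_root c h1

theorem isAncestor_of_critical_mem {c m : D.Comp} (h : D.critical s m ∈ c.1) :
    (D.hat s).IsAncestor (.inr c) (.inr m) :=
  (inr_isAncestor_inl h).trans (isAncestor_parent _ _)

/-- Of two different components that are moved to vertices of `c`, none is above the other: the
upper one would be `c` itself or above `c`, while its class is larger than that of `c`. -/
theorem eq_of_critical_mem (hw : ∀ v, v ≠ T.root → 0 ≤ T.weight v) (hs : 0 < s)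
    {c m m' : D.Comp} (hm : D.critical s m ∈ c.1) (hm' : D.critical s m' ∈ c.1)
    (h : (D.hat s).IsAncestor (.inr m) (.inr m')) : m = m' := by
  by_contra hne
  have h1 := h.parent_of_ne fun h => hne (Sum.inr_injective h)
  rw [hatParent_inr, inr_isAncestor_inl_iff hm'] at h1
  have h2 := lvl_lt_of_critical_mem hw hs hm
  by_cases h3 : m = c
  · rw [h3] at h2
    exact lt_irrefl _ h2
  · exact absurd h2 (lvl_lt_of_isAncestor hw hs h1 h3).not_gt

/-- The subtours at each critical vertex can be rearranged, and dummy terminals can be added, such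
that only few demands occur at the children of that vertex. -/
theorem exists_rearranged_solution [Fintype J] {Γ : ℝ} {k K : ℕ} (hA : D.Admissible Γ k)
    (hw : ∀ v, v ≠ T.root → 0 ≤ T.weight v) (hs : 0 < s) (hroot : T.root ∉ T.leaves)
    (t : T.leaves → J) (hK : K ≤ k)
    (hcap : ∀ j, ∑ c with (D.held t j c).Nonempty, max #(D.held t j c) K ≤ k)
    {b : ℝ} (hb : 0 < b) (hb' : b ≤ 1 / 2) :
    ∃ (d : ℕ) (place : Fin d → V ⊕ D.Comp), (∀ i, place i ∉ (D.hat s).leaves) ∧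
      ∃ S : Solution (D.hat s) (D.hatLoc place) k,
        (∀ c : D.Comp, {i | ∃ x, S.visitor x = i ∧ ∃ v ∈ c.1,
          D.hatLoc place x = Sum.inl v}.ncard ≤ #{j | (D.held t j c).Nonempty}) ∧
        (∀ z ∈ Set.range (D.critical s), ∃ X : Finset ℕ, (#X : ℝ) ≤ 1 / b ∧
          (∀ m ∈ X, K ≤ m ∧ m ≤ k) ∧ ∀ u ∈ (D.hat s).children (Sum.inl z),
            ∀ i a b, RootedTree.IsSubtour (S.tour i) u a b → S.demandBetween i a b ∈ X) ∧
        S.cost ≤ 2 * (∑ j, (D.hat s).spanWeight (Sum.inl '' tourSet t j) +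
          4 * b * ∑ j, ∑ c ∈ D.traversed s (tourSet t j), T.dist (D.critical s c)) := by
  have hleaf_ne : ∀ x : T.leaves, (x : V) ≠ T.root := fun x h => hroot (h ▸ x.2)
  choose comp hcomp using fun x : T.leaves => exists_comp (D := D) (hleaf_ne x)
  set R := D.hat s with hR
  set dem := pieceDemand D s t K with hdem
  have hvis : ∀ j, ∑ c ∈ D.visited (tourSet t j), max #(D.held t j c) K ≤ k := fun j => by
    rw [visited_tourSet]
    exact hcap j
  -- the pieces `(j, c)` of the tours; those with the same critical vertex are rounded together
  set P : Finset (J × D.Comp) := univ.filter fun p => p.2 ∈ D.traversed s (tourSet t p.1) with hP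
  have hP' : ∀ p, p ∈ P ↔ p.2 ∈ D.traversed s (tourSet t p.1) := fun p => by simp [hP]
  have hdem_le : ∀ p ∈ P, dem p ≤ k := fun p _ =>
    (sum_le_sum_of_subset (filter_subset _ _)).trans (hvis p.1)
  have hle_dem : ∀ p ∈ P, K ≤ dem p := by
    intro p hp
    obtain ⟨c, hc, h⟩ := exists_visited ((hP' p).1 hp)
    exact (le_max_right _ _).trans (single_le_sum (f := fun c => max #(D.held t p.1 c) K)
      (fun _ _ => Nat.zero_le _) (mem_filter.2 ⟨hc, h⟩))
  obtain ⟨Q, σ, new, X, hQP, hnew, hnewQ, hσ, hσinj, hXcard, hnewX, hkX, hXle, hQsum⟩ :=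
    exists_rounded_demands_fiberwise P (fun p => D.critical s p.2) dem hdem_le hb hb'
  set par := forestParent D s Q σ with hpar
  -- the demand of the pieces that are continued by the tour `j` in a given part of the tree
  have hsum_new : ∀ j (Z : V → Prop) [DecidablePred Z],
      ∑ q ∈ P with q ∉ Q ∧ (σ q).1 = j ∧ Z (D.critical s q.2), new q ≤
         ∑ c ∈ D.traversed s (tourSet t j) with Z (D.critical s c), dem (j, c) := by
    intro j Z _
    set F := P.filter fun q => q ∉ Q ∧ (σ q).1 = j ∧ Z (D.critical s q.2) with hF
    have hF' : ∀ q ∈ F, q ∈ P ∧ q ∉ Q ∧ (σ q).1 = j ∧ Z (D.critical s q.2) := fun q hq =>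
      mem_filter.1 hq
    calc ∑ q ∈ F, new q ≤ ∑ q ∈ F, dem (σ q) := sum_le_sum fun q hq =>
          (hσ q (hF' q hq).1 (hF' q hq).2.1).2.2
      _ = ∑ r ∈ F.image σ, dem r := by
          rw [sum_image]
          intro q hq q' hq' h
          exact hσinj q (hF' q hq).1 (hF' q hq).2.1 q' (hF' q' hq').1 (hF' q' hq').2.1 h
      _ ≤ ∑ r ∈ ((D.traversed s (tourSet t j)).filter fun c => Z (D.critical s c)).image
            (Prod.mk j), dem r := by
          refine sum_le_sum_of_subset fun r hr => ?_
          obtain ⟨q, hq, rfl⟩ := mem_image.1 hr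
          obtain ⟨h1, h2, h3, h4⟩ := hF' q hq
          obtain ⟨h5, h6, -⟩ := hσ q h1 h2
          refine mem_image.2 ⟨(σ q).2, mem_filter.2 ⟨?_, ?_⟩, Prod.ext h3.symm rfl⟩
          · rw [← h3]
            exact (hP' _).1 h5
          · rw [h6]
            exact h4
      _ = _ := sum_image fun c _ c' _ h => congrArg Prod.snd h
  -- the pieces below `p` have been exchanged for smaller ones, so that the demand of `p` suffices
  -- for the terminals of its component and the rounded demands of the pieces that it continues
  have hchildren : ∀ p ∈ P,
      #(D.held t p.1 p.2) + ∑ q ∈ P with NextPiece s Q σ q p, new q ≤ new p := by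
    intro p hp
    refine le_trans ?_ (hnew p hp)
    have h1 : ∑ q ∈ P with NextPiece s Q σ q p, new q ≤
        ∑ c ∈ D.traversed s (tourSet t p.1) with D.critical s c ∈ p.2.1, dem (p.1, c) := by
      refine le_trans (le_of_eq ?_) (hsum_new p.1 fun z => z ∈ p.2.1)
      refine sum_congr (filter_congr fun q _ => ?_) fun _ _ => rfl
      simp only [NextPiece]
      exact and_congr_right fun _ => and_congr_left fun _ => eq_comm
    set C := ((D.visited (tourSet t p.1)).filter fun c => R.IsAncestor (.inr p.2) (.inr c))
    have h2 : ∑ c ∈ D.traversed s (tourSet t p.1) with D.critical s c ∈ p.2.1, dem (p.1, c) ≤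
        ∑ c ∈ C.erase p.2, max #(D.held t p.1 c) K := by
      refine sum_pieceDemand_le t K ?_ ?_
      · intro c hc c' hc' h
        exact eq_of_critical_mem hw hs (mem_filter.1 hc).2 (mem_filter.1 hc').2 h
      · intro c hc c' hc' h
        have h3 := (mem_filter.1 hc).2
        have h4 := isAncestor_of_critical_mem h3
        refine mem_erase.2 ⟨?_, mem_filter.2 ⟨hc', h4.trans h⟩⟩
        intro h0
        have h5 := lvl_lt_of_critical_mem hw hs h3
        have h6 : c = p.2 := Sum.inr_injective ((h0 ▸ h).antisymm h4)
        rw [h6] at h5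
        exact lt_irrefl _ h5
    have h3 : #(D.held t p.1 p.2) + ∑ c ∈ C.erase p.2, max #(D.held t p.1 c) K ≤
        ∑ c ∈ C, max #(D.held t p.1 c) K := by
      by_cases hmem : p.2 ∈ C
      · rw [← add_sum_erase C _ hmem]
        exact Nat.add_le_add_right (le_max_left _ _) _
      · rw [erase_eq_of_notMem hmem]
        have : D.held t p.1 p.2 = ∅ := by
          by_contra hne
          refine hmem (mem_filter.2 ⟨?_, isAncestor_refl _ _⟩)
          rw [visited_tourSet]
          simpa using nonempty_iff_ne_empty.2 hne
        rw [this, card_empty, zero_add]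
    exact (Nat.add_le_add_left (h1.trans h2) _).trans h3
  -- the dummy terminals
  set dum : J × D.Comp → ℕ := fun p =>
    new p - (#(D.held t p.1 p.2) + ∑ q ∈ P with NextPiece s Q σ q p, new q) with hdum
  set e := Fintype.equivFin (Σ p : {p // p ∈ P}, Fin (dum p)) with he
  set place : Fin (Fintype.card (Σ p : {p // p ∈ P}, Fin (dum p))) → V ⊕ D.Comp :=
    fun i => .inr (e.symm i).1.1.2 with hplace
  set pc : T.leaves ⊕ Fin (Fintype.card (Σ p : {p // p ∈ P}, Fin (dum p))) → J × D.Comp :=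
    Sum.elim (fun x => (t x, comp x)) (fun i => (e.symm i).1.1) with hpc
  set node : T.leaves ⊕ Fin (Fintype.card (Σ p : {p // p ∈ P}, Fin (dum p))) →
      (J ⊕ J × D.Comp) × (V ⊕ D.Comp) :=
    Sum.elim (fun x => (.inl (t x), .inl x)) (fun i => pieceNode (e.symm i).1.1) with hnode
  have hpcP : ∀ x, pc x ∈ P := by
    rintro (x | i)
    · exact (hP' _).2 (mem_traversed_of_mem_visited
        (mem_visited.2 ⟨x, mem_tourSet t x, hcomp x⟩))
    · exact (e.symm i).1.2
  have hbelow : ∀ p x, Below par (pieceNode p) (node x) ↔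
      Below par (pieceNode p) (pieceNode (pc x)) := by
    rintro p (x | i)
    · exact below_pieceNode_inl_iff (hcomp x)
    · rfl
  have hcard_pc : ∀ p ∈ P, #{x | pc x = p} = #(D.held t p.1 p.2) + dum p := by
    intro p hp
    rw [card_filter, Fintype.sum_sum_type]
    congr 1
    · rw [← card_filter]
      congr 1
      ext x
      simp only [mem_filter, mem_univ, true_and, mem_held, hpc, Sum.elim_inl, Prod.ext_iff]
      exact and_congr_right fun _ => ⟨fun h => h ▸ hcomp x, fun h => comp_eq_of_mem (hcomp x) h⟩
    · simp only [hpc, Sum.elim_inr]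
      have h1 : ∀ q : {p // p ∈ P}, ∑ _i : Fin (dum q), (if (q : J × D.Comp) = p then 1 else 0) =
          if (q : J × D.Comp) = p then dum q else 0 := by
        intro q
        split_ifs <;> simp
      rw [e.symm.sum_comp (fun y => if (y.1 : J × D.Comp) = p then 1 else 0), Fintype.sum_sigma]
      refine (sum_congr rfl fun q _ => h1 q).trans ?_
      refine (Finset.sum_coe_sort P (fun q => if q = p then dum q else 0)).trans ?_
      rw [sum_ite_eq' P p, if_pos hp]
  -- the dummy terminals fill each piece up to its rounded demand
  have hload : ∀ p ∈ P, {x | Below par (pieceNode p) (node x)}.ncard = new p := by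
    intro p hp
    rw [show {x | Below par (pieceNode p) (node x)} =
      ((univ.filter fun x => Below par (pieceNode p) (pieceNode (pc x)) : Finset _) : Set _) by
        ext x; simp [hbelow], Set.ncard_coe_finset]
    refine card_below_eq P (NextPiece s Q σ) (fun p q => Below par (pieceNode p) (pieceNode q))
      ?_ ?_ (fun p q => below_pieceNode_iff) (fun p => D.lvl s p.2)
      (fun q p h => lvl_lt_of_critical_mem hw hs h.2.2) pc hpcP new ?_ hp
    · rintro q p p' ⟨-, h1, h2⟩ ⟨-, h3, h4⟩
      exact Prod.ext (h1.trans h3.symm) (comp_eq_of_mem h2 h4)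
    · rintro q hq p ⟨h1, h2, h3⟩
      obtain ⟨h4, h5, -⟩ := hσ q hq h1
      rw [← h5] at h3
      rw [hP', h2]
      exact mem_traversed_of_isAncestor ((hP' _).1 h4) (isAncestor_of_critical_mem h3)
    · intro p hp
      have h1 : #(D.held t p.1 p.2) + dum p + ∑ q ∈ P with NextPiece s Q σ q p, new q =
          new p := by
        have := hchildren p hp
        simp only [hdum]
        omega
      refine Eq.trans ?_ h1
      congr 1
      convert hcard_pc p hp
  -- the nodes of the forest
  set U : J ⊕ J × D.Comp → Set (V ⊕ D.Comp) := Sum.elim (fun j => Sum.inl '' tourSet t j)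
    (fun p => {y | p ∈ Q ∧ y = .inl (D.critical s p.2)}) with hU
  set N : Finset ((J ⊕ J × D.Comp) × (V ⊕ D.Comp)) :=
    univ.filter fun n => n.2 = R.root ∨ n.2 ∈ R.span (U n.1) with hN
  have hN' : ∀ n, n ∈ N ↔ n.2 = R.root ∨ ∃ y ∈ U n.1, R.IsAncestor n.2 y := by
    intro n
    simp only [hN, mem_filter, mem_univ, true_and, mem_span]
    tauto
  have hpiece : ∀ p, pieceNode p ∈ N ↔ p ∈ P := by
    intro p
    rw [hN', hP', mem_traversed]
    simp only [pieceNode, hU, Sum.elim_inl, Set.exists_mem_image]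
    exact or_iff_right Sum.inr_ne_inl
  have hparN : ∀ n ∈ N, par n ∈ N := by
    intro n hn
    by_cases hn0 : n.2 = R.root
    · rw [hpar, forestParent_of_snd_eq_root hn0]
      exact hn
    · obtain ⟨y, hy, hny⟩ := ((hN' n).1 hn).resolve_left hn0
      rw [hN']
      right
      obtain ⟨κ | p, v | c⟩ := n
      · exact ⟨y, hy, (isAncestor_parent _ _).trans hny⟩
      · have hcP : (κ, c) ∈ P := (hpiece _).1 hn
        change ∃ y ∈ U (par (pieceNode (κ, c))).1, R.IsAncestor (par (pieceNode (κ, c))).2 y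
        by_cases hQ : (κ, c) ∈ Q
        · rw [hpar, forestParent_of_mem hQ]
          exact ⟨_, ⟨hQ, rfl⟩, isAncestor_refl _ _⟩
        · rw [hpar, forestParent_of_notMem hQ]
          obtain ⟨h1, h2, -⟩ := hσ _ hcP hQ
          obtain ⟨x, hx, h3⟩ := mem_traversed.1 ((hP' _).1 h1)
          refine ⟨_, Set.mem_image_of_mem _ hx, ?_⟩
          rw [← h2]
          exact (isAncestor_parent R (.inr (σ (κ, c)).2)).trans h3
      all_goals
        rw [hpar, forestParent_inr]
        exact ⟨y, hy, (isAncestor_parent _ _).trans hny⟩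
  have hnodeN : ∀ x, node x ∈ N := by
    rintro (x | i)
    · rw [hN']
      exact Or.inr ⟨.inl x, Set.mem_image_of_mem _ (mem_tourSet t x), isAncestor_refl _ _⟩
    · exact (hpiece _).2 (e.symm i).1.2
  have hnode_inl : ∀ x, ∃ j, (node x).1 = .inl j := by
    rintro (x | i)
    · exact ⟨_, rfl⟩
    · exact ⟨_, rfl⟩
  have hnode_ne : ∀ x, (node x).2 ≠ R.root := by
    rintro (x | i)
    · exact fun h => hleaf_ne x (Sum.inl_injective h)
    · exact Sum.inr_ne_inl
  -- detached pieces have demand `k`, and so have their subtours at all vertices on the way to them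
  have hdetour : ∀ p ∈ Q, ∀ y, R.IsAncestor y (.inl (D.critical s p.2)) →
      {x | Below par (.inr p, y) (node x)}.ncard = k := by
    intro p hp y hy
    rw [← hnewQ p hp, ← hload p (hQP hp)]
    congr 1
    ext x
    obtain ⟨j, hj⟩ := hnode_inl x
    exact (below_detour_iff hj).trans ⟨fun h => h.2.2, fun h => ⟨hp, hy, h⟩⟩
  -- the capacity: what is below the root of the `j`-th tour is below pieces that replace smaller
  -- pieces of this tour, and these have total demand at most `k`
  have hcapN : ∀ r ∈ N, r.2 = R.root → {x | Below par r (node x)}.ncard ≤ k := by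
    rintro ⟨κ, y⟩ hr hy
    simp only at hy
    subst hy
    rcases κ with j | p
    · set F := P.filter fun q => q ∉ Q ∧ (σ q).1 = j ∧ D.critical s q.2 = T.root with hF
      have hsub : {x | Below par (.inl j, R.root) (node x)} ⊆
          ((F.biUnion fun q => univ.filter fun x => Below par (pieceNode q) (node x) :
            Finset _) : Set _) := by
        intro x hx
        obtain ⟨q, h1, h2, h3, h4⟩ := exists_piece_of_below_root hx (hnode_ne x)
        simp only [coe_biUnion, Set.mem_iUnion, coe_filter, mem_univ, true_and]
        exact ⟨q, mem_filter.2 ⟨(hpiece q).1 (h4.mem hparN (hnodeN x)), h1, h2, h3⟩, h4⟩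
      refine (Set.ncard_le_ncard hsub (Finset.finite_toSet _)).trans ?_
      rw [Set.ncard_coe_finset]
      refine card_biUnion_le.trans ?_
      calc ∑ q ∈ F, #{x | Below par (pieceNode q) (node x)} = ∑ q ∈ F, new q := by
            refine sum_congr rfl fun q hq => ?_
            rw [← hload q (mem_filter.1 hq).1, ← Set.ncard_coe_finset]
            congr 1
            ext x
            simp
        _ ≤ ∑ c ∈ D.traversed s (tourSet t j) with D.critical s c = T.root, dem (j, c) :=
            hsum_new j fun z => z = T.root
        _ ≤ ∑ c ∈ D.visited (tourSet t j), max #(D.held t j c) K :=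
            sum_pieceDemand_le t K
              (fun c _ c' hc' h => eq_of_critical_eq_root (mem_filter.1 hc').2 h)
              fun c _ c' hc' _ => hc'
        _ ≤ k := hvis j
    · by_cases hp : p ∈ Q
      · exact (hdetour p hp _ (isAncestor_root _ _)).le
      · rw [show {x | Below par (.inr p, R.root) (node x)} = ∅ from ?_]
        · simp
        · refine Set.eq_empty_of_forall_notMem fun x hx => ?_
          obtain ⟨j, hj⟩ := hnode_inl x
          exact hp ((below_detour_iff hj).1 hx).1
  obtain ⟨S, hcost, hvisitor, hsub⟩ := exists_solution_of_forest (T := R) (φ := Prod.snd)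
    (par := par) N hparN (fun n _ => rfl) (fun n _ hn => forestParent_of_snd_eq_root hn)
    (loc := D.hatLoc place) (k := k) node hnodeN (by rintro (x | i) <;> rfl) hcapN
  refine ⟨_, place, fun i => inr_notMem_leaves_hat _, S, ?_, ?_, ?_⟩
  · intro c
    -- the terminals that a tour holds in `c` belong to the same piece, and so to the same new tour
    have hrep : ∀ j, (D.held t j c).Nonempty → ∃ i, ∀ x ∈ D.held t j c,
        S.visitor (.inl x) = i := by
      rintro j ⟨x₀, hx₀⟩
      refine ⟨S.visitor (.inl x₀), fun x hx => hvisitor _ _ ?_⟩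
      have hφ : ∀ i n, (par^[i] n).2 = R.parent^[i] n.2 := by
        intro i n
        induction i with
        | zero => rfl
        | succ i ih =>
          rw [Function.iterate_succ_apply', Function.iterate_succ_apply', ← ih]
          rfl
      have hmem : ∀ x ∈ D.held t j c, Below par (pieceNode (j, c)) (node (.inl x)) := by
        intro x hx
        obtain ⟨h1, h2⟩ := mem_held.1 hx
        have h3 : pc (.inl x) = (j, c) := Prod.ext h1 (comp_eq_of_mem (hcomp x) h2)
        rw [hbelow, h3]
        exact Below.refl _
      refine ⟨par^[R.depth (.inr c)] (pieceNode (j, c)), ?_, ?_, ?_, ?_⟩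
      · exact Below.mem hparN ⟨_, rfl⟩ ((hmem x hx).mem hparN (hnodeN _))
      · rw [hφ]
        exact R.depth_spec _
      · exact Below.trans ⟨_, rfl⟩ (hmem x hx)
      · exact Below.trans ⟨_, rfl⟩ (hmem x₀ hx₀)
    have : Nonempty (Fin S.numTours) := by
      obtain ⟨x, hx, -⟩ := T.exists_leaf T.root
      exact ⟨S.visitor (.inl ⟨x, hx⟩)⟩
    choose! rep hrep using hrep
    have hsubset : {i | ∃ x, S.visitor x = i ∧ ∃ v ∈ c.1, D.hatLoc place x = Sum.inl v} ⊆
        (((univ.filter fun j => (D.held t j c).Nonempty).image rep : Finset _) : Set _) := by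
      rintro i ⟨x | x, hx, v, hv, hloc⟩
      · have hxv : (x : V) = v := Sum.inl_injective hloc
        have h1 : x ∈ D.held t (t x) c := mem_held.2 ⟨rfl, hxv ▸ hv⟩
        refine mem_coe.2 (mem_image.2 ⟨t x, ?_, ?_⟩)
        · simpa using ⟨x, h1⟩
        · rw [← hx, hrep _ ⟨x, h1⟩ x h1]
      · exact absurd hloc Sum.inr_ne_inl
    refine (Set.ncard_le_ncard hsubset (Finset.finite_toSet _)).trans ?_
    rw [Set.ncard_coe_finset]
    exact card_image_le
  · intro z hz
    refine ⟨X z, hXcard z, ?_, ?_⟩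
    · intro m hm
      rcases hXle z m hm with rfl | ⟨h1, p, hp, h2⟩
      · exact ⟨hK, le_rfl⟩
      · exact ⟨(hle_dem p hp).trans h2, h1⟩
    · intro u hu i a b hsubtour
      obtain ⟨c, rfl, rfl⟩ := hA.exists_of_mem_children hz hu
      obtain ⟨⟨κ, y⟩, hn, hy, hdemand⟩ := hsub _ Sum.inr_ne_inl i a b hsubtour
      simp only at hy
      subst hy
      rw [hdemand]
      rcases κ with j | p
      · have hjP : (j, c) ∈ P := (hpiece _).1 hn
        have h1 := hload (j, c) hjP
        simp only [pieceNode] at h1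
        rw [h1]
        exact hnewX (j, c) hjP
      · obtain ⟨y, ⟨hp, rfl⟩, h1⟩ := ((hN' _).1 hn).resolve_left Sum.inr_ne_inl
        rw [hdetour p hp _ h1]
        exact hkX _
  · have h1 : ∑ n ∈ N with n.2 ≠ R.root, R.weight n.2 = ∑ κ, R.spanWeight (U κ) := by
      have h2 : N.filter (fun n => n.2 ≠ R.root) =
          univ.filter fun n : (J ⊕ J × D.Comp) × (V ⊕ D.Comp) => n.2 ∈ R.span (U n.1) := by
        ext n
        simp only [hN, mem_filter, mem_univ, true_and]
        constructor
        · rintro ⟨h3 | h3, h4⟩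
          · exact absurd h3 h4
          · exact h3
        · exact fun h3 => ⟨Or.inr h3, (mem_span.1 h3).1⟩
      rw [h2, sum_filter, Fintype.sum_prod_type]
      refine sum_congr rfl fun κ _ => ?_
      rw [spanWeight, ← sum_filter]
      exact sum_congr (by ext y; simp) fun _ _ => rfl
    -- a tour of its own for a detached piece costs twice the way to its critical vertex
    have h2 : ∑ p, R.spanWeight (U (.inr p)) = ∑ p ∈ Q, T.dist (D.critical s p.2) := by
      rw [← sum_subset (subset_univ Q) fun p _ hp => ?_]
      · refine sum_congr rfl fun p hp => ?_
        have h3 : U (.inr p) = {.inl (D.critical s p.2)} := by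
          ext y
          simp [hU, hp]
        rw [h3, ← dist_eq_spanWeight, hR, dist_hat]
        rfl
      · rw [spanWeight, sum_eq_zero]
        intro y hy
        obtain ⟨-, y', ⟨h3, -⟩, -⟩ := mem_span.1 hy
        exact absurd h3 hp
    have h3 := hQsum T.dist (dist_nonneg hw)
    have h4 : ∑ p ∈ P, T.dist (D.critical s p.2) =
        ∑ j, ∑ c ∈ D.traversed s (tourSet t j), T.dist (D.critical s c) := by
      rw [hP, sum_filter, Fintype.sum_prod_type]
      refine sum_congr rfl fun j _ => ?_
      rw [← sum_filter]
      exact sum_congr (by ext y; simp) fun _ _ => rfl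
    rw [h4] at h3
    have h5 : S.cost = 2 * ∑ κ, R.spanWeight (U κ) := hcost.trans (by rw [← h1]; congr!)
    rw [h5, Fintype.sum_sum_type, h2]
    refine mul_le_mul_of_nonneg_left (add_le_add le_rfl h3) zero_le_two

end Rearrange

/-! ### The constants -/

section Constants

variable {ε : ℝ}

theorem alpha_pos (hε : 0 < ε) : 0 < alpha ε := Real.rpow_pos_of_pos hε _

theorem beta_pos (hε : 0 < ε) : 0 < beta ε := mul_pos (by norm_num) (Real.rpow_pos_of_pos hε _)

theorem Gam_pos (hε : 0 < ε) : 0 < Gam ε := div_pos (by norm_num) hε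

theorem four_le_one_div (hε : 0 < ε) (hε' : ε ≤ 1 / 4) : 4 ≤ 1 / ε := by
  rw [le_div_iff₀ hε]
  linarith

/-- A power of `ε` with a large exponent is much smaller than `ε`. -/
theorem rpow_le_div_sixteen (hε : 0 < ε) (hε' : ε ≤ 1 / 4) {y : ℝ} (hy : 3 ≤ y) :
    ε ^ y ≤ ε / 16 := by
  have h1 : ε ^ y ≤ ε ^ (3 : ℝ) :=
    Real.rpow_le_rpow_of_exponent_ge hε (by linarith) hy
  have h2 : ε ^ (3 : ℝ) = ε * (ε * ε) := by
    rw [show (3 : ℝ) = ((3 : ℕ) : ℝ) by norm_num, Real.rpow_natCast]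
    ring
  have h3 : ε * ε ≤ 1 / 4 * (1 / 4) := mul_le_mul hε' hε' hε.le (by norm_num)
  have h4 : ε * (ε * ε) ≤ ε * (1 / 4 * (1 / 4)) := mul_le_mul_of_nonneg_left h3 hε.le
  exact h1.trans (h2.le.trans (h4.trans (by linarith)))

theorem four_mul_alpha_le_one (hε : 0 < ε) (hε' : ε ≤ 1 / 4) : 4 * alpha ε ≤ 1 := by
  have := rpow_le_div_sixteen hε hε' (y := 1 / ε + 1) (by linarith [four_le_one_div hε hε'])
  unfold alpha
  linarith

theorem beta_le_half (hε : 0 < ε) (hε' : ε ≤ 1 / 4) : beta ε ≤ 1 / 2 := by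
  have h1 := four_le_one_div hε hε'
  have h2 : 4 / ε = 4 * (1 / ε) := by ring
  have := rpow_le_div_sixteen hε hε' (y := 4 / ε + 1) (by linarith)
  unfold beta
  linarith

theorem one_div_rpow_eq (hε : 0 < ε) (y : ℝ) : (1 / ε) ^ y = ε ^ (-y) := by
  rw [one_div, Real.inv_rpow hε.le, Real.rpow_neg hε.le]

theorem alpha_mul_one_div_rpow (hε : 0 < ε) :
    alpha ε * (1 / ε) ^ (1 / ε - 1) = ε ^ 2 := by
  rw [alpha, one_div_rpow_eq hε, ← Real.rpow_add hε,
    show 1 / ε + 1 + -(1 / ε - 1) = ((2 : ℕ) : ℝ) by push_cast; ring, Real.rpow_natCast]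

/-- The factor by which the cost increases when the number of tours per component is reduced. -/
theorem local_factor_le (hε : 0 < ε) (hε' : ε ≤ 1 / 4) {M m : ℝ} (hm : 0 < m)
    (hM : M ≤ (1 / ε) ^ (1 / ε - 1) * m) :
    1 + (1 + 4 * alpha ε) * (4 / Gam ε) + 4 * alpha ε * M / m ≤ 1 + 5 / 3 * ε := by
  have hα := alpha_pos hε
  have h1 : 4 * alpha ε * M / m ≤ ε := by
    rw [div_le_iff₀ hm]
    calc 4 * alpha ε * M ≤ 4 * alpha ε * ((1 / ε) ^ (1 / ε - 1) * m) := by gcongr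
      _ = 4 * (alpha ε * (1 / ε) ^ (1 / ε - 1)) * m := by ring
      _ = 4 * ε * ε * m := by rw [alpha_mul_one_div_rpow hε]; ring
      _ ≤ 1 * ε * m := by gcongr; linarith
      _ = ε * m := by ring
  have h2 : 4 / Gam ε = ε / 3 := by
    rw [Gam]
    field_simp
    norm_num
  have h3 : 4 * alpha ε * (ε / 3) ≤ 1 * (ε / 3) :=
    mul_le_mul_of_nonneg_right (four_mul_alpha_le_one hε hε') (by positivity)
  rw [h2]
  linarith

/-- The factor by which the cost increases when the height is reduced and the demands are
rounded. -/
theorem rounding_factor_le (hε : 0 < ε) (hε' : ε ≤ 1 / 4) {M m : ℝ} (hm : 0 < m)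
    (hM : M ≤ (1 / ε) ^ (1 / ε - 1) * m) :
    1 + alpha ε * ε * m / (alpha ε * m) +
      4 * beta ε / alpha ε * (M / (alpha ε * ε * m) + 1) ≤ 1 + 9 / 8 * ε := by
  have hα := alpha_pos hε
  have h4 := four_le_one_div hε hε'
  have h1 : alpha ε * ε * m / (alpha ε * m) = ε := by field_simp
  have h2 : 4 * beta ε / alpha ε = ε ^ (3 / ε) := by
    rw [div_eq_iff hα.ne', beta, alpha, ← Real.rpow_add hε,
      show 3 / ε + (1 / ε + 1) = 4 / ε + 1 by ring]
    ring
  have h3 : M / (alpha ε * ε * m) ≤ ε ^ (-(2 / ε) - 1) := by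
    rw [div_le_iff₀ (by positivity)]
    refine hM.trans (le_of_eq ?_)
    rw [one_div_rpow_eq hε, alpha]
    calc ε ^ (-(1 / ε - 1)) * m = ε ^ (-(2 / ε) - 1 + (1 / ε + 1) + 1) * m := by
          congr 2
          ring
      _ = _ := by
          rw [Real.rpow_add hε, Real.rpow_add hε, Real.rpow_one]
          ring
  have h5 : ε ^ (3 / ε) * ε ^ (-(2 / ε) - 1) = ε ^ (1 / ε - 1) := by
    rw [← Real.rpow_add hε]
    congr 1
    ring
  have h6 := rpow_le_div_sixteen hε hε' (y := 1 / ε - 1) (by linarith)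
  have h7 := rpow_le_div_sixteen hε hε' (y := 3 / ε)
    (by rw [show 3 / ε = 3 * (1 / ε) by ring]; linarith)
  have h8 : ε ^ (3 / ε) * (M / (alpha ε * ε * m)) ≤ ε ^ (3 / ε) * ε ^ (-(2 / ε) - 1) :=
    mul_le_mul_of_nonneg_left h3 (Real.rpow_pos_of_pos hε _).le
  rw [h1, h2, mul_add, mul_one]
  linarith

end Constants

/-! ### Solutions and their tours -/

section Solutions

variable {V : Type*} [Fintype V] {T : RootedTree V}

/-- The lower bound for the cost of a solution, to which all other costs are compared. -/
theorem two_mul_totalSpan_le_cost (hw : ∀ v, v ≠ T.root → 0 ≤ T.weight v) {k : ℕ}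
    (S : Solution T (fun x : T.leaves => (x : V)) k) :
    2 * totalSpan S.visitor ≤ S.cost := by
  rw [totalSpan, mul_sum, Solution.cost]
  refine sum_le_sum fun i _ => two_mul_spanWeight_le_walkCost hw _ ?_
  rintro _ ⟨x, rfl, rfl⟩
  have := (S.tour (S.visitor x)).getVert_mem_support (S.time x)
  rwa [S.getVert_time] at this

/-- The solution in which each terminal has its own tour. -/
theorem nonempty_solution {k : ℕ} (hk : 1 ≤ k) :
    Nonempty (Solution T (fun x : T.leaves => (x : V)) k) := by
  have hcap : ∀ r ∈ (univ : Finset (T.leaves × V)), r.2 = T.root →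
      {x : T.leaves | Below (fun n : T.leaves × V => (n.1, T.parent n.2)) r
        (x, (x : V))}.ncard ≤ k := by
    rintro ⟨y, v⟩ - -
    refine le_trans ?_ hk
    have hsub : {x : T.leaves | Below (fun n : T.leaves × V => (n.1, T.parent n.2)) (y, v)
        (x, (x : V))} ⊆ {y} := by
      rintro x ⟨i, hi⟩
      have key : ∀ i, ((fun n : T.leaves × V => (n.1, T.parent n.2))^[i] (x, (x : V))).1 = x := by
        intro i
        induction i with
        | zero => rfl
        | succ i ih =>
          rw [Function.iterate_succ_apply']
          exact ih
      rw [← key i, hi]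
      rfl
    exact (Set.ncard_le_ncard hsub (Set.finite_singleton y)).trans (Set.ncard_singleton y).le
  obtain ⟨S, -⟩ := exists_solution_of_forest (T := T) (φ := Prod.snd)
    (par := fun n : T.leaves × V => (n.1, T.parent n.2)) univ (fun _ _ => mem_univ _)
    (fun _ _ => rfl) (fun n _ h => Prod.ext rfl (by simp only [h, T.parent_root]))
    (loc := fun x : T.leaves => (x : V)) (k := k) (fun x => (x, (x : V))) (fun _ => mem_univ _)
    (fun _ => rfl) hcap
  exact ⟨S⟩

theorem Dmin_le_dist {x : V} (hx : x ∈ T.leaves) : T.Dmin ≤ T.dist x :=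
  csInf_le (Set.toFinite _).bddBelow (Set.mem_image_of_mem _ hx)

theorem dist_le_Dmax {x : V} (hx : x ∈ T.leaves) : T.dist x ≤ T.Dmax :=
  le_csSup (Set.toFinite _).bddAbove (Set.mem_image_of_mem _ hx)

/-- The strict inequality for the distances excludes terminals at distance `0`. -/
theorem Dmin_pos (hw : ∀ v, v ≠ T.root → 0 ≤ T.weight v) {ε : ℝ} (h : T.BoundedDistances ε) :
    0 < T.Dmin := by
  obtain ⟨x, hx, -⟩ := T.exists_leaf T.root
  have h0 : 0 ≤ T.Dmin := le_csInf ⟨_, Set.mem_image_of_mem _ hx⟩ (by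
    rintro _ ⟨y, -, rfl⟩
    exact dist_nonneg hw y)
  refine lt_of_le_of_ne h0 fun h1 => ?_
  rw [BoundedDistances, ← h1, mul_zero] at h
  linarith [dist_le_Dmax hx, dist_nonneg hw x]

theorem root_notMem_leaves (h : 0 < T.Dmin) : T.root ∉ T.leaves := fun h1 => by
  have := Dmin_le_dist h1
  rw [dist_root] at this
  linarith

theorem Dmin_le_totalSpan (hw : ∀ v, v ≠ T.root → 0 ≤ T.weight v) {I : Type*} [Fintype I]
    (t : T.leaves → I) : T.Dmin ≤ totalSpan t := by
  obtain ⟨x, hx, -⟩ := T.exists_leaf T.root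
  refine (Dmin_le_dist hx).trans ?_
  refine (dist_le_spanWeight hw (mem_tourSet t ⟨x, hx⟩) (T.isAncestor_refl _)).trans ?_
  exact single_le_sum (f := fun i => T.spanWeight (tourSet t i))
    (fun i _ => spanWeight_nonneg hw _) (mem_univ (t ⟨x, hx⟩))

/-- There are solutions whose cost exceeds the optimum by less than any given factor. The optimum is
an infimum over an infinite set, and no attaining solution is needed. -/
theorem exists_solution_mul_cost_lt (hw : ∀ v, v ≠ T.root → 0 ≤ T.weight v) {k : ℕ} (hk : 1 ≤ k)
    (hD : 0 < T.Dmin) {a b : ℝ} (ha : 0 < a) (hab : a < b) :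
    ∃ S : Solution T (fun x : T.leaves => (x : V)) k, a * S.cost < b * opt T k := by
  have := nonempty_solution (T := T) hk
  have hpos : 0 < opt T k := by
    have h1 : 2 * T.Dmin ≤ opt T k := le_ciInf fun S => by
      have := two_mul_totalSpan_le_cost hw S
      have := Dmin_le_totalSpan hw S.visitor
      linarith
    linarith
  have h2 : opt T k < b * opt T k / a := by
    rw [lt_div_iff₀ ha, mul_comm]
    exact mul_lt_mul_of_pos_right hab hpos
  obtain ⟨S, hS⟩ := exists_lt_of_ciInf_lt h2
  refine ⟨S, ?_⟩
  rw [lt_div_iff₀ ha] at hS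
  linarith

end Solutions

section Reduction

open Decomposition

variable {V : Type*} [Fintype V] [DecidableEq V] {T : RootedTree V} {D : Decomposition T}
  {J : Type*}

/-- The total cost after the reduction of the height, including the tours of detached pieces. -/
theorem sum_spanWeight_hat_le [Fintype J] (hw : ∀ v, v ≠ T.root → 0 ≤ T.weight v) {s : ℝ}
    (hs : 0 < s) {k : ℕ} (hk : 1 ≤ k) {α b M m : ℝ} (hα : 0 < α) (hb : 0 ≤ b) (hm : 0 < m)
    (hM : ∀ x ∈ T.leaves, T.dist x ≤ M) (hM0 : 0 ≤ M) (hm' : ∀ x ∈ T.leaves, m ≤ T.dist x)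
    (t : T.leaves → J)
    (hcap : ∀ j, ∑ c with (D.held t j c).Nonempty, max #(D.held t j c) ⌈α * k⌉₊ ≤ k) :
    ∑ j, (D.hat s).spanWeight (Sum.inl '' tourSet t j) +
      4 * b * ∑ j, ∑ c ∈ D.traversed s (tourSet t j), T.dist (D.critical s c) ≤
      (1 + s / (α * m) + 4 * b / α * (M / s + 1)) * totalSpan t := by
  have hk0 : (0 : ℝ) < k := by exact_mod_cast hk
  -- a tour has to visit at least `α k` terminals in each component
  have hvis : ∀ j, (#(D.visited (tourSet t j)) : ℝ) ≤ 1 / α := by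
    intro j
    have h1 : #(D.visited (tourSet t j)) * ⌈α * k⌉₊ ≤ k := by
      refine le_trans ?_ (hcap j)
      rw [visited_tourSet, ← smul_eq_mul]
      exact card_nsmul_le_sum _ _ _ fun c _ => le_max_right _ _
    have h2 : (#(D.visited (tourSet t j)) : ℝ) * (α * k) ≤ k := by
      calc (#(D.visited (tourSet t j)) : ℝ) * (α * k) ≤ #(D.visited (tourSet t j)) * ⌈α * k⌉₊ := by
            gcongr
            exact Nat.le_ceil _
        _ ≤ k := by exact_mod_cast h1
    rw [le_div_iff₀ hα]
    refine le_of_mul_le_mul_right ?_ hk0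
    linarith
  have hspan : ∀ j, (#(D.visited (tourSet t j)) : ℝ) ≤
      1 / (α * m) * T.spanWeight (tourSet t j) := by
    intro j
    rcases (D.visited (tourSet t j)).eq_empty_or_nonempty with h | ⟨c, hc⟩
    · rw [h]
      have := spanWeight_nonneg hw (tourSet t j)
      simp only [card_empty, Nat.cast_zero]
      positivity
    · obtain ⟨x, hx, -⟩ := mem_visited.1 hc
      obtain ⟨x', -, rfl⟩ := id hx
      have h1 : m ≤ T.spanWeight (tourSet t j) :=
        (hm' x' x'.2).trans (dist_le_spanWeight hw hx (T.isAncestor_refl _))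
      calc (#(D.visited (tourSet t j)) : ℝ) ≤ 1 / α := hvis j
        _ = 1 / (α * m) * m := by field_simp
        _ ≤ _ := by gcongr
  have h1 : ∑ j, (D.hat s).spanWeight (Sum.inl '' tourSet t j) ≤
      (1 + s / (α * m)) * totalSpan t := by
    rw [totalSpan, mul_sum]
    refine sum_le_sum fun j _ => (spanWeight_hat_le hw hs _).trans ?_
    have := mul_le_mul_of_nonneg_right (hspan j) hs.le
    calc T.spanWeight (tourSet t j) + #(D.visited (tourSet t j)) * s ≤
          T.spanWeight (tourSet t j) + 1 / (α * m) * T.spanWeight (tourSet t j) * s := by gcongr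
      _ = _ := by ring
  -- each critical vertex of a tour is closer to the depot than some terminal of the tour
  have h2 : ∑ j, ∑ c ∈ D.traversed s (tourSet t j), T.dist (D.critical s c) ≤
      1 / α * (M / s + 1) * totalSpan t := by
    rw [totalSpan, mul_sum]
    refine sum_le_sum fun j _ => ?_
    have hleaf : ∀ x ∈ tourSet t j, T.dist x ≤ M := by
      rintro _ ⟨x, -, rfl⟩
      exact hM x x.2
    have h0 := spanWeight_nonneg hw (tourSet t j)
    calc ∑ c ∈ D.traversed s (tourSet t j), T.dist (D.critical s c)
        ≤ #(D.traversed s (tourSet t j)) • T.spanWeight (tourSet t j) := by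
          refine sum_le_card_nsmul _ _ _ fun c hc => ?_
          obtain ⟨x, hx, h⟩ := mem_traversed.1 hc
          exact dist_le_spanWeight hw hx
            ((critical_isAncestor_top c).trans (shadow_isAncestor h))
      _ = #(D.traversed s (tourSet t j)) * T.spanWeight (tourSet t j) := nsmul_eq_mul _ _
      _ ≤ #(D.visited (tourSet t j)) * (M / s + 1) * T.spanWeight (tourSet t j) := by
          gcongr
          exact card_traversed_le hw hs hleaf hM0
      _ ≤ 1 / α * (M / s + 1) * T.spanWeight (tourSet t j) := by
          gcongr
          exact hvis j
  have h3 := mul_le_mul_of_nonneg_left h2 (show 0 ≤ 4 * b by positivity)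
  calc _ ≤ (1 + s / (α * m)) * totalSpan t + 4 * b * (1 / α * (M / s + 1) * totalSpan t) :=
        add_le_add h1 h3
    _ = _ := by ring

/-- Each component decomposition admits a structured solution of almost optimal cost: starting from
an almost optimal solution, the number of tours in each component is reduced, and then the resulting
distribution of the terminals is realized in the tree of reduced height with rounded demands. -/
theorem exists_structured_solution (hw : ∀ v, v ≠ T.root → 0 ≤ T.weight v) {k : ℕ} (hk : 1 ≤ k)
    {ε : ℝ} (hε : 0 < ε) (hε' : ε ≤ 1 / 4) (hdist : T.BoundedDistances ε)
    (hA : D.Admissible (Gam ε) k) :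
    ∃ (d : ℕ) (place : Fin d → V ⊕ D.Comp),
      (∀ j, place j ∉ (D.hat (step T ε)).leaves) ∧
      ∃ S : Solution (D.hat (step T ε)) (D.hatLoc place) k,
        (∀ c : D.Comp,
          ({i | ∃ x, S.visitor x = i ∧ ∃ v ∈ c.1, D.hatLoc place x = Sum.inl v}.ncard : ℝ) ≤
            2 * Gam ε / alpha ε + 1) ∧
        (∀ z ∈ Set.range (D.critical (step T ε)),
          ∃ X : Finset ℕ, (X.card : ℝ) ≤ 1 / beta ε ∧
            (∀ m ∈ X, alpha ε * k ≤ m ∧ m ≤ k) ∧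
            ∀ u ∈ (D.hat (step T ε)).children (Sum.inl z),
              ∀ i a b, RootedTree.IsSubtour (S.tour i) u a b →
                S.demandBetween i a b ∈ X) ∧
        S.cost < (1 + 4 * ε) * opt T k := by
  have hm := Dmin_pos hw hdist
  have hroot := root_notMem_leaves hm
  have hα := alpha_pos hε
  have hα4 := four_mul_alpha_le_one hε hε'
  have hs : 0 < step T ε := mul_pos (mul_pos hα hε) hm
  have hM0 : 0 ≤ T.Dmax := by
    obtain ⟨x, hx, -⟩ := T.exists_leaf T.root
    exact (dist_nonneg hw x).trans (dist_le_Dmax hx)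
  -- the two steps together cost a factor of at most `1 + 33 / 10 * ε`
  obtain ⟨S₀, hS₀⟩ := exists_solution_mul_cost_lt hw hk hm
    (a := 1 + 33 / 10 * ε) (b := 1 + 4 * ε) (by positivity) (by linarith)
  have hcap : ∀ i, #{x | S₀.visitor x = i} ≤ k := by
    intro i
    rw [← Set.ncard_coe_finset]
    refine le_trans (le_of_eq ?_) (S₀.capacity i)
    congr 1
    ext x
    simp
  obtain ⟨J, _, t, hJcap, hJfew, hJspan⟩ := exists_few_tours_per_component S₀.visitor hw
    (fun i => by convert hcap i) hA hk (Gam_pos hε) hroot hα hα4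
    (fun x hx => dist_le_Dmax hx) (fun x hx => Dmin_le_dist hx) hm
  have hceil : ⌈alpha ε * k⌉₊ ≤ k := Nat.ceil_le.2 (by
    have : (0 : ℝ) ≤ k := Nat.cast_nonneg k
    nlinarith)
  obtain ⟨d, place, hplace, S, hSfew, hSdemand, hScost⟩ :=
    exists_rearranged_solution hA hw hs hroot t hceil hJcap (beta_pos hε) (beta_le_half hε hε')
  refine ⟨d, place, hplace, S, fun c => ?_, fun z hz => ?_, ?_⟩
  · exact (Nat.cast_le.2 (hSfew c)).trans (hJfew c)
  · obtain ⟨X, h1, h2, h3⟩ := hSdemand z hz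
    exact ⟨X, h1, fun m hm => ⟨Nat.ceil_le.1 (h2 m hm).1, (h2 m hm).2⟩, h3⟩
  · have h1 := sum_spanWeight_hat_le hw hs hk hα (beta_pos hε).le hm (fun x hx => dist_le_Dmax hx)
      hM0 (fun x hx => Dmin_le_dist hx) t hJcap
    have h2 := rounding_factor_le hε hε' hm hdist.le
    have h3 := local_factor_le hε hε' hm hdist.le
    have h4 := two_mul_totalSpan_le_cost hw S₀
    have h5 : 0 ≤ totalSpan t := sum_nonneg fun j _ => spanWeight_nonneg hw _
    have h6 : 0 ≤ totalSpan S₀.visitor := sum_nonneg fun j _ => spanWeight_nonneg hw _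
    have h7 : totalSpan t ≤ (1 + 5 / 3 * ε) * totalSpan S₀.visitor :=
      hJspan.trans (mul_le_mul_of_nonneg_right h3 h6)
    have h8 : (1 + 9 / 8 * ε) * (1 + 5 / 3 * ε) ≤ 1 + 33 / 10 * ε := by nlinarith
    calc S.cost ≤ 2 * ((1 + 9 / 8 * ε) * totalSpan t) :=
          hScost.trans (mul_le_mul_of_nonneg_left
            (h1.trans (mul_le_mul_of_nonneg_right h2 h5)) zero_le_two)
      _ ≤ 2 * ((1 + 9 / 8 * ε) * ((1 + 5 / 3 * ε) * totalSpan S₀.visitor)) := by gcongr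
      _ = (1 + 9 / 8 * ε) * (1 + 5 / 3 * ε) * (2 * totalSpan S₀.visitor) := by ring
      _ ≤ (1 + 33 / 10 * ε) * (2 * totalSpan S₀.visitor) := by gcongr
      _ ≤ (1 + 33 / 10 * ε) * S₀.cost := by gcongr
      _ < (1 + 4 * ε) * opt T k := hS₀

end Reduction

/-! ### Existence of a component decomposition -/

section Existence

open Decomposition

variable {V : Type*} [Fintype V] {T : RootedTree V}

variable (T) in
/-- The leaves below `v`. -/
def leavesBelow (v : V) : Finset V := {x | x ∈ T.leaves ∧ T.IsAncestor v x}
variable (T) in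
/-- There are at least `θ` leaves below `v`. -/
def IsHeavy (θ : ℝ) (v : V) : Prop := θ ≤ #(leavesBelow T v)

variable (T) in
/-- There are two heavy children of `v`. -/
def Splits (θ : ℝ) (v : V) : Prop :=
  ∃ a ∈ T.children v, ∃ b ∈ T.children v, a ≠ b ∧ IsHeavy T θ a ∧ IsHeavy T θ b

theorem mem_leavesBelow {v x : V} : x ∈ leavesBelow T v ↔ x ∈ T.leaves ∧ T.IsAncestor v x := by
  simp [leavesBelow]

variable (T) in
/-- The recursion that defines the cut vertices, from the leaves upwards, has a solution. -/
theorem exists_isCut (θ : ℝ) : ∃ cut : V → Prop, ∀ v, cut v ↔ v = T.root ∨ Splits T θ v ∨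
    θ ≤ #{x ∈ leavesBelow T v | ∀ u, u ≠ v → T.IsAncestor v u → T.IsAncestor u x → ¬ cut u} := by
  have hwf : WellFounded fun u v : V => u ≠ v ∧ T.IsAncestor v u := by
    have : IsTrans V fun u v : V => u ≠ v ∧ T.IsAncestor v u := ⟨fun a b c h1 h2 =>
      ⟨fun h => h2.1 ((h ▸ h1.2 : T.IsAncestor b c).antisymm h2.2), h2.2.trans h1.2⟩⟩
    have : Std.Irrefl fun u v : V => u ≠ v ∧ T.IsAncestor v u := ⟨fun a h => h.1 rfl⟩
    exact Finite.wellFounded_of_trans_of_irrefl _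
  refine ⟨hwf.fix fun v cut => v = T.root ∨ Splits T θ v ∨ θ ≤ #{x ∈ leavesBelow T v |
    ∀ u, ∀ h1 : u ≠ v, ∀ h2 : T.IsAncestor v u, T.IsAncestor u x → ¬ cut u ⟨h1, h2⟩}, fun v => ?_⟩
  rw [hwf.fix_eq]

variable (T) in
/-- The vertices at which the tree is cut: the root, the vertices with two heavy children, and,
from the leaves upwards, each vertex below which at least `θ` leaves have not been cut off yet. -/
def IsCut (θ : ℝ) : V → Prop := Classical.choose (exists_isCut T θ)

variable (T) in
/-- The leaves below `v` that have not been cut off below `v`. -/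
def openLeaves (θ : ℝ) (v : V) : Finset V :=
  {x ∈ leavesBelow T v | ∀ u, u ≠ v → T.IsAncestor v u → T.IsAncestor u x → ¬ IsCut T θ u}

variable {θ : ℝ}

theorem isCut_iff {v : V} :
    IsCut T θ v ↔ v = T.root ∨ Splits T θ v ∨ θ ≤ #(openLeaves T θ v) := by
  rw [openLeaves]
  exact Classical.choose_spec (exists_isCut T θ) v

theorem isCut_root : IsCut T θ T.root := isCut_iff.2 (Or.inl rfl)

theorem mem_openLeaves {v x : V} : x ∈ openLeaves T θ v ↔ x ∈ T.leaves ∧ T.IsAncestor v x ∧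
    ∀ u, u ≠ v → T.IsAncestor v u → T.IsAncestor u x → ¬ IsCut T θ u := by
  simp [openLeaves, mem_leavesBelow, and_assoc]

theorem IsHeavy.of_isAncestor {u v : V} (hv : IsHeavy T θ v) (h : T.IsAncestor u v) :
    IsHeavy T θ u :=
  hv.trans (Nat.cast_le.2 (card_le_card fun x hx => by
    rw [mem_leavesBelow] at hx ⊢
    exact ⟨hx.1, h.trans hx.2⟩))

theorem IsCut.isHeavy {v : V} (h : IsCut T θ v) (hv : v ≠ T.root) : IsHeavy T θ v := by
  rcases isCut_iff.1 h with h | ⟨a, ha, -, -, -, h, -⟩ | h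
  · exact absurd h hv
  · exact h.of_isAncestor (ha.2 ▸ T.isAncestor_parent a)
  · exact h.trans (Nat.cast_le.2 (card_le_card (filter_subset _ _)))

theorem openLeaves_eq {v : V} (h : ∀ u, u ≠ v → T.IsAncestor v u → ¬ IsCut T θ u) :
    openLeaves T θ v = leavesBelow T v :=
  filter_true_of_mem fun _ _ u h1 h2 _ => h u h1 h2

theorem IsHeavy.exists_isCut {v : V} (hv : IsHeavy T θ v) :
    ∃ u, T.IsAncestor v u ∧ IsCut T θ u := by
  by_contra hno
  push Not at hno
  refine hno v (T.isAncestor_refl v) (isCut_iff.2 (Or.inr (Or.inr ?_)))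
  rw [openLeaves_eq fun u _ h => hno u h]
  exact hv

theorem not_isHeavy_of_leaf (hθ : 1 < θ) {x : V} (hx : x ∈ T.leaves) : ¬ IsHeavy T θ x := by
  have h : leavesBelow T x ⊆ {x} := fun y hy => by
    rw [mem_leavesBelow] at hy
    rw [mem_singleton]
    exact (eq_of_isAncestor_of_leaf hx hy.2).symm
  have h1 : (#(leavesBelow T x) : ℝ) ≤ 1 := by exact_mod_cast card_le_card h
  rw [IsHeavy]
  linarith

theorem notMem_leaves_of_isCut (hθ : 1 < θ) (hroot : T.root ∉ T.leaves) {v : V}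
    (hv : IsCut T θ v) : v ∉ T.leaves := fun h => by
  by_cases hv0 : v = T.root
  · exact hroot (hv0 ▸ h)
  · exact not_isHeavy_of_leaf hθ h (hv.isHeavy hv0)

theorem exists_mem_children {v : V} (hv : v ∉ T.leaves) : ∃ u, u ∈ T.children v := by
  by_contra hno
  push Not at hno
  exact hv (Set.eq_empty_of_forall_notMem hno)

variable (T θ) in
/-- The topmost edge on the way from `v` to the next cut vertex above `v`. -/
def anchor (v : V) : V :=
  if _h : v = T.root ∨ IsCut T θ (T.parent v) then v else anchor (T.parent v)
termination_by T.depth v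
decreasing_by exact T.depth_parent v fun h => _h (Or.inl h)

theorem anchor_eq_self {v : V} (h : IsCut T θ (T.parent v)) : anchor T θ v = v := by
  rw [anchor, dif_pos (Or.inr h)]

theorem anchor_eq_parent {v : V} (hv : v ≠ T.root) (h : ¬ IsCut T θ (T.parent v)) :
    anchor T θ v = anchor T θ (T.parent v) := by
  rw [anchor, dif_neg (not_or.2 ⟨hv, h⟩)]

theorem anchor_spec {v : V} (hv : v ≠ T.root) : anchor T θ v ≠ T.root ∧
    T.IsAncestor (anchor T θ v) v ∧ IsCut T θ (T.parent (anchor T θ v)) := by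
  suffices H : ∀ n v, T.depth v ≤ n → v ≠ T.root → anchor T θ v ≠ T.root ∧
      T.IsAncestor (anchor T θ v) v ∧ IsCut T θ (T.parent (anchor T θ v)) from H _ v le_rfl hv
  intro n
  induction n with
  | zero => exact fun v hd hv => absurd (depth_eq_zero.1 (Nat.le_zero.1 hd)) hv
  | succ n ih =>
    intro v hd hv
    by_cases h : IsCut T θ (T.parent v)
    · rw [anchor_eq_self h]
      exact ⟨hv, T.isAncestor_refl v, h⟩
    · rw [anchor_eq_parent hv h]
      have := T.depth_parent v hv
      obtain ⟨h1, h2, h3⟩ := ih (T.parent v) (by omega) fun h4 => h (h4 ▸ isCut_root)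
      exact ⟨h1, h2.trans (T.isAncestor_parent v), h3⟩

/-- The component of an edge: below a vertex with two heavy children each child edge has its own
component, below any other cut vertex both child edges belong to the same component. -/
def compKey (T : RootedTree V) (θ : ℝ) (v : V) : V × Bool :=
  if Splits T θ (T.parent (anchor T θ v)) then (anchor T θ v, true)
  else (T.parent (anchor T θ v), false)

/-- The root of a component. -/
def keyTop (T : RootedTree V) (p : V × Bool) : V := if p.2 then T.parent p.1 else p.1

theorem keyTop_compKey (v : V) : keyTop T (compKey T θ v) = T.parent (anchor T θ v) := by
  unfold compKey keyTop
  split_ifs with h1 h2 h3 <;> simp_all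

theorem compKey_eq_parent {v : V} (hv : v ≠ T.root) (h : ¬ IsCut T θ (T.parent v)) :
    compKey T θ v = compKey T θ (T.parent v) := by
  rw [compKey, compKey, anchor_eq_parent hv h]

variable [DecidableEq V]

/-- The decomposition into the fibers of a function on the edges. -/
theorem exists_decomposition_of_key {κ : Type*} (key : V → κ) (top : κ → V)
    (h1 : ∀ v, v ≠ T.root → top (key v) ≠ T.root → key (top (key v)) ≠ key v)
    (h2 : ∀ v, v ≠ T.root →
      T.parent v = top (key v) ∨ T.parent v ≠ T.root ∧ key (T.parent v) = key v) :
    ∃ (D : Decomposition T) (keyOf : D.Comp → κ),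
      (∀ c v, v ∈ c.1 ↔ v ≠ T.root ∧ key v = keyOf c) ∧ ∀ c, D.top c = top (keyOf c) := by
  set P : Finpartition T.edges := Finpartition.ofSetSetoid (Setoid.ker key) T.edges with hP
  have hedges : ∀ v, v ∈ T.edges ↔ v ≠ T.root := fun v => by simp [RootedTree.edges]
  choose rep hrep using fun c : {c // c ∈ P.parts} => P.nonempty_of_mem_parts c.2
  have hmem : ∀ (c : {c // c ∈ P.parts}) v, v ∈ c.1 ↔ v ≠ T.root ∧ key v = key (rep c) := by
    intro c v
    rw [← P.part_eq_of_mem c.2 (hrep c), Finpartition.mem_part_ofSetSetoid_iff_rel, hedges]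
    have hr := (hedges _).1 (P.le c.2 (hrep c))
    rw [hedges]
    simp only [hr, ne_eq, not_false_eq_true, true_and]
    exact and_congr_right fun _ => eq_comm
  refine ⟨⟨P, fun c => top (key (rep c)), fun c hc => ?_, fun c v hv => ?_⟩, fun c => key (rep c),
    hmem, fun c => rfl⟩
  · obtain ⟨h3, h4⟩ := (hmem c _).1 hc
    exact h1 _ ((hmem c _).1 (hrep c)).1 h3 h4
  · obtain ⟨h3, h4⟩ := (hmem c v).1 hv
    rw [hmem, ← h4]
    exact h2 v h3

variable (T θ) in
/-- A decomposition of `T` whose components are the fibers of `compKey`. -/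
structure CutDecomposition extends Decomposition T where
  keyOf : toDecomposition.Comp → V × Bool
  mem_iff : ∀ c v, v ∈ c.1 ↔ v ≠ T.root ∧ compKey T θ v = keyOf c
  top_eq : ∀ c, top c = keyTop T (keyOf c)

/-- The recursive structure of `anchor` makes the fibers of `compKey` connected. -/
theorem exists_cutDecomposition : Nonempty (CutDecomposition T θ) := by
  obtain ⟨D, keyOf, h1, h2⟩ := exists_decomposition_of_key (T := T) (compKey T θ) (keyTop T)
    (fun v hv hne heq => by
      have h3 := anchor_spec (θ := θ) hv
      have h4 := anchor_spec (θ := θ) hne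
      have h5 := congrArg (keyTop T) heq
      rw [keyTop_compKey, keyTop_compKey] at h5
      rw [keyTop_compKey] at h4
      have h6 := h4.2.1.depth_le
      have h7 := T.depth_parent _ h4.1
      rw [h5] at h7
      omega)
    (fun v hv => by
      rw [keyTop_compKey]
      by_cases h : IsCut T θ (T.parent v)
      · rw [anchor_eq_self h]
        exact Or.inl rfl
      · exact Or.inr ⟨fun h1 => h (h1 ▸ isCut_root), (compKey_eq_parent hv h).symm⟩)
  exact ⟨⟨D, keyOf, h1, h2⟩⟩

end Existence

section Existence

open Decomposition

variable {V : Type*} [Fintype V] {T : RootedTree V} {θ : ℝ}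

/-- In a binary tree, both children of a vertex with two heavy children are heavy. -/
theorem Splits.isHeavy (hT : T.IsBinary) {u a : V} (h : Splits T θ u) (ha : a ∈ T.children u) :
    IsHeavy T θ a := by
  obtain ⟨p, hp, q, hq, hne, h1, h2⟩ := h
  have hleaf : u ∉ T.leaves := fun h => by
    rw [show T.children u = ∅ from h] at hp
    exact hp
  have h3 : ({p, q} : Set V) = T.children u := by
    refine Set.eq_of_subset_of_ncard_le ?_ ?_ (Set.toFinite _)
    · rintro x (rfl | rfl)
      · exact hp
      · exact hq
    · rw [hT u hleaf, Set.ncard_pair hne]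
  rw [← h3] at ha
  rcases ha with rfl | rfl
  · exact h1
  · exact h2

variable [DecidableEq V]

namespace CutDecomposition

variable (E : CutDecomposition T θ) {c c' : E.Comp}

theorem keyOf_injective (h : E.keyOf c = E.keyOf c') : c = c' := by
  obtain ⟨v, hv⟩ := comp_nonempty c
  have h1 := (E.mem_iff c v).1 hv
  exact comp_eq_of_mem hv ((E.mem_iff c' v).2 ⟨h1.1, h1.2.trans h⟩)

theorem isCut_top (c : E.Comp) : IsCut T θ (E.top c) := by
  obtain ⟨v, hv⟩ := comp_nonempty c
  obtain ⟨h1, h2⟩ := (E.mem_iff c v).1 hv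
  rw [E.top_eq, ← h2, keyTop_compKey]
  exact (anchor_spec h1).2.2

theorem parent_eq_top {v : V} (hv : v ∈ c.1) (h : IsCut T θ (T.parent v)) :
    T.parent v = E.top c := by
  obtain ⟨-, h1⟩ := (E.mem_iff c v).1 hv
  rw [E.top_eq, ← h1, keyTop_compKey, anchor_eq_self h]

theorem mem_of_parent_mem {v : V} (hv : v ≠ T.root) (h : T.parent v ∈ c.1)
    (h1 : ¬ IsCut T θ (T.parent v)) : v ∈ c.1 := by
  rw [E.mem_iff, compKey_eq_parent hv h1]
  exact ⟨hv, ((E.mem_iff c _).1 h).2⟩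

theorem mem_of_forall_not_isCut {u v : V} (hu : u ∈ c.1) (h : T.IsAncestor u v)
    (h1 : ∀ x, T.IsAncestor u x → T.IsAncestor x v → x ≠ v → ¬ IsCut T θ x) : v ∈ c.1 := by
  refine h.induction (p := fun v => (∀ x, T.IsAncestor u x → T.IsAncestor x v → x ≠ v →
    ¬ IsCut T θ x) → v ∈ c.1) (fun _ => hu) (fun v hv h2 ih h3 => ?_) h1
  have h4 := T.isAncestor_parent v
  refine E.mem_of_parent_mem hv (ih fun x h5 h6 _ => h3 x h5 (h6.trans h4) ?_)
    (h3 _ h2 h4 (parent_ne hv))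
  rintro rfl
  exact not_isAncestor_parent hv h6

/-- Nothing in a component lies below a cut vertex in that component. -/
theorem eq_of_isCut_of_isAncestor {u v : V} (hu : u ∈ c.1) (hv : v ∈ c.1) (h : IsCut T θ u)
    (h1 : T.IsAncestor u v) : u = v := by
  by_contra hne
  obtain ⟨w, h2, h3, h4⟩ := h1.exists_child hne
  have h5 : T.IsAncestor u w := h3 ▸ T.isAncestor_parent w
  have h6 : w ∈ c.1 := mem_of_isAncestor hv h4 ((top_isAncestor hu).trans h5) fun h7 => by
    have h8 := depth_top_lt hu
    rw [h7] at h8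
    exact absurd h5.depth_le (not_le.2 h8)
  have h7 := E.parent_eq_top h6 (h3.symm ▸ h)
  exact top_ne hu (h7.symm.trans h3)

theorem keyOf_of_splits {a : V} (ha : a ∈ c.1) (h : T.parent a = E.top c)
    (hs : Splits T θ (E.top c)) : E.keyOf c = (a, true) := by
  have h1 : anchor T θ a = a := anchor_eq_self (h ▸ E.isCut_top c)
  rw [← ((E.mem_iff c a).1 ha).2, compKey, h1, h, if_pos hs]

theorem keyOf_of_not_splits (hs : ¬ Splits T θ (E.top c)) : E.keyOf c = (E.top c, false) := by
  obtain ⟨a, ha, h⟩ := exists_child_top c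
  have h1 : anchor T θ a = a := anchor_eq_self (h ▸ E.isCut_top c)
  rw [← ((E.mem_iff c a).1 ha).2, compKey, h1, h, if_neg hs]

theorem mem_of_not_splits {a : V} (ha : a ≠ T.root) (h : T.parent a = E.top c)
    (hs : ¬ Splits T θ (E.top c)) : a ∈ c.1 := by
  have h1 : anchor T θ a = a := anchor_eq_self (h ▸ E.isCut_top c)
  rw [E.mem_iff, E.keyOf_of_not_splits hs, compKey, h1, h, if_neg hs]
  exact ⟨ha, rfl⟩

/-- The heavy vertices of a component lie on one path. -/
theorem isAncestor_of_isHeavy {x y : V} (hx : x ∈ c.1) (hy : y ∈ c.1) (h : IsHeavy T θ x)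
    (h' : IsHeavy T θ y) (hd : T.depth x ≤ T.depth y) : T.IsAncestor x y := by
  suffices H : ∀ n, ∀ x ∈ c.1, T.depth x ≤ n → IsHeavy T θ x → T.depth x ≤ T.depth y →
      T.IsAncestor x y from H _ x hx le_rfl h hd
  intro n
  induction n with
  | zero =>
    intro x hx hn
    exact absurd (depth_eq_zero.1 (Nat.le_zero.1 hn)) (ne_root_of_mem hx)
  | succ n ih =>
    intro x hx hn h hd
    have hx0 := ne_root_of_mem hx
    have h0 := T.depth_parent x hx0
    rcases E.connected c x hx with h1 | h1
    · obtain ⟨w, h2, h3, h4⟩ := (top_isAncestor hy).exists_child (top_ne hy)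
      have h5 : w ∈ c.1 := mem_of_isAncestor hy h4 (h3 ▸ T.isAncestor_parent w)
        (h3 ▸ parent_ne h2)
      have h6 : x = w := by
        by_cases hs : Splits T θ (E.top c)
        · exact congrArg Prod.fst ((E.keyOf_of_splits hx h1 hs).symm.trans
            (E.keyOf_of_splits h5 h3 hs))
        · by_contra hne
          exact hs ⟨x, ⟨hx0, h1⟩, w, ⟨h2, h3⟩, hne, h, h'.of_isAncestor h4⟩
      rw [h6]
      exact h4
    · have h2 := ih _ h1 (by omega) (h.of_isAncestor (T.isAncestor_parent x)) (by omega)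
      obtain ⟨w, h3, h4, h5⟩ := h2.exists_child (fun h => by rw [h] at h0; omega)
      by_cases hxw : x = w
      · rw [hxw]
        exact h5
      · exfalso
        have h6 : IsCut T θ (T.parent x) := isCut_iff.2 (Or.inr (Or.inl
          ⟨x, ⟨hx0, rfl⟩, w, ⟨h3, h4⟩, hxw, h, h'.of_isAncestor h5⟩))
        rw [E.parent_eq_top hx h6] at h1
        exact E.top_notMem c h1

theorem eq_of_isCut {x y : V} (hx : x ∈ c.1) (hy : y ∈ c.1) (h : IsCut T θ x)
    (h' : IsCut T θ y) : x = y := by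
  have hx' := h.isHeavy (ne_root_of_mem hx)
  have hy' := h'.isHeavy (ne_root_of_mem hy)
  rcases le_total (T.depth x) (T.depth y) with hd | hd
  · exact E.eq_of_isCut_of_isAncestor hx hy h (E.isAncestor_of_isHeavy hx hy hx' hy' hd)
  · exact (E.eq_of_isCut_of_isAncestor hy hx h' (E.isAncestor_of_isHeavy hy hx hy' hx' hd)).symm

/-- A component that is continued further down is continued at a cut vertex. -/
theorem exists_isCut_mem (hT : T.IsBinary) (hc : ¬ E.IsLeaf c) : ∃ e ∈ c.1, IsCut T θ e := by
  by_contra hno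
  push Not at hno
  have hdown : ∀ {u v}, u ∈ c.1 → T.IsAncestor u v → v ∈ c.1 := fun {u v} hu h =>
    h.induction (p := fun v => v ∈ c.1) hu fun v hv _ ih =>
      E.mem_of_parent_mem hv ih (hno _ ih)
  obtain ⟨a, ha, h⟩ := exists_child_top c
  simp only [Decomposition.IsLeaf, not_forall] at hc
  obtain ⟨u, hu, hu'⟩ := hc
  rw [mem_verts, not_or] at hu'
  obtain ⟨w, h1, h2, h3⟩ := hu.exists_child (Ne.symm hu'.1)
  by_cases hs : Splits T θ (E.top c)
  · obtain ⟨x, h4, h5⟩ := (hs.isHeavy hT ⟨ne_root_of_mem ha, h⟩).exists_isCut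
    exact hno x (hdown ha h4) h5
  · exact hu'.2 (hdown (E.mem_of_not_splits h1 h2 hs) h3)

/-- A component has at most two topmost edges. Below each of them there are less than `θ` leaves
that have not been cut off, since otherwise the tree would have been cut there. -/
theorem numTerminals_le (hT : T.IsBinary) (hθ : 1 < θ) (hroot : T.root ∉ T.leaves) (c : E.Comp) :
    (E.numTerminals c : ℝ) ≤ 2 * θ := by
  set C : Finset V := {a | a ∈ T.children (E.top c)} with hC
  have hC2 : #C = 2 := by
    rw [← hT _ (notMem_leaves_of_isCut hθ hroot (E.isCut_top c)), ← Set.ncard_coe_finset]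
    congr 1
    ext a
    simp [hC]
  set L : V → Finset V := fun a => {x | x ∈ T.leaves ∧ x ∈ c.1 ∧ T.IsAncestor a x} with hL
  have hL' : ∀ a x, x ∈ L a ↔ x ∈ T.leaves ∧ x ∈ c.1 ∧ T.IsAncestor a x := fun a x => by simp [hL]
  have hsub : (E.terminals c).map (Function.Embedding.subtype _) ⊆ C.biUnion L := by
    intro x hx
    obtain ⟨y, hy, rfl⟩ := mem_map.1 hx
    have hxc := mem_terminals.1 hy
    obtain ⟨w, h2, h3, h4⟩ := (top_isAncestor hxc).exists_child (top_ne hxc)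
    exact mem_biUnion.2 ⟨w, by simpa [hC] using ⟨h2, h3⟩, (hL' _ _).2 ⟨y.2, hxc, h4⟩⟩
  have hcard : ∀ a ∈ C, (#(L a) : ℝ) ≤ θ := by
    intro a ha
    have ha' : a ∈ T.children (E.top c) := by simpa [hC] using ha
    have hac : ∀ x ∈ L a, a ∈ c.1 := fun x hx => mem_of_isAncestor ((hL' _ _).1 hx).2.1
      ((hL' _ _).1 hx).2.2 (ha'.2 ▸ T.isAncestor_parent a) (ha'.2 ▸ parent_ne ha'.1)
    by_cases hcut : IsCut T θ a
    · have : L a = ∅ := by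
        by_contra hne
        obtain ⟨x, hx⟩ := nonempty_iff_ne_empty.2 hne
        obtain ⟨h1, h2, h3⟩ := (hL' _ _).1 hx
        have h4 := E.eq_of_isCut_of_isAncestor (hac x hx) h2 hcut h3
        exact notMem_leaves_of_isCut hθ hroot hcut (h4 ▸ h1)
      rw [this, card_empty, Nat.cast_zero]
      linarith
    · have hopen : L a ⊆ openLeaves T θ a := by
        intro x hx
        obtain ⟨h1, h2, h3⟩ := (hL' _ _).1 hx
        refine mem_openLeaves.2 ⟨h1, h3, fun u h4 h5 h6 h7 => ?_⟩
        have h8 : u ∈ c.1 := mem_of_isAncestor h2 h6 ((top_isAncestor (hac x hx)).trans h5)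
          fun h9 => not_isAncestor_top (hac x hx) (h9 ▸ h5)
        have h9 := E.eq_of_isCut_of_isAncestor h8 h2 h7 h6
        exact notMem_leaves_of_isCut hθ hroot h7 (h9 ▸ h1)
      have h1 : ¬ θ ≤ #(openLeaves T θ a) := fun h => hcut (isCut_iff.2 (Or.inr (Or.inr h)))
      exact (Nat.cast_le.2 (card_le_card hopen)).trans (not_le.1 h1).le
  rw [numTerminals_eq, ← card_map (Function.Embedding.subtype _)]
  calc ((#((E.terminals c).map (Function.Embedding.subtype _)) : ℕ) : ℝ)
      ≤ ∑ a ∈ C, (#(L a) : ℝ) := by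
        exact_mod_cast (card_le_card hsub).trans card_biUnion_le
    _ ≤ #C • θ := sum_le_card_nsmul _ _ _ hcard
    _ = 2 * θ := by rw [hC2, nsmul_eq_mul, Nat.cast_ofNat]

/-- Apart from the components below vertices with two heavy children, only the component of the
root may fail to be big. -/
theorem le_numTerminals (hθ : 1 < θ) (hroot : T.root ∉ T.leaves)
    (hs : ¬ Splits T θ (E.top c)) (h : θ ≤ #(openLeaves T θ (E.top c))) :
    θ ≤ E.numTerminals c := by
  refine h.trans (Nat.cast_le.2 ?_)
  rw [numTerminals_eq, ← card_map (Function.Embedding.subtype _)]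
  refine card_le_card fun x hx => ?_
  obtain ⟨h1, h2, h3⟩ := mem_openLeaves.1 hx
  have hne : E.top c ≠ x := fun h =>
    notMem_leaves_of_isCut hθ hroot (E.isCut_top c) (h ▸ h1)
  obtain ⟨w, h4, h5, h6⟩ := h2.exists_child hne
  have h7 := E.mem_of_not_splits h4 h5 hs
  refine mem_map.2 ⟨⟨x, h1⟩, mem_terminals.2 ?_, rfl⟩
  refine E.mem_of_forall_not_isCut h7 h6 fun y h8 h9 _ => h3 y ?_ ((top_isAncestor h7).trans h8) h9
  rintro rfl
  exact not_isAncestor_top h7 h8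

theorem not_splits_of_isLeaf (hc : E.IsLeaf c) : ¬ Splits T θ (E.top c) := by
  intro hs
  obtain ⟨a, ha, b, hb, hne, -⟩ := id hs
  have key : ∀ {a}, a ∈ T.children (E.top c) → E.keyOf c = (a, true) := fun {a} ha => by
    have h1 := hc a (ha.2 ▸ T.isAncestor_parent a)
    refine E.keyOf_of_splits ((mem_verts.1 h1).resolve_left ?_) ha.2 hs
    rw [← ha.2]
    exact (parent_ne ha.1).symm
  exact hne (congrArg Prod.fst ((key ha).symm.trans (key hb)))

theorem le_numTerminals_of_isLeaf (hθ : 1 < θ) (hroot : T.root ∉ T.leaves)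
    (hheavy : IsHeavy T θ T.root) (hc : E.IsLeaf c) : θ ≤ E.numTerminals c := by
  refine E.le_numTerminals hθ hroot (E.not_splits_of_isLeaf hc) ?_
  rw [openLeaves_eq]
  · by_cases h : E.top c = T.root
    · rw [h]
      exact hheavy
    · exact (E.isCut_top c).isHeavy h
  · intro u hu h1 h2
    have h3 : u ∈ c.1 := (mem_verts.1 (hc u h1)).resolve_left hu
    obtain ⟨w, hw0, hw⟩ := exists_mem_children (notMem_leaves_of_isCut hθ hroot h2)
    have h4 : T.IsAncestor u w := hw ▸ T.isAncestor_parent w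
    have h5 : w ∈ c.1 := (mem_verts.1 (hc w (h1.trans h4))).resolve_left fun h =>
      not_isAncestor_top h3 (h ▸ h4)
    exact hu (hw.symm.trans (E.parent_eq_top h5 (hw.symm ▸ h2)))

/-- If the whole tree has less than `θ` leaves, the only cut vertex is the root. -/
theorem card_parts_le_one (h : ¬ IsHeavy T θ T.root) : #E.partition.parts ≤ 1 := by
  have key : ∀ c : E.Comp, E.keyOf c = (T.root, false) := by
    intro c
    have h1 : E.top c = T.root := by
      by_contra hne
      exact h (((E.isCut_top c).isHeavy hne).of_isAncestor (T.isAncestor_root _))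
    rw [E.keyOf_of_not_splits, h1]
    rintro ⟨a, -, -, -, -, h2, -⟩
    exact h (h2.of_isAncestor (T.isAncestor_root _))
  exact card_le_one.2 fun a ha b hb => congrArg Subtype.val
    (E.keyOf_injective (c := ⟨a, ha⟩) (c' := ⟨b, hb⟩) ((key _).trans (key _).symm))

/-- At a heavy vertex without heavy children there is a big component. -/
theorem exists_big (hθ : 1 < θ) (hroot : T.root ∉ T.leaves) {l : V} (hl : IsHeavy T θ l)
    (hl' : ∀ u ∈ T.children l, ¬ IsHeavy T θ u) :
    ∃ b : E.Comp, E.top b = l ∧ ¬ Splits T θ l ∧ θ ≤ E.numTerminals b := by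
  have hbelow : ∀ u, u ≠ l → T.IsAncestor l u → ¬ IsCut T θ u := by
    intro u hu h1 h2
    obtain ⟨w, h3, h4, h5⟩ := h1.exists_child (Ne.symm hu)
    exact hl' w ⟨h3, h4⟩ ((h2.isHeavy (h5.ne_root h3)).of_isAncestor h5)
  have hcut : IsCut T θ l := by
    obtain ⟨u, h1, h2⟩ := hl.exists_isCut
    by_cases hu : u = l
    · exact hu ▸ h2
    · exact absurd h2 (hbelow u hu h1)
  have hs : ¬ Splits T θ l := fun ⟨a, ha, _, _, _, h, _⟩ => hl' a ha h
  obtain ⟨w, hw0, hw⟩ := exists_mem_children (notMem_leaves_of_isCut hθ hroot hcut)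
  obtain ⟨b, hb⟩ := exists_comp (D := E.toDecomposition) hw0
  have htop : E.top b = l := (E.parent_eq_top hb (hw.symm ▸ hcut)).symm.trans hw
  refine ⟨b, htop, hs, E.le_numTerminals hθ hroot (htop.symm ▸ hs) ?_⟩
  rw [htop, openLeaves_eq hbelow]
  exact hl

end CutDecomposition

end Existence

/-- Following an injective relation as long as possible leads from different sources (elements
without predecessors) to different sinks. -/
theorem exists_injective_descent {S : Type*} [Finite S] (R : S → S → Prop)
    (hinj : ∀ a a' b, R a b → R a' b → a = a') (rank : S → ℕ)
    (hrank : ∀ a b, R a b → rank a < rank b) :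
    ∃ f : S → S, (∀ a, Relation.ReflTransGen R a (f a) ∧ ∀ b, ¬ R (f a) b) ∧
      ∀ a a', (∀ b, ¬ R b a) → (∀ b, ¬ R b a') → f a = f a' → a = a' := by
  have hex : ∀ a, ∃ x, Relation.ReflTransGen R a x ∧ ∀ b, ¬ R x b := by
    intro a
    obtain ⟨x, hx, hmax⟩ := Set.exists_max_image {x | Relation.ReflTransGen R a x} rank
      (Set.toFinite _) ⟨a, .refl⟩
    exact ⟨x, hx, fun b hb => (hmax b (Relation.ReflTransGen.tail hx hb)).not_gt (hrank _ _ hb)⟩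
  choose f hf hf' using hex
  have htotal : ∀ a a' x, Relation.ReflTransGen R a x → Relation.ReflTransGen R a' x →
      Relation.ReflTransGen R a a' ∨ Relation.ReflTransGen R a' a := by
    intro a a' x h h'
    induction h with
    | refl => exact Or.inr h'
    | @tail y z h1 h2 ih =>
      rcases Relation.ReflTransGen.cases_tail h' with h3 | ⟨y', h3, h4⟩
      · rw [← h3]
        exact Or.inl (h1.tail h2)
      · rw [hinj y' y z h4 h2] at h3
        exact ih h3
  have hsource : ∀ a a', Relation.ReflTransGen R a a' → (∀ b, ¬ R b a') → a = a' := by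
    intro a a' h h'
    rcases Relation.ReflTransGen.cases_tail h with h1 | ⟨b, -, h1⟩
    · exact h1.symm
    · exact absurd h1 (h' b)
  refine ⟨f, fun a => ⟨hf a, hf' a⟩, fun a a' h h' heq => ?_⟩
  rcases htotal a a' (f a) (hf a) (heq ▸ hf a') with h1 | h1
  · exact hsource a a' h1 h'
  · exact (hsource a' a h1 h).symm

section Existence

open Decomposition

variable {V : Type*} [Fintype V] {T : RootedTree V} {θ : ℝ}

/-- From the slots `(u, false)` and `(u, true)` at the heavy vertices `u` one can move down to
heavy vertices without heavy children such that different starting slots lead to different slots,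
if the starting slots are of the form `(u, false)` where `u` is the root or a child of a vertex
with two heavy children. At the latter vertices the two slots are separated, so that they can use
the slots `(a, true)` and `(b, true)` of the two children, and the slots `(a, false)` and
`(b, false)` are free to be starting slots. -/
theorem exists_heavy_descent (T : RootedTree V) (θ : ℝ) : ∃ f : V × Bool → V × Bool,
    (∀ a, T.IsAncestor a.1 (f a).1 ∧ (IsHeavy T θ a.1 → IsHeavy T θ (f a).1) ∧
      ∀ u ∈ T.children (f a).1, ¬ IsHeavy T θ u) ∧
    ∀ a a', (a = T.root ∨ Splits T θ (T.parent a)) → (a' = T.root ∨ Splits T θ (T.parent a')) →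
      f (a, false) = f (a', false) → a = a' := by
  have hfirst : ∀ u, ∃ a, Splits T θ u → a ∈ T.children u ∧ IsHeavy T θ a ∧
      ∃ b ∈ T.children u, b ≠ a ∧ IsHeavy T θ b := by
    intro u
    by_cases h : Splits T θ u
    · obtain ⟨a, ha, b, hb, hne, h1, h2⟩ := h
      exact ⟨a, fun _ => ⟨ha, h1, b, hb, hne.symm, h2⟩⟩
    · exact ⟨u, fun h' => absurd h' h⟩
  choose first hfirst using hfirst
  obtain ⟨f, hf, hinj⟩ := exists_injective_descent (S := V × Bool)
    (fun a b => b.1 ∈ T.children a.1 ∧ IsHeavy T θ b.1 ∧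
      if Splits T θ a.1 then b.2 = true ∧ (a.2 = false ↔ b.1 = first a.1) else b.2 = a.2)
    (by
      rintro ⟨u, i⟩ ⟨u', i'⟩ ⟨v, j⟩ ⟨⟨-, h1⟩, -, h2⟩ ⟨⟨-, h3⟩, -, h4⟩
      simp only at h1 h2 h3 h4
      have huu : u = u' := h1.symm.trans h3
      subst huu
      refine Prod.ext rfl ?_
      split_ifs at h2 h4 with hs
      · have h5 : i = false ↔ i' = false := h2.2.trans h4.2.symm
        cases i <;> cases i' <;> simp_all
      · exact h2.symm.trans h4)
    (fun a => T.depth a.1) (fun a b h => h.1.2 ▸ T.depth_parent b.1 h.1.1)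
  refine ⟨f, fun a => ⟨?_, ?_, ?_⟩, fun a a' ha ha' h => ?_⟩
  · obtain ⟨h, -⟩ := hf a
    generalize f a = x at h
    induction h with
    | refl => exact T.isAncestor_refl _
    | tail _ h ih => exact ih.trans (h.1.2 ▸ T.isAncestor_parent _)
  · obtain ⟨h, -⟩ := hf a
    generalize f a = x at h
    intro ha
    induction h with
    | refl => exact ha
    | tail _ h _ => exact h.2.1
  · intro u hu hheavy
    obtain ⟨-, h⟩ := hf a
    by_cases hs : Splits T θ (f a).1
    · obtain ⟨h1, h2, b, h3, h4, h5⟩ := hfirst _ hs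
      rcases hj : (f a).2 with _ | _
      · exact h (first (f a).1, true) ⟨h1, h2, by simp [hs, hj]⟩
      · exact h (b, true) ⟨h3, h5, by simp [hs, hj, h4]⟩
    · exact h (u, (f a).2) ⟨hu, hheavy, by simp [hs]⟩
  · have hsource : ∀ a, (a = T.root ∨ Splits T θ (T.parent a)) → ∀ b : V × Bool,
        ¬ ((a, false).1 ∈ T.children b.1 ∧ IsHeavy T θ (a, false).1 ∧
          if Splits T θ b.1 then (a, false).2 = true ∧ (b.2 = false ↔ (a, false).1 = first b.1)
          else (a, false).2 = b.2) := by
      rintro a (rfl | ha) b ⟨h1, -, h2⟩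
      · exact h1.1 rfl
      · rw [h1.2] at ha
        rw [if_pos ha] at h2
        exact Bool.false_ne_true h2.1
    exact congrArg Prod.fst (hinj _ _ (hsource a ha) (hsource a' ha') h)

variable [DecidableEq V]

namespace CutDecomposition

variable (E : CutDecomposition T θ)

/-- A component that is not big starts with an edge from a vertex with two heavy children to one of
them, or it is the only component at the root. So it has a starting slot of its own, from which it
descends to a big component at a heavy vertex without heavy children. The two slots there and the
big component itself make at most three preimages. -/
theorem exists_map (hT : T.IsBinary) (hθ : 1 < θ) (hroot : T.root ∉ T.leaves)
    (hheavy : IsHeavy T θ T.root) : ∃ f : E.Comp → E.Comp,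
      (∀ c, θ ≤ E.numTerminals (f c) ∧ E.IsBelow c (f c)) ∧ ∀ b, {c | f c = b}.ncard ≤ 3 := by
  obtain ⟨F, hF, hFinj⟩ := exists_heavy_descent T θ
  -- the starting slot of a component that is not big
  have hslot : ∀ c : E.Comp, ¬ θ ≤ E.numTerminals c →
      (Splits T θ (E.top c) ∧ (E.keyOf c).1 ∈ c.1 ∧ T.parent (E.keyOf c).1 = E.top c ∧
        E.keyOf c = ((E.keyOf c).1, true)) ∨
      (¬ Splits T θ (E.top c) ∧ E.top c = T.root ∧ E.keyOf c = (T.root, false)) := by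
    intro c hc
    by_cases hs : Splits T θ (E.top c)
    · obtain ⟨a, ha, h⟩ := exists_child_top c
      left
      rw [E.keyOf_of_splits ha h hs]
      exact ⟨hs, ha, h, rfl⟩
    · right
      have h1 : E.top c = T.root := by
        by_contra hne
        rcases isCut_iff.1 (E.isCut_top c) with h | h | h
        · exact hne h
        · exact hs h
        · exact hc (E.le_numTerminals hθ hroot hs h)
      exact ⟨hs, h1, by rw [E.keyOf_of_not_splits hs, h1]⟩
  have hstart : ∀ c : E.Comp, ¬ θ ≤ E.numTerminals c →
      (E.keyOf c).1 = T.root ∨ Splits T θ (T.parent (E.keyOf c).1) := by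
    intro c hc
    rcases hslot c hc with ⟨h1, -, h3, -⟩ | ⟨-, -, h3⟩
    · exact Or.inr (h3.symm ▸ h1)
    · exact Or.inl (by rw [h3])
  have hstart_heavy : ∀ c : E.Comp, ¬ θ ≤ E.numTerminals c → IsHeavy T θ (E.keyOf c).1 := by
    intro c hc
    rcases hslot c hc with ⟨h1, h2, h3, -⟩ | ⟨-, -, h3⟩
    · exact h1.isHeavy hT ⟨ne_root_of_mem h2, h3⟩
    · rw [h3]
      exact hheavy
  have hinj : ∀ c c' : E.Comp, ¬ θ ≤ E.numTerminals c → ¬ θ ≤ E.numTerminals c' →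
      F ((E.keyOf c).1, false) = F ((E.keyOf c').1, false) → c = c' := by
    intro c c' hc hc' h
    have h1 := hFinj _ _ (hstart c hc) (hstart c' hc') h
    refine E.keyOf_injective ?_
    rcases hslot c hc with ⟨-, h2, -, h3⟩ | ⟨-, -, h3⟩ <;>
      rcases hslot c' hc' with ⟨-, h2', -, h3'⟩ | ⟨-, -, h3'⟩
    · rw [h3, h3', h1]
    · rw [h3'] at h1
      exact absurd h1 (ne_root_of_mem h2)
    · rw [h3] at h1
      exact absurd h1.symm (ne_root_of_mem h2')
    · rw [h3, h3']
  have htarget : ∀ c : E.Comp, ∃ b : E.Comp, θ ≤ E.numTerminals b ∧ E.IsBelow c b ∧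
      (¬ θ ≤ E.numTerminals c → E.top b = (F ((E.keyOf c).1, false)).1) ∧
      (θ ≤ E.numTerminals c → b = c) := by
    intro c
    by_cases hc : θ ≤ E.numTerminals c
    · exact ⟨c, hc, Or.inl rfl, fun h => absurd hc h, fun _ => rfl⟩
    · obtain ⟨h1, h2, h3⟩ := hF ((E.keyOf c).1, false)
      obtain ⟨b, h4, h5, h6⟩ := E.exists_big hθ hroot (h2 (hstart_heavy c hc)) h3
      refine ⟨b, h6, ?_, fun _ => h4, fun h => absurd h hc⟩
      simp only at h1
      rw [← h4] at h1 h5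
      rcases hslot c hc with ⟨-, h7, -, -⟩ | ⟨h7, h8, h9⟩
      · exact Or.inr ⟨_, h7, h1⟩
      · by_cases hb : E.top b = T.root
        · refine Or.inl (E.keyOf_injective ?_)
          rw [E.keyOf_of_not_splits h5, h9, hb]
        · obtain ⟨w, h10, h11, h12⟩ := (T.isAncestor_root (E.top b)).exists_child (Ne.symm hb)
          exact Or.inr ⟨w, E.mem_of_not_splits h10 (h11.trans h8.symm) h7, h12⟩
  choose f hf1 hf2 hf3 hf4 using htarget
  refine ⟨f, fun c => ⟨hf1 c, hf2 c⟩, fun b => ?_⟩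
  have hsub : {c | f c = b} ⊆ {b} ∪ {c | f c = b ∧ ¬ θ ≤ E.numTerminals c} := by
    intro c hc
    by_cases h : θ ≤ E.numTerminals c
    · exact Or.inl ((hf4 c h).symm.trans hc)
    · exact Or.inr ⟨hc, h⟩
  have hcard : {c | f c = b ∧ ¬ θ ≤ E.numTerminals c}.ncard ≤ 2 := by
    rw [← Set.ncard_pair (a := (E.top b, false)) (b := (E.top b, true)) (by simp)]
    refine Set.ncard_le_ncard_of_injOn (fun c => F ((E.keyOf c).1, false)) ?_ ?_ (Set.toFinite _)
    · rintro c ⟨rfl, hc⟩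
      rw [hf3 c hc]
      rcases h : (F ((E.keyOf c).1, false)).2 with _ | _
      · exact Or.inl (Prod.ext rfl h)
      · exact Or.inr (Prod.ext rfl h)
    · rintro c ⟨-, hc⟩ c' ⟨-, hc'⟩ h
      exact hinj c c' hc hc' h
  have h1 := Set.ncard_le_ncard hsub (Set.toFinite _)
  have h2 := Set.ncard_union_le {b} {c | f c = b ∧ ¬ θ ≤ E.numTerminals c}
  rw [Set.ncard_singleton] at h2
  omega

end CutDecomposition

/-- The number of components is bounded by the number of terminals in the big ones. -/
theorem Decomposition.card_parts_le {D : Decomposition T} (hθ : 0 < θ) {f : D.Comp → D.Comp}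
    (hf : ∀ c, θ ≤ D.numTerminals (f c)) (hf' : ∀ b, {c | f c = b}.ncard ≤ 3) :
    (#D.partition.parts : ℝ) * θ ≤ 3 * T.leaves.ncard := by
  set B : Finset D.Comp := univ.image f with hB
  have h1 : #D.partition.parts ≤ #B * 3 := by
    rw [← Fintype.card_coe, ← card_univ, mul_comm]
    refine card_le_mul_card_image_of_maps_to (f := f) (fun c _ => mem_image_of_mem f (mem_univ c))
      3 fun b _ => ?_
    rw [← Set.ncard_coe_finset]
    refine le_trans (le_of_eq ?_) (hf' b)
    congr 1
    ext c
    simp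
  have h2 : #B • θ ≤ ∑ b ∈ B, (#(D.terminals b) : ℝ) := by
    refine card_nsmul_le_sum _ _ _ fun b hb => ?_
    obtain ⟨c, -, rfl⟩ := mem_image.1 hb
    rw [← numTerminals_eq]
    exact hf c
  have h3 : ∑ b ∈ B, #(D.terminals b) ≤ T.leaves.ncard := by
    rw [← card_biUnion]
    · refine (card_le_univ _).trans (le_of_eq ?_)
      rw [← Nat.card_eq_fintype_card]
      rfl
    · intro b _ b' _ hne
      simp only [Function.onFun]
      rw [Finset.disjoint_left]
      exact fun x hx hx' => hne (comp_eq_of_mem (mem_terminals.1 hx) (mem_terminals.1 hx'))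
  have h4 : (#D.partition.parts : ℝ) ≤ #B * 3 := by exact_mod_cast h1
  have h5 : ∑ b ∈ B, (#(D.terminals b) : ℝ) ≤ T.leaves.ncard := by exact_mod_cast h3
  rw [nsmul_eq_mul] at h2
  calc (#D.partition.parts : ℝ) * θ ≤ #B * 3 * θ := by gcongr
    _ = 3 * (#B * θ) := by ring
    _ ≤ 3 * T.leaves.ncard := by linarith

/-- The tree is cut with the threshold `θ = Γ k`. The hypothesis on the root says that the tree does
not consist of a single vertex. -/
theorem exists_admissible (hT : T.IsBinary) (hroot : T.root ∉ T.leaves) {Γ : ℝ} {k : ℕ}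
    (hΓ : 1 < Γ) (hk : 1 ≤ k) : ∃ D : Decomposition T, D.Admissible Γ k := by
  have hk' : (1 : ℝ) ≤ k := by exact_mod_cast hk
  have hθ : 1 < Γ * k := by nlinarith
  obtain ⟨E⟩ := exists_cutDecomposition (T := T) (θ := Γ * k)
  have hheavy : 1 < #E.partition.parts → IsHeavy T (Γ * k) T.root := fun h => by
    by_contra hno
    have := E.card_parts_le_one hno
    omega
  -- a common vertex of two components is the root of one of them
  have hmeet : ∀ {c c' : E.Comp} {x}, c' ≠ c → x ∈ E.verts c → x ∈ E.verts c' →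
      x = E.top c ∨ x ∈ c.1 ∧ x = E.top c' := by
    intro c c' x hne hx hx'
    rcases mem_verts.1 hx with h | h
    · exact Or.inl h
    · rcases mem_verts.1 hx' with h' | h'
      · exact Or.inr ⟨h, h'⟩
      · exact absurd (comp_eq_of_mem h' h) hne
  refine ⟨E.toDecomposition, ?_, ?_, ?_, ?_, ?_, ?_⟩
  · intro c hc c' hne x hx hx'
    rcases hmeet hne hx hx' with h | ⟨h1, rfl⟩
    · exact h
    · obtain ⟨v, hv, hv'⟩ := exists_child_top c'
      have h2 : T.IsAncestor (E.top c') v := top_isAncestor hv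
      have h3 := hc v ((top_isAncestor h1).trans h2)
      rcases mem_verts.1 h3 with h4 | h4
      · exact absurd (h4 ▸ h2) (not_isAncestor_top h1)
      · exact absurd (comp_eq_of_mem hv h4) hne
  · intro c hc
    obtain ⟨e, he, hcut⟩ := E.exists_isCut_mem hT hc
    refine ⟨e, he, ?_, ?_, ?_⟩
    · rintro v hv rfl
      exact top_ne he (E.parent_eq_top hv hcut).symm
    · obtain ⟨w, hw0, hw⟩ := exists_mem_children (notMem_leaves_of_isCut hθ hroot hcut)
      obtain ⟨c', hc'⟩ := exists_comp (D := E.toDecomposition) hw0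
      have htop : e = E.top c' := hw.symm.trans (E.parent_eq_top hc' (hw.symm ▸ hcut))
      refine ⟨c', ?_, mem_verts.2 (Or.inl htop)⟩
      rintro rfl
      exact top_ne he htop.symm
    · intro c' hne x hx hx'
      refine (hmeet hne hx hx').imp_right ?_
      rintro ⟨h1, rfl⟩
      exact E.eq_of_isCut h1 he (E.isCut_top c') hcut
  · intro c
    have := E.numTerminals_le hT hθ hroot c
    rwa [← mul_assoc] at this
  · exact fun h c hc => E.le_numTerminals_of_isLeaf hθ hroot (hheavy h) hc
  · exact fun h => E.exists_map hT hθ hroot (hheavy h)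
  · intro h
    obtain ⟨f, hf, hf'⟩ := E.exists_map hT hθ hroot (hheavy h)
    have h1 := Decomposition.card_parts_le (by linarith) (fun c => (hf c).1) hf'
    have h2 : (#E.partition.parts : ℝ) * Γ ≤ #E.partition.parts * (Γ * k) := by
      have : Γ ≤ Γ * k := le_mul_of_one_le_right (by linarith) hk'
      gcongr
    rw [div_mul_eq_mul_div, le_div_iff₀ (by linarith)]
    exact h2.trans h1

end Existence

end TreeCVRP

end

theorem mainTheorem8 {V : Type*} [Fintype V] [DecidableEq V]
    (T : TreeCVRP.RootedTree V)
    (hweight : ∀ v, v ≠ T.root → 0 ≤ T.weight v)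
    (hbinary : T.IsBinary)
    (k : ℕ) (hk : 1 ≤ k)
    (ε : ℝ) (hε : 0 < ε) (hε' : ε ≤ 1 / 4)
    (hdist : T.BoundedDistances ε) :
    -- a component decomposition exists, and for each one:
    (∃ D : TreeCVRP.Decomposition T, D.Admissible (TreeCVRP.Gam ε) k) ∧
    ∀ D : TreeCVRP.Decomposition T, D.Admissible (TreeCVRP.Gam ε) k →
      -- there are dummy terminals at internal vertices of the reduced tree
      ∃ (d : ℕ) (place : Fin d → V ⊕ D.Comp),
        (∀ j, place j ∉ (D.hat (TreeCVRP.step T ε)).leaves) ∧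
        -- and a solution visiting the real and the dummy terminals
        ∃ S : TreeCVRP.Solution (D.hat (TreeCVRP.step T ε)) (D.hatLoc place) k,
          -- few tours visit terminals in any given component
          (∀ c : D.Comp,
            ({i | ∃ x, S.visitor x = i ∧ ∃ v ∈ c.1, D.hatLoc place x = Sum.inl v}.ncard : ℝ) ≤
              2 * TreeCVRP.Gam ε / TreeCVRP.alpha ε + 1) ∧
          -- few demands occur at the children of any given critical vertex
          (∀ z ∈ Set.range (D.critical (TreeCVRP.step T ε)),
            ∃ X : Finset ℕ, (X.card : ℝ) ≤ 1 / TreeCVRP.beta ε ∧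
              (∀ m ∈ X, TreeCVRP.alpha ε * k ≤ m ∧ m ≤ k) ∧
              ∀ u ∈ (D.hat (TreeCVRP.step T ε)).children (Sum.inl z),
                ∀ i a b, TreeCVRP.RootedTree.IsSubtour (S.tour i) u a b →
                  S.demandBetween i a b ∈ X) ∧
          S.cost < (1 + 4 * ε) * TreeCVRP.opt T k := by
  have hmin := TreeCVRP.Dmin_pos hweight hdist
  have hΓ : 1 < TreeCVRP.Gam ε := by
    rw [TreeCVRP.Gam, lt_div_iff₀ hε]
    linarith
  exact ⟨TreeCVRP.exists_admissible hbinary (TreeCVRP.root_notMem_leaves hmin) hΓ hk,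
    fun D hA => TreeCVRP.exists_structured_solution hweight hk hε hε' hdist hA⟩
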